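/- **Proposition 6.13.** Let $D\subset\mathbb{R}^2$ be a bounded simply connected domain (open set) with $0\in D$. For an integer $n\ge 1$, let $S$ be the simple random walk on $\mathbb{Z}^2$ started from $0$, let $\tau$ be the time at which it first traverses an edge which (as a closed segment) is not contained in $nD$, and let $\gamma^{nD}$ be the chronological loop-erasure of $(S_0,\dots,S_\tau)$. Let $\mathbb{L}^{\mathbb{Z}^2}$ be a random walk loop soup of intensity $1$, independent of $\gamma^{nD}$, i.e. a Poisson point process on the set of rooted, oriented nearest-neighbour loops of $\mathbb{Z}^2$ with a positive number of steps, whose intensity gives mass $4^{-k}/k$ to each loop with $k$ steps. For a loop $\mathbf{L}$, let $t_{\mathbf L}$ be its number of steps. Let $\mathbb{L}^{nD}_{\gamma^{nD}}$ be the multiset of those loops of $\mathbb{L}^{\mathbb{Z}^2}$ all of whose edges are contained in $nD$ and which intersect $\gamma^{nD}$. Under the rescaling $\mathbf L\mapsto n^{-1}\mathbf L(2n^2\,\cdot)$ a loop $\mathbf L$ has duration $t_{\mathbf L}/(2n^2)$, and for $\delta>0$ we let $$T_{\le\delta}(\mathcal{X}^n):=\sum_{\mathbf L\in\mathbb{L}^{nD}_{\gamma^{nD}},\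 t_{\mathbf L}/(2n^2)\le\delta}\frac{t_{\mathbf L}}{2n^2}$$ be the total rescaled time spent on intersected loops of rescaled duration at most $\delta$ (sums and cardinalities are with multiplicity). Then there exists $\nu>0$ such that the following two statements hold. 1. There exists $C<\infty$ such that for all positive integers $n$ and $k$, $$\mathbb{E}\big[\#\{\mathbf{L}\in\mathbb{L}^{nD}_{\gamma^{nD}}: t_{\mathbf L}=k\}\big]\le C\,n^{2-\nu}\,k^{-2}\,\max(\sqrt{k},\log n)^{\nu}.$$ 2. There exists $C<\infty$ such that for all integers $n\ge 1$ and all real $\delta>0$, $$\mathbb{E}\big[T_{\le\delta}(\mathcal{X}^n)\big]\le C\Big((\log\log n)\,(\log n)^{\nu}\,n^{-\nu}+\delta^{\nu/2}\Big),$$ where for $n\in\{1,2\}$ the first term in the parenthesis is understood to be $0$. The constants $\nu$ and $C$ depend only on $D$ (not on $n$, $k$, $\delta$, nor on the probability space or the joint law of the objects for different $n$). -/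

import Mathlib

open MeasureTheory ProbabilityTheory
open scoped ENNReal NNReal

noncomputable section

/-! ### The square lattice and the graph of lattice edges inside `nD` -/

/-- The square lattice `ℤ²`, with nearest-neighbour edges. -/
def squareLattice : SimpleGraph (ℤ × ℤ) where
  Adj x y := |x.1 - y.1| + |x.2 - y.2| = 1
  symm := ⟨fun x y h => by rw [abs_sub_comm y.1, abs_sub_comm y.2]; exact h⟩
  loopless := ⟨fun x h => by simp at h⟩

/-- The embedding of `ℤ²` in the plane. -/
def latticePoint (x : ℤ × ℤ) : ℂ := ⟨(x.1 : ℝ), (x.2 : ℝ)⟩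

/-- The dilated domain `nD`. -/
def dilate (n : ℕ) (D : Set ℂ) : Set ℂ := (fun z : ℂ => (n : ℂ) * z) '' D

/-- The closed segment from `x` to `y` is contained in `nD`. -/
def EdgeInside (D : Set ℂ) (n : ℕ) (x y : ℤ × ℤ) : Prop :=
  segment ℝ (latticePoint x) (latticePoint y) ⊆ dilate n D

/-! ### Simple random walk and loop-erased random walk -/

/-- The four unit steps of the simple random walk. -/
def unitSteps : Finset (ℤ × ℤ) := {(1, 0), (-1, 0), (0, 1), (0, -1)}

/-- The law of the sequence of steps of a simple random walk on `ℤ²`: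
independent steps, each uniform among the four unit steps. -/
def walkStepsLaw : Measure (ℕ → ℤ × ℤ) :=
  Measure.infinitePi fun _ : ℕ =>
    (PMF.uniformOfFinset unitSteps ⟨(1, 0), by simp [unitSteps]⟩).toMeasure

/-- The walk started from `0` with the given steps, at time `j`. -/
def walkAt (s : ℕ → ℤ × ℤ) (j : ℕ) : ℤ × ℤ := ∑ i ∈ Finset.range j, s i

/-- The number of steps made by the walk before its first step along an edge not contained
in `nD`. (For bounded `D` it is almost surely finite; the junk value `0` is used on the null event
that the walk never leaves `nD`.) -/
def stepsBeforeExit (D : Set ℂ) (n : ℕ) (s : ℕ → ℤ × ℤ) : ℕ :=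
  sInf {j : ℕ | ¬ EdgeInside D n (walkAt s j) (walkAt s (j + 1))}

/-- The walk stopped when it first exits `nD` (by edges), as the list `[S 0, …, S τ]` of its
successive positions, the exit step being the last one. -/
def stoppedWalk (D : Set ℂ) (n : ℕ) (s : ℕ → ℤ × ℤ) : List (ℤ × ℤ) :=
  (List.range (stepsBeforeExit D n s + 2)).map (walkAt s)

/-- The chronological loop-erasure of a finite path: the vertices are added one by one, and when
the new vertex `v` is already on the current simple path, the loop just closed at `v` is erased. -/
def loopErasure (path : List (ℤ × ℤ)) : List (ℤ × ℤ) :=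
  path.foldl (fun η v => η.takeWhile (fun u => decide (u ≠ v)) ++ [v]) []

/-- Finite lattice paths form a countable set, with its discrete σ-algebra. -/
instance latticePathMeasurableSpace : MeasurableSpace (List (ℤ × ℤ)) := ⊤

/-- The law of the loop-erased random walk `γ^{nD}` from `0` to the boundary of `nD`. -/
def lerwLaw (D : Set ℂ) (n : ℕ) : Measure (List (ℤ × ℤ)) :=
  walkStepsLaw.map fun s => loopErasure (stoppedWalk D n s)

/-! ### The random walk loop soup -/

/-- Rooted and oriented loops on the square lattice, with a positive number of steps. -/
structure LatticeLoop where
  root : ℤ × ℤ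
  walk : squareLattice.Walk root root
  length_pos : 0 < walk.length

/-- The duration of a loop parametrised at unit speed, i.e. its number of steps. -/
def LatticeLoop.duration (L : LatticeLoop) : ℕ := L.walk.length

/-- The random walk loop measure, which gives mass `4^{-k} / k` to each rooted loop
with `k` steps. -/
def loopWeight (L : LatticeLoop) : ℝ≥0 := (4⁻¹ : ℝ≥0) ^ L.duration / (L.duration : ℝ≥0)

/-- The law of the random walk loop soup with intensity `1`, i.e. of the Poisson point process
whose intensity is the random walk loop measure. The space of loops is countable and discrete, so
this point process is the family of the multiplicities of the loops, which are independent
Poisson variables. -/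
def loopSoupLaw : Measure (LatticeLoop → ℕ) :=
  Measure.infinitePi fun L => poissonMeasure (loopWeight L)

/-- All edges of the loop are contained in `nD`. -/
def LatticeLoop.Inside (D : Set ℂ) (n : ℕ) (L : LatticeLoop) : Prop :=
  ∀ d ∈ L.walk.darts, EdgeInside D n d.fst d.snd

/-- The loop and the lattice path have a common vertex. (Two lattice curves, being made of
lattice edges, intersect in the plane if and only if they have a common vertex.) -/
def LatticeLoop.Meets (γ : List (ℤ × ℤ)) (L : LatticeLoop) : Prop :=
  ∃ v ∈ L.walk.support, v ∈ γ

/-- For a path `γ` and a multiset `N` of lattice loops (given by multiplicities), the number,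
counted with multiplicity, of loops inside `nD` which meet `γ` and have duration `k`. -/
def numLoopsMeeting (D : Set ℂ) (n : ℕ) (γ : List (ℤ × ℤ)) (N : LatticeLoop → ℕ) (k : ℕ) : ℝ≥0∞ :=
  ∑' L : {L : LatticeLoop // L.Inside D n ∧ L.Meets γ ∧ L.duration = k}, (N L.1 : ℝ≥0∞)

/-- The duration of the rescaled loop `t ↦ n⁻¹ L(2 n² t)`. -/
def LatticeLoop.rescaledDuration (n : ℕ) (L : LatticeLoop) : ℝ := (L.duration : ℝ) / (2 * (n : ℝ) ^ 2)

/-- `T_{≤ δ}`: the total rescaled duration, counted with multiplicity, of the loops inside `nD`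
which meet `γ` and have rescaled duration at most `δ`. -/
def timeOnSmallLoops (D : Set ℂ) (n : ℕ) (γ : List (ℤ × ℤ)) (N : LatticeLoop → ℕ) (δ : ℝ) : ℝ≥0∞ :=
  ∑' L : {L : LatticeLoop // L.Inside D n ∧ L.Meets γ ∧ L.rescaledDuration n ≤ δ},
    (N L.1 : ℝ≥0∞) * ENNReal.ofReal (L.1.rescaledDuration n)

/-- Under `P`, the random path `γ` is a loop-erased random walk from `0` to the boundary of `nD`,
and the random multiset `N` of loops is a random walk loop soup on `ℤ²`, independent of `γ`. -/
structure IsLerwWithLoopSoup {Ω : Type*} [MeasurableSpace Ω] (P : Measure Ω) (D : Set ℂ) (n : ℕ)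
    (γ : Ω → List (ℤ × ℤ)) (N : Ω → LatticeLoop → ℕ) : Prop where
  lerw : HasLaw γ (lerwLaw D n) P
  soup : HasLaw N loopSoupLaw P
  indep : IndepFun γ N P

end

/-!
The expected number of loops of `k` steps is compared with the number of pairs `(x, l)`, where `x`
is a root and `l` a closed sequence of `k` unit steps: the loop can only meet the loop-erased walk if
the latter comes within distance `range l` of `x`. So Campbell's formula (`lintegral_tsum_meeting`)
and the independence of the walk and the soup reduce both bounds to two estimates: the range of a
closed walk of `k` steps is of order `√k` (`avg_closed_range_sq_le`), and the expected number of
vertices within distance `r` of the loop-erased walk is at most of order `n ^ 2 * (r / n) ^ ν` for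
some `ν > 0` (`sum_avg_nearAtExit_le`). The second bound of the theorem follows from the first one by
summation over `k`. The factors `log n` are not needed.

The sparsity of the loop-erased walk rests on one discrete estimate, `le_avg_hit_of_reachable`: a walk
started at distance at most `R` from `x` hits, with a probability bounded below and before a time of
order `R ^ 2`, any lattice set which connects the ball of radius `R` to distance `5 R`, where
connections by jumps of bounded length are enough. (Such a set contains `R` points with distinct values
of `x + y` or of `x - y`; these two coordinates of the walk are independent one-dimensional walks, so
that the expected number of visits to these points is of order `R`, wherever the walk starts.) It is
used in two ways.

* If the loop-erasure comes close to `x`, its part before the first close vertex connects the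
  neighbourhood of `x` to the origin. While the walk moves away from `x`, at each scale it hits this
  part with a probability bounded below, which erases the close vertices. So the probability that
  close vertices survive until the walk is at distance `s` from `x` is at most a power of `r / s`
  (`avg_nearUntilLeaving_le`).
* As the domain is simply connected, for every point `a` outside it a continuous logarithm of `z - a`
  exists inside it. Summing a discrete differential of the imaginary part around a finite set of
  faces shows that the vertices with an edge that leaves the domain are connected, by short jumps, to
  arbitrarily large distances (`exists_reachable_bad`). So the walk leaves the domain quickly once it
  is close to the boundary (`surv_le_of_close_bad`).

A vertex `x` is then close to the loop-erased walk only if the walk visits the neighbourhood of `x` and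
afterwards leaves, either out of the domain or to the distance `s`, without erasing the close
vertices. A decomposition at the last visit, together with the bound on the expected lifetime of
the walk, controls the vertices whose distance to the boundary is at least `s`; the other
vertices are controlled by the fast exit close to the boundary.
-/

noncomputable section

namespace SquareLattice

/-! ### Averages over the step sequences of the walk -/

/-- The indicator of a proposition, as a real number. -/
def ind (p : Prop) : ℝ := by
  classical exact if p then 1 else 0

lemma ind_true {p : Prop} (h : p) : ind p = 1 := by simp [ind, h]

lemma ind_false {p : Prop} (h : ¬ p) : ind p = 0 := by simp [ind, h]

lemma ind_nonneg (p : Prop) : 0 ≤ ind p := by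
  by_cases h : p <;> simp [ind, h]

lemma ind_le_one (p : Prop) : ind p ≤ 1 := by
  by_cases h : p <;> simp [ind, h]

lemma ind_mono {p q : Prop} (h : p → q) : ind p ≤ ind q := by
  by_cases hp : p
  · rw [ind_true hp, ind_true (h hp)]
  · rw [ind_false hp]; exact ind_nonneg q

lemma ind_congr {p q : Prop} (h : p ↔ q) : ind p = ind q := by rw [propext h]

lemma ind_and (p q : Prop) : ind (p ∧ q) = ind p * ind q := by
  by_cases h : p <;> by_cases h' : q <;> simp [ind, h, h']

lemma ind_exists_le {ι : Type*} (s : Finset ι) (p : ι → Prop) :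
    ind (∃ i ∈ s, p i) ≤ ∑ i ∈ s, ind (p i) := by
  by_cases h : ∃ i ∈ s, p i
  · obtain ⟨i, hi, hpi⟩ := h
    rw [ind_true ⟨i, hi, hpi⟩, ← ind_true hpi]
    exact Finset.single_le_sum (f := fun i => ind (p i)) (fun _ _ => ind_nonneg _) hi
  · rw [ind_false h]
    exact Finset.sum_nonneg fun _ _ => ind_nonneg _

/-- The average of `f` over the `4 ^ m` sequences of `m` unit steps, i.e. the expectation of `f`
at the first `m` steps of the simple random walk. -/
def avg : ℕ → (List (ℤ × ℤ) → ℝ) → ℝ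
  | 0, f => f []
  | m + 1, f => (∑ e ∈ unitSteps, avg m fun l => f (e :: l)) / 4

lemma sum_unitSteps (f : ℤ × ℤ → ℝ) :
    ∑ e ∈ unitSteps, f e = f (1, 0) + f (-1, 0) + f (0, 1) + f (0, -1) := by
  rw [unitSteps, Finset.sum_insert (by decide), Finset.sum_insert (by decide),
    Finset.sum_insert (by decide), Finset.sum_singleton]
  ring

@[simp] lemma avg_zero (f : List (ℤ × ℤ) → ℝ) : avg 0 f = f [] := rfl

lemma avg_succ (m : ℕ) (f : List (ℤ × ℤ) → ℝ) :
    avg (m + 1) f = (∑ e ∈ unitSteps, avg m fun l => f (e :: l)) / 4 := rfl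

/-- Sequences of unit steps. -/
def IsSteps (m : ℕ) (l : List (ℤ × ℤ)) : Prop := l.length = m ∧ ∀ e ∈ l, e ∈ unitSteps

lemma isSteps_nil : IsSteps 0 [] := by simp [IsSteps]

lemma IsSteps.cons {m : ℕ} {l : List (ℤ × ℤ)} (h : IsSteps m l) {e : ℤ × ℤ}
    (he : e ∈ unitSteps) : IsSteps (m + 1) (e :: l) := by
  refine ⟨by simp [h.1], ?_⟩
  simpa [he] using h.2

lemma isSteps_cons {m : ℕ} {l : List (ℤ × ℤ)} {e : ℤ × ℤ} (h : IsSteps (m + 1) (e :: l)) :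
    e ∈ unitSteps ∧ IsSteps m l := by
  obtain ⟨h1, h2⟩ := h
  simp only [List.length_cons, add_left_inj, List.mem_cons, forall_eq_or_imp] at h1 h2
  exact ⟨h2.1, h1, h2.2⟩

lemma avg_mono {m : ℕ} {f g : List (ℤ × ℤ) → ℝ} (h : ∀ l, IsSteps m l → f l ≤ g l) :
    avg m f ≤ avg m g := by
  induction m generalizing f g with
  | zero => exact h [] isSteps_nil
  | succ m ih =>
    rw [avg_succ, avg_succ]
    have : ∀ e ∈ unitSteps, avg m (fun l => f (e :: l)) ≤ avg m fun l => g (e :: l) :=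
      fun e he => ih fun l hl => h _ (hl.cons he)
    have := Finset.sum_le_sum this
    linarith

lemma avg_congr {m : ℕ} {f g : List (ℤ × ℤ) → ℝ} (h : ∀ l, IsSteps m l → f l = g l) :
    avg m f = avg m g :=
  le_antisymm (avg_mono fun l hl => (h l hl).le) (avg_mono fun l hl => (h l hl).ge)

lemma avg_const (m : ℕ) (c : ℝ) : avg m (fun _ => c) = c := by
  induction m with
  | zero => rfl
  | succ m ih => rw [avg_succ, sum_unitSteps, ih]; ring

lemma avg_add (m : ℕ) (f g : List (ℤ × ℤ) → ℝ) :
    avg m (fun l => f l + g l) = avg m f + avg m g := by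
  induction m generalizing f g with
  | zero => rfl
  | succ m ih => simp only [avg_succ, ih, Finset.sum_add_distrib, add_div]

lemma avg_mul_left (m : ℕ) (c : ℝ) (f : List (ℤ × ℤ) → ℝ) :
    avg m (fun l => c * f l) = c * avg m f := by
  induction m generalizing f with
  | zero => rfl
  | succ m ih => simp only [avg_succ, ih, ← Finset.mul_sum, mul_div_assoc]

lemma avg_mul_right (m : ℕ) (c : ℝ) (f : List (ℤ × ℤ) → ℝ) :
    avg m (fun l => f l * c) = avg m f * c := by
  simp only [mul_comm _ c, avg_mul_left]

lemma avg_sub (m : ℕ) (f g : List (ℤ × ℤ) → ℝ) :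
    avg m (fun l => f l - g l) = avg m f - avg m g := by
  have := avg_add m f fun l => (-1) * g l
  rw [avg_mul_left] at this
  rw [sub_eq_add_neg, ← neg_one_mul (avg m g), ← this]
  congr 1; ext l; ring

lemma avg_sum {ι : Type*} (s : Finset ι) (m : ℕ) (f : ι → List (ℤ × ℤ) → ℝ) :
    avg m (fun l => ∑ i ∈ s, f i l) = ∑ i ∈ s, avg m (f i) := by
  classical
  induction s using Finset.induction_on with
  | empty => simp [avg_const]
  | insert a s ha ih => simp only [Finset.sum_insert ha, avg_add, ih]

lemma avg_nonneg {m : ℕ} {f : List (ℤ × ℤ) → ℝ} (h : ∀ l, IsSteps m l → 0 ≤ f l) :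
    0 ≤ avg m f := by
  rw [← avg_const m 0]; exact avg_mono h

lemma avg_le_const {m : ℕ} {f : List (ℤ × ℤ) → ℝ} {c : ℝ} (h : ∀ l, IsSteps m l → f l ≤ c) :
    avg m f ≤ c := by
  rw [← avg_const m c]; exact avg_mono h

/-- The Markov property at a fixed time. -/
lemma avg_append (a b : ℕ) (f : List (ℤ × ℤ) → ℝ) :
    avg (a + b) f = avg a fun l => avg b fun l' => f (l ++ l') := by
  induction a generalizing f with
  | zero => simp
  | succ a ih =>
    rw [show a + 1 + b = a + b + 1 by ring, avg_succ, avg_succ]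
    simp only [ih, List.cons_append]

lemma avg_snoc (m : ℕ) (f : List (ℤ × ℤ) → ℝ) :
    avg (m + 1) f = (∑ e ∈ unitSteps, avg m fun l => f (l ++ [e])) / 4 := by
  rw [avg_append]
  simp only [avg_succ, avg_zero, div_eq_mul_inv]
  rw [avg_mul_right, avg_sum]

/-- The steps of the walk are exchangeable; in particular their order can be reversed. -/
lemma avg_reverse (m : ℕ) (f : List (ℤ × ℤ) → ℝ) :
    avg m (fun l => f l.reverse) = avg m f := by
  induction m generalizing f with
  | zero => rfl
  | succ m ih =>
    rw [avg_succ, avg_snoc]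
    simp only [List.reverse_cons]
    congr 1
    exact Finset.sum_congr rfl fun e _ => ih fun l => f (l ++ [e])

/-! ### Coordinates, norm and positions of the walk -/

/-- The graph distance to the origin. -/
def dist0 (z : ℤ × ℤ) : ℕ := z.1.natAbs + z.2.natAbs

lemma dist0_neg (z : ℤ × ℤ) : dist0 (-z) = dist0 z := by
  simp [dist0]

lemma dist0_sub_comm (z w : ℤ × ℤ) : dist0 (z - w) = dist0 (w - z) := by
  rw [← dist0_neg, neg_sub]

lemma dist0_sub_le (z w y : ℤ × ℤ) : dist0 (z - y) ≤ dist0 (z - w) + dist0 (w - y) := by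
  simp only [dist0, Prod.fst_sub, Prod.snd_sub]; omega

@[simp] lemma dist0_zero : dist0 0 = 0 := rfl

lemma mem_unitSteps {e : ℤ × ℤ} :
    e ∈ unitSteps ↔ e = (1, 0) ∨ e = (-1, 0) ∨ e = (0, 1) ∨ e = (0, -1) := by
  simp [unitSteps]

lemma dist0_unitSteps {e : ℤ × ℤ} (he : e ∈ unitSteps) : dist0 e = 1 := by
  rcases mem_unitSteps.1 he with rfl | rfl | rfl | rfl <;> rfl

/-- The ball of the graph distance. -/
def ball (x : ℤ × ℤ) (r : ℕ) : Finset (ℤ × ℤ) :=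
  (Finset.Icc (x.1 - r) (x.1 + r) ×ˢ Finset.Icc (x.2 - r) (x.2 + r)).filter
    fun z => dist0 (z - x) ≤ r

lemma mem_ball {x z : ℤ × ℤ} {r : ℕ} : z ∈ ball x r ↔ dist0 (z - x) ≤ r := by
  rw [ball, Finset.mem_filter, Finset.mem_product, Finset.mem_Icc, Finset.mem_Icc,
    and_iff_right_iff_imp]
  simp only [dist0, Prod.fst_sub, Prod.snd_sub]
  omega

lemma card_ball_le (x : ℤ × ℤ) (r : ℕ) : (ball x r).card ≤ (2 * r + 1) ^ 2 := by
  refine (Finset.card_filter_le _ _).trans ?_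
  rw [Finset.card_product, Int.card_Icc, Int.card_Icc, sq]
  apply Nat.mul_le_mul <;> omega

/-- The successive positions, after the start `z`, of the walk with steps `l`. -/
def positions : ℤ × ℤ → List (ℤ × ℤ) → List (ℤ × ℤ)
  | _, [] => []
  | z, e :: l => (z + e) :: positions (z + e) l

/-- The largest distance between the start of the walk with steps `l` and its positions. -/
def range (l : List (ℤ × ℤ)) : ℕ := ((positions 0 l).map dist0).foldr max 0

lemma positions_append (z : ℤ × ℤ) (l l' : List (ℤ × ℤ)) :
    positions z (l ++ l') = positions z l ++ positions (z + l.sum) l' := by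
  induction l generalizing z with
  | nil => simp [positions]
  | cons e l ih => simp [positions, ih, add_assoc]

lemma positions_eq_map (z : ℤ × ℤ) (l : List (ℤ × ℤ)) :
    positions z l = (positions 0 l).map (z + ·) := by
  have key : ∀ w z : ℤ × ℤ, positions (z + w) l = (positions w l).map (z + ·) := by
    induction l with
    | nil => intro w z; rfl
    | cons e l ih => intro w z; simp [positions, add_assoc, ih]
  simpa using key 0 z

lemma le_foldr_max {L : List ℕ} {a : ℕ} (h : a ∈ L) : a ≤ L.foldr max 0 := by
  induction L with
  | nil => simp at h
  | cons b L ih =>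
    rcases List.mem_cons.1 h with rfl | h
    · simp
    · simpa using Or.inr (ih h)

lemma foldr_max_le {L : List ℕ} {c : ℕ} (h : ∀ a ∈ L, a ≤ c) : L.foldr max 0 ≤ c := by
  induction L with
  | nil => simp
  | cons b L ih =>
    simp only [List.mem_cons, forall_eq_or_imp] at h
    simpa using ⟨h.1, ih h.2⟩

lemma dist0_le_range {z p : ℤ × ℤ} {l : List (ℤ × ℤ)} (hp : p ∈ z :: positions z l) :
    dist0 (p - z) ≤ range l := by
  rcases List.mem_cons.1 hp with rfl | hp
  · simp
  · rw [positions_eq_map, List.mem_map] at hp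
    obtain ⟨w, hw, rfl⟩ := hp
    rw [add_sub_cancel_left]
    exact le_foldr_max (List.mem_map_of_mem hw)

lemma range_le {l : List (ℤ × ℤ)} {c : ℕ} (h : ∀ p ∈ positions 0 l, dist0 p ≤ c) :
    range l ≤ c := by
  apply foldr_max_le
  rintro _ ha
  obtain ⟨p, hp, rfl⟩ := List.mem_map.1 ha
  exact h p hp

lemma endpoint_mem (z : ℤ × ℤ) (l : List (ℤ × ℤ)) : z + l.sum ∈ z :: positions z l := by
  induction l generalizing z with
  | nil => simp
  | cons e l ih =>
    have := ih (z + e)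
    rw [List.sum_cons, ← add_assoc]
    exact List.mem_cons_of_mem _ this

/-! ### The maximal inequality -/

/-- Twice the squared Euclidean norm. -/
def normSq (z : ℤ × ℤ) : ℝ := 2 * ((z.1 : ℝ) ^ 2 + (z.2 : ℝ) ^ 2)

lemma normSq_nonneg (z : ℤ × ℤ) : 0 ≤ normSq z := by unfold normSq; positivity

lemma natAbs_cast_eq (a : ℤ) : ((a.natAbs : ℕ) : ℝ) = |(a : ℝ)| := by
  rw [Nat.cast_natAbs, Int.cast_abs]

lemma dist0_sq_le (z : ℤ × ℤ) : (dist0 z : ℝ) ^ 2 ≤ normSq z := by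
  simp only [dist0, normSq, Nat.cast_add, natAbs_cast_eq]
  nlinarith [sq_nonneg (|(z.1 : ℝ)| - |(z.2 : ℝ)|), sq_abs (z.1 : ℝ), sq_abs (z.2 : ℝ)]

lemma sum_normSq (z : ℤ × ℤ) : (∑ e ∈ unitSteps, normSq (z + e)) / 4 = normSq z + 2 := by
  rw [sum_unitSteps]; simp only [normSq, Prod.fst_add, Prod.snd_add]; push_cast; ring

lemma avg_normSq_sq_le (m : ℕ) (z : ℤ × ℤ) :
    avg m (fun l => normSq (z + l.sum) ^ 2) ≤ normSq z ^ 2 + 8 * m * normSq z + 8 * m ^ 2 := by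
  induction m generalizing z with
  | zero => simp
  | succ m ih =>
    rw [avg_succ]
    simp only [List.sum_cons, ← add_assoc]
    have h1 := Finset.sum_le_sum fun e (_ : e ∈ unitSteps) => ih (z + e)
    have h2 : (∑ e ∈ unitSteps, (normSq (z + e) ^ 2 + 8 * m * normSq (z + e) + 8 * (m : ℝ) ^ 2)) / 4
        = normSq z ^ 2 + 8 * normSq z + 4 + 8 * m * (normSq z + 2) + 8 * (m : ℝ) ^ 2 := by
      rw [sum_unitSteps]; simp only [normSq, Prod.fst_add, Prod.snd_add]; push_cast; ring
    push_cast
    nlinarith [normSq_nonneg z]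

/-- The running maximum of `normSq` along the walk from `z`, started from the value `y`. -/
def runMax : ℝ → ℤ × ℤ → List (ℤ × ℤ) → ℝ
  | y, _, [] => y
  | y, z, e :: l => runMax (max y (normSq (z + e))) (z + e) l

lemma le_runMax (y : ℝ) (z : ℤ × ℤ) (l : List (ℤ × ℤ)) : y ≤ runMax y z l := by
  induction l generalizing y z with
  | nil => exact le_rfl
  | cons e l ih => exact (le_max_left _ _).trans (ih _ _)

lemma normSq_le_runMax {y : ℝ} {z p : ℤ × ℤ} {l : List (ℤ × ℤ)} (hp : p ∈ positions z l) :
    normSq p ≤ runMax y z l := by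
  induction l generalizing y z with
  | nil => simp [positions] at hp
  | cons e l ih =>
    rcases List.mem_cons.1 hp with rfl | hp
    · exact (le_max_right _ _).trans (le_runMax _ _ _)
    · exact ih hp

/-- Doob's `L²` inequality, proved with the function `2 y (y - 2 x)` of the running maximum `y` and
the current value `x` of a submartingale, whose expectation is nonincreasing. -/
lemma avg_runMax_sq_le (m : ℕ) (y : ℝ) (z : ℤ × ℤ) (hy : normSq z ≤ y) :
    avg m (fun l => runMax y z l ^ 2 - 4 * normSq (z + l.sum) ^ 2) ≤ 2 * y * (y - 2 * normSq z) := by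
  induction m generalizing y z with
  | zero => simp only [avg_zero, runMax, List.sum_nil, add_zero]; nlinarith [sq_nonneg (y - 2 * normSq z)]
  | succ m ih =>
    have hy0 : 0 ≤ y := (normSq_nonneg z).trans hy
    rw [avg_succ]
    simp only [runMax, List.sum_cons, ← add_assoc]
    have key : ∀ e ∈ unitSteps,
        avg m (fun l => runMax (max y (normSq (z + e))) (z + e) l ^ 2 - 4 * normSq (z + e + l.sum) ^ 2)
          ≤ 2 * y ^ 2 - 4 * y * normSq (z + e) := by
      intro e _
      refine (ih _ _ (le_max_right _ _)).trans ?_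
      rcases le_total y (normSq (z + e)) with h | h
      · rw [max_eq_right h]; nlinarith [sq_nonneg (normSq (z + e) - y)]
      · rw [max_eq_left h]; nlinarith
    have h1 := Finset.sum_le_sum key
    have h2 := sum_normSq z
    rw [sum_unitSteps] at h2
    rw [sum_unitSteps] at h1
    rw [sum_unitSteps (fun e => 2 * y ^ 2 - 4 * y * normSq (z + e))] at h1
    rw [sum_unitSteps]
    nlinarith

lemma avg_range_pow_four_le (m : ℕ) : avg m (fun l => (range l : ℝ) ^ 4) ≤ 32 * (m : ℝ) ^ 2 := by
  have h1 := avg_runMax_sq_le m 0 0 (by simp [normSq])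
  have h2 := avg_normSq_sq_le m 0
  rw [avg_sub, avg_mul_left] at h1
  have h3 : avg m (fun l => (range l : ℝ) ^ 4) ≤ avg m fun l => runMax 0 0 l ^ 2 := by
    refine avg_mono fun l _ => ?_
    have h0 : 0 ≤ runMax 0 0 l := le_runMax _ _ _
    have : (range l : ℝ) ≤ √(runMax 0 0 l) := by
      have hr : range l ≤ ⌊√(runMax 0 0 l)⌋₊ := by
        refine range_le fun p hp => Nat.le_floor ?_
        apply Real.le_sqrt_of_sq_le
        exact (dist0_sq_le p).trans (normSq_le_runMax hp)
      exact (Nat.cast_le.2 hr).trans (Nat.floor_le (Real.sqrt_nonneg _))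
    calc (range l : ℝ) ^ 4 ≤ √(runMax 0 0 l) ^ 4 := by gcongr
      _ = (√(runMax 0 0 l) ^ 2) ^ 2 := by ring
      _ = runMax 0 0 l ^ 2 := by rw [Real.sq_sqrt h0]
  have h4 : normSq 0 = 0 := by simp [normSq]
  rw [h4] at h1 h2
  simp only [zero_add] at h1 h2
  nlinarith

lemma avg_range_sq_le (m : ℕ) : avg m (fun l => (range l : ℝ) ^ 2) ≤ 33 * m := by
  rcases Nat.eq_zero_or_pos m with rfl | hm
  · simp [range, positions]
  have hm' : (0 : ℝ) < m := Nat.cast_pos.2 hm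
  have : avg m (fun l => (range l : ℝ) ^ 2) ≤ avg m fun l => m + (m : ℝ)⁻¹ * (range l : ℝ) ^ 4 := by
    refine avg_mono fun l _ => ?_
    have h : 0 ≤ (m : ℝ)⁻¹ * ((range l : ℝ) ^ 2 - m) ^ 2 := by positivity
    have h' : (m : ℝ)⁻¹ * ((range l : ℝ) ^ 2 - m) ^ 2
        = (m : ℝ)⁻¹ * (range l : ℝ) ^ 4 - 2 * (range l : ℝ) ^ 2 + m := by
      field_simp; ring
    nlinarith [sq_nonneg (range l : ℝ)]
  rw [avg_add, avg_const, avg_mul_left] at this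
  have h2 := mul_le_mul_of_nonneg_left (avg_range_pow_four_le m) (inv_nonneg.2 hm'.le)
  have h3 : (m : ℝ)⁻¹ * (32 * (m : ℝ) ^ 2) = 32 * m := by field_simp
  linarith

/-! ### The transition probabilities of the walk -/

/-- The transition probabilities of the simple random walk on `ℤ`. -/
def q : ℕ → ℤ → ℝ
  | 0, k => ind (k = 0)
  | t + 1, k => (q t (k - 1) + q t (k + 1)) / 2

lemma q_nonneg (t : ℕ) (k : ℤ) : 0 ≤ q t k := by
  induction t generalizing k with
  | zero => exact ind_nonneg _
  | succ t ih => have := ih (k - 1); have := ih (k + 1); simp only [q]; positivity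

lemma q_neg (t : ℕ) (k : ℤ) : q t (-k) = q t k := by
  induction t generalizing k with
  | zero => simp [q]
  | succ t ih =>
    simp only [q]
    rw [← ih (k - 1), ← ih (k + 1), add_comm (q t (-k - 1))]
    congr 3 <;> ring

/-- In the coordinates `x + y` and `x - y` the walk on `ℤ²` consists of two independent walks
on `ℤ`. -/
lemma avg_ind_sum_eq (t : ℕ) (w : ℤ × ℤ) :
    avg t (fun l => ind (l.sum = w)) = q t (w.1 + w.2) * q t (w.1 - w.2) := by
  induction t generalizing w with
  | zero =>
    simp only [avg_zero, List.sum_nil, q, ← ind_and]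
    congr 1
    rw [eq_comm, Prod.ext_iff, Prod.fst_zero, Prod.snd_zero, eq_iff_iff]
    omega
  | succ t ih =>
    have h : ∀ e : ℤ × ℤ, avg t (fun l => ind ((e :: l).sum = w))
        = q t ((w - e).1 + (w - e).2) * q t ((w - e).1 - (w - e).2) := by
      intro e
      rw [← ih]
      simp only [List.sum_cons, eq_sub_iff_add_eq']
    rw [avg_succ, Finset.sum_congr rfl fun e _ => h e, sum_unitSteps]
    simp only [Prod.fst_sub, Prod.snd_sub, q]
    ring_nf

lemma q_eq_zero_of_lt {t : ℕ} {k : ℤ} (h : (t : ℤ) < |k|) : q t k = 0 := by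
  induction t generalizing k with
  | zero => rw [q, ind_false]; simpa using h
  | succ t ih =>
    push_cast at h
    rw [q, ih, ih]
    · simp
    · rw [lt_abs] at h ⊢; omega
    · rw [lt_abs] at h ⊢; omega

lemma q_eq_zero_of_odd {t : ℕ} {k : ℤ} (h : Odd (t + k)) : q t k = 0 := by
  induction t generalizing k with
  | zero =>
    rw [q, ind_false]
    rintro rfl
    simp at h
  | succ t ih =>
    rw [Int.odd_iff] at h
    push_cast at h
    rw [q, ih (by rw [Int.odd_iff]; omega), ih (by rw [Int.odd_iff]; omega)]
    simp

lemma q_eq_choose (t i : ℕ) : q t (2 * i - t) = t.choose i / 2 ^ t := by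
  induction t generalizing i with
  | zero =>
    rcases Nat.eq_zero_or_pos i with rfl | hi
    · simp [q, ind_true]
    · rw [q, ind_false (by push_cast; omega), Nat.choose_eq_zero_of_lt hi]; simp
  | succ t ih =>
    rcases i with _ | i
    · rw [q, q_eq_zero_of_lt (by rw [lt_abs]; push_cast; omega)]
      have := ih 0
      rw [show (2 * ((0 : ℕ) : ℤ) - ((t + 1 : ℕ) : ℤ) + 1) = 2 * ((0 : ℕ) : ℤ) - t by push_cast; ring,
        this, Nat.choose_zero_right, Nat.choose_zero_right, pow_succ]
      field_simp
      simp
    · rw [q, Nat.choose_succ_succ, pow_succ]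
      have h1 := ih i
      have h2 := ih (i + 1)
      push_cast at h1 h2 ⊢
      rw [show (2 * ((i : ℤ) + 1) - (t + 1) - 1) = 2 * i - t by ring, h1,
        show (2 * ((i : ℤ) + 1) - (t + 1) + 1) = 2 * (i + 1) - t by ring, h2]
      field_simp

lemma mul_centralBinom_sq_le (m : ℕ) : (2 * m + 1 : ℝ) * m.centralBinom ^ 2 ≤ 16 ^ m := by
  induction m with
  | zero => simp
  | succ m ih =>
    have h : ((m : ℝ) + 1) * (m + 1).centralBinom = 2 * (2 * m + 1) * m.centralBinom := by
      exact_mod_cast Nat.succ_mul_centralBinom_succ m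
    have hm : (0 : ℝ) < (m + 1) ^ 2 := by positivity
    rw [← mul_le_mul_iff_of_pos_right hm, pow_succ (16 : ℝ)]
    push_cast
    calc (2 * ((m : ℝ) + 1) + 1) * (m + 1).centralBinom ^ 2 * ((m : ℝ) + 1) ^ 2
        = (2 * (m : ℝ) + 3) * (((m : ℝ) + 1) * (m + 1).centralBinom) ^ 2 := by ring
      _ = 4 * (2 * (m : ℝ) + 3) * (2 * m + 1) * ((2 * m + 1) * m.centralBinom ^ 2) := by rw [h]; ring
      _ ≤ 4 * (2 * (m : ℝ) + 3) * (2 * m + 1) * 16 ^ m := by gcongr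
      _ ≤ 16 ^ m * 16 * ((m : ℝ) + 1) ^ 2 := by
        have : (0 : ℝ) < 16 ^ m := by positivity
        nlinarith

lemma le_mul_centralBinom_sq {m : ℕ} (hm : 1 ≤ m) : (16 : ℝ) ^ m ≤ 4 * m * m.centralBinom ^ 2 := by
  induction m, hm using Nat.le_induction with
  | base => norm_num [Nat.centralBinom, Nat.choose]
  | succ m hm1 ih =>
    have h : ((m : ℝ) + 1) * (m + 1).centralBinom = 2 * (2 * m + 1) * m.centralBinom := by
      exact_mod_cast Nat.succ_mul_centralBinom_succ m
    have hm : (0 : ℝ) < m * (m + 1) := by positivity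
    rw [← mul_le_mul_iff_of_pos_right hm, pow_succ]
    push_cast
    calc (16 : ℝ) ^ m * 16 * (m * (m + 1)) ≤ 4 * m * m.centralBinom ^ 2 * 16 * (m * (m + 1)) := by
          gcongr
      _ ≤ 4 * m * (2 * (2 * m + 1) * m.centralBinom) ^ 2 := by
        have : (0 : ℝ) ≤ m * (m.centralBinom : ℝ) ^ 2 := by positivity
        nlinarith
      _ = 4 * ((m : ℝ) + 1) * (m + 1).centralBinom ^ 2 * (m * (m + 1)) := by rw [← h]; ring

lemma q_two_mul_le (m : ℕ) (k : ℤ) : q (2 * m) k ≤ 1 / √(2 * m + 1) := by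
  have hpos : (0 : ℝ) < 4 ^ m := by positivity
  have hc : (m.centralBinom : ℝ) / 4 ^ m ≤ 1 / √(2 * m + 1) := by
    rw [div_le_div_iff₀ hpos (by positivity), one_mul]
    apply le_of_sq_le_sq _ hpos.le
    rw [mul_pow, Real.sq_sqrt (by positivity), ← pow_mul, mul_comm m 2, pow_mul, mul_comm]
    norm_num
    exact mul_centralBinom_sq_le m
  by_cases hodd : Odd (((2 * m : ℕ) : ℤ) + k)
  · rw [q_eq_zero_of_odd hodd]; positivity
  by_cases hlt : ((2 * m : ℕ) : ℤ) < |k|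
  · rw [q_eq_zero_of_lt hlt]; positivity
  rw [Int.odd_iff] at hodd
  rw [not_lt, abs_le] at hlt
  push_cast at hodd hlt
  obtain ⟨i, hi⟩ : ∃ i : ℕ, k = 2 * (i : ℤ) - (2 * m : ℕ) :=
    ⟨((2 * m + k) / 2).toNat, by push_cast; omega⟩
  rw [hi, q_eq_choose]
  refine le_trans ?_ hc
  rw [pow_mul]
  norm_num
  gcongr
  exact_mod_cast Nat.choose_le_centralBinom i m

lemma q_le {t : ℕ} (ht : 1 ≤ t) (k : ℤ) : q t k ≤ 1 / √t := by
  have ht' : (0 : ℝ) < √t := Real.sqrt_pos.2 (by exact_mod_cast ht)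
  rcases Nat.even_or_odd' t with ⟨m, rfl | rfl⟩
  · refine (q_two_mul_le m k).trans ?_
    gcongr
    push_cast
    linarith
  · have h1 := q_two_mul_le m (k - 1)
    have h2 := q_two_mul_le m (k + 1)
    simp only [q]
    push_cast
    linarith

/-- Bernoulli's inequality for the ratio to the central binomial coefficient. -/
lemma centralBinom_mul_le_choose (m j : ℕ) :
    (m.centralBinom : ℝ) * (1 - j ^ 2 / (m + 1)) ≤ (2 * m).choose (m + j) := by
  induction j with
  | zero => simp [Nat.centralBinom]
  | succ j ih =>
    have hm : (0 : ℝ) < m + 1 := by positivity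
    by_cases hb : (m : ℝ) + 1 < (j + 1) ^ 2
    · refine le_trans ?_ (Nat.cast_nonneg _)
      apply mul_nonpos_of_nonneg_of_nonpos (Nat.cast_nonneg _)
      rw [sub_nonpos, le_div_iff₀ hm]
      push_cast; linarith
    push Not at hb
    have hjm : j ≤ m := by
      have : (j + 1) ^ 2 ≤ m + 1 := by exact_mod_cast hb
      nlinarith
    have h := Nat.choose_succ_right_eq (2 * m) (m + j)
    rw [show 2 * m - (m + j) = m - j by omega] at h
    have h' : ((2 * m).choose (m + (j + 1)) : ℝ) * (m + j + 1) = (2 * m).choose (m + j) * (m - j) := by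
      rw [← Nat.cast_sub hjm]; exact_mod_cast h
    have hd : (0 : ℝ) < m + j + 1 := by positivity
    rw [← mul_le_mul_iff_of_pos_right hd, h']
    have hjm' : (0 : ℝ) ≤ m - j := by rw [sub_nonneg]; exact_mod_cast hjm
    refine le_trans ?_ (mul_le_mul_of_nonneg_right ih hjm')
    rw [mul_assoc, mul_assoc]
    apply mul_le_mul_of_nonneg_left _ (Nat.cast_nonneg _)
    have h1 : (1 - ((j + 1 : ℕ) : ℝ) ^ 2 / (m + 1)) * (m + j + 1)
        = ((m + 1 - (j + 1) ^ 2) * (m + j + 1)) / (m + 1) := by push_cast; field_simp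
    have h2 : (1 - (j : ℝ) ^ 2 / (m + 1)) * (m - j) = ((m + 1 - j ^ 2) * (m - j)) / (m + 1) := by
      field_simp
    rw [h1, h2]
    gcongr ?_ / _
    have hj : (0 : ℝ) ≤ j := Nat.cast_nonneg _
    nlinarith [mul_nonneg hj hj, mul_nonneg (mul_nonneg hj hj) hj]

lemma le_q_two_mul {m : ℕ} (hm : 1 ≤ m) {j : ℤ} (hj : 2 * j ^ 2 ≤ m + 1) :
    1 / (4 * √m) ≤ q (2 * m) (2 * j) := by
  wlog h0 : 0 ≤ j generalizing j
  · have := this (j := -j) (by simpa using hj) (by omega)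
    rwa [mul_neg, q_neg] at this
  obtain ⟨i, rfl⟩ := Int.eq_ofNat_of_zero_le h0
  have hq := q_eq_choose (2 * m) (m + i)
  rw [show (2 * ((m + i : ℕ) : ℤ) - (2 * m : ℕ)) = 2 * (i : ℤ) by push_cast; ring] at hq
  rw [hq]
  have hpos : (0 : ℝ) < 4 ^ m := by positivity
  have hm' : (0 : ℝ) < m := by exact_mod_cast hm
  have hs : 0 < √(m : ℝ) := Real.sqrt_pos.2 hm'
  have hc : (4 : ℝ) ^ m ≤ 2 * √m * m.centralBinom := by
    apply le_of_sq_le_sq _ (by positivity)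
    rw [mul_pow, mul_pow, Real.sq_sqrt hm'.le, ← pow_mul, mul_comm m 2, pow_mul]
    have := le_mul_centralBinom_sq hm
    norm_num
    linarith
  have h2 : (m.centralBinom : ℝ) * (1 / 2) ≤ (2 * m).choose (m + i) := by
    refine le_trans ?_ (centralBinom_mul_le_choose m i)
    gcongr
    have : (2 : ℝ) * i ^ 2 ≤ m + 1 := by exact_mod_cast hj
    rw [le_sub_comm, div_le_iff₀ (by positivity)]
    linarith
  rw [pow_mul, div_le_div_iff₀ (by positivity) (by positivity)]
  norm_num
  nlinarith

lemma le_q {t : ℕ} (ht : 2 ≤ t) {k : ℤ} (hk : 4 * k ^ 2 ≤ t) (hpar : Even (t + k)) :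
    1 / (4 * √t) ≤ q t k := by
  rcases Nat.even_or_odd' t with ⟨m, rfl | rfl⟩
  · obtain ⟨j, rfl⟩ : ∃ j, k = 2 * j := ⟨k / 2, by rw [Int.even_iff] at hpar; push_cast at hpar; omega⟩
    have hm : 1 ≤ m := by omega
    refine le_trans ?_ (le_q_two_mul hm (j := j) (by push_cast at hk; nlinarith))
    have : (0 : ℝ) < m := by exact_mod_cast hm
    gcongr
    linarith
  · obtain ⟨j, rfl⟩ : ∃ j, k = 2 * j + 1 :=
      ⟨k / 2, by rw [Int.even_iff] at hpar; push_cast at hpar; omega⟩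
    have hm : 1 ≤ m := by omega
    push_cast at hk
    have h1 := le_q_two_mul hm (j := j) (by nlinarith [sq_nonneg (j + 1)])
    have h2 := le_q_two_mul hm (j := j + 1) (by nlinarith [sq_nonneg j])
    have h3 : 1 / (4 * √((2 * m + 1 : ℕ) : ℝ)) ≤ 1 / (4 * √m) := by
      have : (0 : ℝ) < m := by exact_mod_cast hm
      gcongr
      linarith
    simp only [q]
    rw [show (2 * j + 1 - 1) = 2 * j by ring, show (2 * j + 1 + 1) = 2 * (j + 1) by ring]
    linarith

lemma sum_q_le_one (t : ℕ) (s : Finset ℤ) (c : ℤ) : ∑ k ∈ s, q t (k + c) ≤ 1 := by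
  induction t generalizing c with
  | zero =>
    classical
    simp only [q]
    by_cases h : -c ∈ s
    · rw [Finset.sum_eq_single_of_mem _ h fun k _ hk => ind_false (by omega)]
      exact ind_le_one _
    · rw [Finset.sum_eq_zero]
      · exact zero_le_one
      · intro k hk
        apply ind_false
        intro hkc
        exact h (by rwa [show -c = k by omega])
  | succ t ih =>
    simp only [q, ← Finset.sum_div, Finset.sum_add_distrib]
    have h1 := ih (c - 1)
    have h2 := ih (c + 1)
    simp only [← add_sub_assoc, ← add_assoc] at h1 h2
    linarith

lemma avg_ind_sum_eq_le {t : ℕ} (ht : 1 ≤ t) (w : ℤ × ℤ) :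
    avg t (fun l => ind (l.sum = w)) ≤ 1 / t := by
  rw [avg_ind_sum_eq]
  calc _ ≤ 1 / √t * (1 / √t) :=
        mul_le_mul (q_le ht _) (q_le ht _) (q_nonneg _ _) (by positivity)
    _ = 1 / t := by rw [div_mul_div_comm, Real.mul_self_sqrt (Nat.cast_nonneg _), one_mul]

/-! ### Hitting a spread out set -/

/-- No two points of `F` have the same coordinate `x + y`, or no two of them have the same
coordinate `x - y`. -/
def Spread (F : Finset (ℤ × ℤ)) : Prop :=
  Set.InjOn (fun a : ℤ × ℤ => a.1 + a.2) F ∨ Set.InjOn (fun a : ℤ × ℤ => a.1 - a.2) F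

lemma avg_ind_mem (t : ℕ) (F : Finset (ℤ × ℤ)) (z : ℤ × ℤ) :
    avg t (fun l => ind (z + l.sum ∈ F))
      = ∑ a ∈ F, q t ((a - z).1 + (a - z).2) * q t ((a - z).1 - (a - z).2) := by
  rw [← Finset.sum_congr rfl fun a _ => avg_ind_sum_eq t (a - z), ← avg_sum]
  refine avg_congr fun l _ => ?_
  by_cases h : z + l.sum ∈ F
  · rw [ind_true h, Finset.sum_eq_single_of_mem _ h]
    · rw [ind_true]; abel
    · intro b _ hb
      apply ind_false
      rintro hl
      apply hb
      rw [hl]; abel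
  · rw [ind_false h, Finset.sum_eq_zero]
    intro a ha
    apply ind_false
    intro hl
    apply h
    rwa [hl, add_sub_cancel]

lemma avg_ind_mem_le {t : ℕ} (ht : 1 ≤ t) {F : Finset (ℤ × ℤ)} (hF : Spread F) (z : ℤ × ℤ) :
    avg t (fun l => ind (z + l.sum ∈ F)) ≤ 1 / √t := by
  rw [avg_ind_mem]
  have h0 : 0 ≤ 1 / √(t : ℝ) := by positivity
  rcases hF with hF | hF
  · calc _ ≤ ∑ a ∈ F, 1 / √t * q t (a.1 + a.2 + (-z.1 - z.2)) := by
          refine Finset.sum_le_sum fun a _ => ?_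
          rw [mul_comm, show (a - z).1 + (a - z).2 = a.1 + a.2 + (-z.1 - z.2) by simp; ring]
          exact mul_le_mul_of_nonneg_right (q_le ht _) (q_nonneg _ _)
      _ = 1 / √t * ∑ k ∈ F.image (fun a => a.1 + a.2), q t (k + (-z.1 - z.2)) := by
          rw [Finset.sum_image hF, Finset.mul_sum]
      _ ≤ 1 / √t := mul_le_of_le_one_right h0 (sum_q_le_one _ _ _)
  · calc _ ≤ ∑ a ∈ F, 1 / √t * q t (a.1 - a.2 + (-z.1 + z.2)) := by
          refine Finset.sum_le_sum fun a _ => ?_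
          rw [show (a - z).1 - (a - z).2 = a.1 - a.2 + (-z.1 + z.2) by simp; ring]
          exact mul_le_mul_of_nonneg_right (q_le ht _) (q_nonneg _ _)
      _ = 1 / √t * ∑ k ∈ F.image (fun a => a.1 - a.2), q t (k + (-z.1 + z.2)) := by
          rw [Finset.sum_image hF, Finset.mul_sum]
      _ ≤ 1 / √t := mul_le_of_le_one_right h0 (sum_q_le_one _ _ _)

lemma sum_one_div_sqrt_le (T : ℕ) : ∑ t ∈ Finset.range T, 1 / √((t + 1 : ℕ) : ℝ) ≤ 2 * √T := by
  induction T with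
  | zero => simp
  | succ T ih =>
    rw [Finset.sum_range_succ]
    have h1 : 0 < √((T + 1 : ℕ) : ℝ) := by positivity
    have h2 : √(T : ℝ) ≤ √((T + 1 : ℕ) : ℝ) := Real.sqrt_le_sqrt (by push_cast; linarith)
    have h3 : √((T + 1 : ℕ) : ℝ) ^ 2 = T + 1 := by rw [Real.sq_sqrt (by positivity)]; push_cast; ring
    have h4 : √(T : ℝ) ^ 2 = T := Real.sq_sqrt (by positivity)
    have : 1 / √((T + 1 : ℕ) : ℝ) ≤ 2 * √((T + 1 : ℕ) : ℝ) - 2 * √T := by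
      rw [div_le_iff₀ h1]
      nlinarith [sq_nonneg (√((T + 1 : ℕ) : ℝ) - √T)]
    linarith

/-- Decomposition at the first hitting time of `F`: the expected number of visits is at most the
hitting probability times the largest expected number of visits from a point of `F`. -/
lemma sum_avg_ind_mem_le {F : Finset (ℤ × ℤ)} {B : ℝ} (T : ℕ)
    (hB : ∀ a ∈ F, ∑ t ∈ Finset.range (T + 1), avg t (fun l => ind (a + l.sum ∈ F)) ≤ B)
    (z : ℤ × ℤ) :
    ∑ t ∈ Finset.range (T + 1), avg t (fun l => ind (z + l.sum ∈ F))
      ≤ B * avg T fun l => ind (∃ p ∈ z :: positions z l, p ∈ F) := by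
  induction T generalizing z with
  | zero =>
    by_cases hz : z ∈ F
    · simpa [hz, ind_true, positions] using hB z hz
    · simp [hz, ind_false, positions]
  | succ T ih =>
    by_cases hz : z ∈ F
    · refine (hB z hz).trans ?_
      rw [avg_congr (g := fun _ => 1), avg_const, mul_one]
      intro l _
      exact ind_true ⟨z, by simp, hz⟩
    · have hB' : ∀ a ∈ F, ∑ t ∈ Finset.range (T + 1), avg t (fun l => ind (a + l.sum ∈ F)) ≤ B := by
        intro a ha
        refine le_trans ?_ (hB a ha)
        rw [Finset.sum_range_succ _ (T + 1)]
        exact le_add_of_nonneg_right (avg_nonneg fun _ _ => ind_nonneg _)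
      rw [Finset.sum_range_succ']
      simp only [avg_zero, List.sum_nil, add_zero, ind_false hz, avg_succ, List.sum_cons]
      rw [← Finset.sum_div, Finset.sum_comm, mul_div_assoc', Finset.mul_sum]
      gcongr with e _
      simp only [← add_assoc]
      refine (ih hB' (z + e)).trans_eq ?_
      congr 2
      ext l
      congr 1
      simp [positions, hz]

lemma mul_le_sum_range {g : ℕ → ℝ} (hg : ∀ t, 0 ≤ g t) {c : ℝ} {A : ℕ}
    (h : ∀ i < A, c ≤ g (2 * A + 2 * i) + g (2 * A + 2 * i + 1)) :
    A * c ≤ ∑ t ∈ Finset.range (4 * A), g t := by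
  have key : ∀ n ≤ A, n * c ≤ ∑ t ∈ Finset.range (2 * A + 2 * n), g t := by
    intro n
    induction n with
    | zero => intro _; simpa using Finset.sum_nonneg fun t _ => hg t
    | succ n ih =>
      intro hn
      rw [show 2 * A + 2 * (n + 1) = 2 * A + 2 * n + 1 + 1 by ring, Finset.sum_range_succ,
        Finset.sum_range_succ]
      have := ih (by omega)
      have := h n (by omega)
      push_cast; linarith
  have := key A le_rfl
  rwa [show 2 * A + 2 * A = 4 * A by ring] at this

lemma abs_coord_le (w : ℤ × ℤ) : |w.1 + w.2| ≤ dist0 w ∧ |w.1 - w.2| ≤ dist0 w := by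
  rw [abs_le, abs_le, dist0]; omega

/-- A spread out set of `R` points at distance of order `R` is hit within a time of order `R ^ 2`
with a probability bounded below. -/
lemma le_avg_hit {R : ℕ} (hR : 1 ≤ R) {F : Finset (ℤ × ℤ)} (hF : Spread F) (hcard : F.card = R)
    (z : ℤ × ℤ) (hz : ∀ a ∈ F, dist0 (a - z) ≤ 10 * R) :
    1 / 5184 ≤ avg (1600 * R ^ 2) fun l => ind (∃ p ∈ positions z l, p ∈ F) := by
  have hRpos : (0 : ℝ) < R := by exact_mod_cast hR
  set T := 1600 * R ^ 2 with hT
  have hT1 : 1 ≤ T := by rw [hT]; nlinarith [sq_nonneg R]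
  have hsq : √(T : ℝ) = 40 * R := by
    rw [hT]; push_cast
    rw [show (1600 : ℝ) * R ^ 2 = (40 * R) ^ 2 by ring, Real.sqrt_sq (by positivity)]
  have hB : ∀ a : ℤ × ℤ, ∑ t ∈ Finset.range T, avg t (fun l => ind (a + l.sum ∈ F)) ≤ 81 * R := by
    intro a
    obtain ⟨T', hT'⟩ : ∃ T', T = T' + 1 := ⟨T - 1, by omega⟩
    rw [hT', Finset.sum_range_succ']
    have h1 : ∑ t ∈ Finset.range T', avg (t + 1) (fun l => ind (a + l.sum ∈ F)) ≤ 2 * √T' :=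
      (Finset.sum_le_sum fun t _ => avg_ind_mem_le (by omega) hF a).trans (sum_one_div_sqrt_le T')
    have h2 : √(T' : ℝ) ≤ √T := Real.sqrt_le_sqrt (by rw [hT']; push_cast; linarith)
    have h3 : avg 0 (fun l => ind (a + l.sum ∈ F)) ≤ 1 := ind_le_one _
    have h4 : (1 : ℝ) ≤ R := by exact_mod_cast hR
    linarith
  have hlow : (R : ℝ) / 64 ≤ ∑ t ∈ Finset.range T, avg (t + 1) (fun l => ind (z + l.sum ∈ F)) := by
    simp only [avg_ind_mem]
    rw [Finset.sum_comm]
    have : ∀ a ∈ F, (1 : ℝ) / 64 ≤ ∑ t ∈ Finset.range T,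
        q (t + 1) ((a - z).1 + (a - z).2) * q (t + 1) ((a - z).1 - (a - z).2) := by
      intro a ha
      obtain ⟨hu, hv⟩ := abs_coord_le (a - z)
      have hd : ((dist0 (a - z) : ℕ) : ℤ) ≤ 10 * R := by exact_mod_cast hz a ha
      -- The local lower bound, for the times with the parity of `a - z`.
      have key : ∀ t : ℕ, 800 * R ^ 2 ≤ t → t ≤ T → Even ((t : ℤ) + ((a - z).1 + (a - z).2)) →
          1 / (16 * (T : ℝ)) ≤ q t ((a - z).1 + (a - z).2) * q t ((a - z).1 - (a - z).2) := by
        intro t ht1 ht2 hpar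
        have ht1' : (800 : ℤ) * R ^ 2 ≤ t := by exact_mod_cast ht1
        have hbd : ∀ k : ℤ, |k| ≤ dist0 (a - z) → 4 * k ^ 2 ≤ t := by
          intro k hk
          have : |k| ^ 2 ≤ (10 * (R : ℤ)) ^ 2 := by
            have := hk.trans hd
            gcongr
          rw [sq_abs] at this
          nlinarith [sq_nonneg (R : ℤ)]
        have ht2' : 2 ≤ t := by nlinarith
        have h1 := le_q ht2' (hbd _ hu) hpar
        have h2 := le_q ht2' (hbd _ hv) (by rw [Int.even_iff] at hpar ⊢; omega)
        calc 1 / (16 * (T : ℝ)) ≤ 1 / (4 * √t) * (1 / (4 * √t)) := by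
              rw [div_mul_div_comm, one_mul, show 4 * √(t : ℝ) * (4 * √t) = 16 * (√t * √t) by ring,
                Real.mul_self_sqrt (Nat.cast_nonneg _)]
              have : (0 : ℝ) < t := by exact_mod_cast (by omega : 0 < t)
              gcongr
          _ ≤ _ := mul_le_mul h1 h2 (by positivity) (q_nonneg _ _)
      have hA : T = 4 * (400 * R ^ 2) := by rw [hT]; ring
      have h := mul_le_sum_range (A := 400 * R ^ 2) (c := 1 / (16 * (T : ℝ)))
        (g := fun t => q (t + 1) ((a - z).1 + (a - z).2) * q (t + 1) ((a - z).1 - (a - z).2))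
        (fun t => mul_nonneg (q_nonneg _ _) (q_nonneg _ _)) (by
          intro i hi
          obtain ⟨t, ht⟩ : ∃ t, t = 2 * (400 * R ^ 2) + 2 * i := ⟨_, rfl⟩
          simp only [← ht]
          have hn : ∀ t, 0 ≤ q t ((a - z).1 + (a - z).2) * q t ((a - z).1 - (a - z).2) :=
            fun t => mul_nonneg (q_nonneg _ _) (q_nonneg _ _)
          rcases Int.even_or_odd (((t + 1 : ℕ) : ℤ) + ((a - z).1 + (a - z).2)) with hp | hp
          · have := key (t + 1) (by omega) (by omega) hp
            linarith [hn (t + 1 + 1)]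
          · have := key (t + 1 + 1) (by omega) (by omega) (by
              rw [Int.odd_iff] at hp; rw [Int.even_iff]; push_cast at hp ⊢; omega)
            linarith [hn (t + 1)])
      rw [← hA] at h
      refine le_trans (le_of_eq ?_) h
      rw [hT]; push_cast; field_simp; norm_num
    calc (R : ℝ) / 64 = ∑ _a ∈ F, (1 : ℝ) / 64 := by
          rw [Finset.sum_const, hcard, nsmul_eq_mul]; ring
      _ ≤ _ := Finset.sum_le_sum this
  obtain ⟨T', hT'⟩ : ∃ T', T = T' + 1 := ⟨T - 1, by omega⟩
  -- The walk is observed from its first step on, since `z` itself may belong to `F`.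
  have hstep : ∑ t ∈ Finset.range T, avg (t + 1) (fun l => ind (z + l.sum ∈ F))
      ≤ 81 * R * avg T fun l => ind (∃ p ∈ positions z l, p ∈ F) := by
    rw [hT'] at hB ⊢
    simp only [avg_succ _ (fun l => ind (z + l.sum ∈ F)), List.sum_cons, ← add_assoc]
    rw [avg_succ T', ← Finset.sum_div, Finset.sum_comm, mul_div_assoc', Finset.mul_sum]
    gcongr with e _
    exact sum_avg_ind_mem_le T' (fun a _ => hB a) (z + e)
  have h := hlow.trans hstep
  rw [show 81 * (R : ℝ) * avg T (fun l => ind (∃ p ∈ positions z l, p ∈ F))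
    = R * (81 * avg T fun l => ind (∃ p ∈ positions z l, p ∈ F)) by ring, div_eq_mul_inv] at h
  have := le_of_mul_le_mul_left h hRpos
  linarith

/-! ### Hitting a connected set of macroscopic diameter -/

/-- Two points of `S` at distance at most four of each other. -/
def Close (S : Set (ℤ × ℤ)) (a b : ℤ × ℤ) : Prop := a ∈ S ∧ b ∈ S ∧ dist0 (a - b) ≤ 4

/-- A discrete intermediate value theorem. -/
lemma exists_reachable_between {S : Set (ℤ × ℤ)} {f : ℤ × ℤ → ℤ}
    (hf : ∀ a b, |f a - f b| ≤ dist0 (a - b)) {p b : ℤ × ℤ}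
    (h : Relation.ReflTransGen (Close S) p b) {w : ℤ} (hp : f p < w) (hb : w ≤ f b) :
    ∃ c ∈ S, w ≤ f c ∧ f c < w + 4 := by
  induction h with
  | refl => omega
  | @tail b c _ hbc ih =>
    by_cases h : w ≤ f b
    · exact ih h
    · refine ⟨c, hbc.2.1, hb, ?_⟩
      have h1 := hf b c
      have h2 := hbc.2.2
      rw [abs_le] at h1
      omega

lemma exists_injOn_of_reachable {S : Set (ℤ × ℤ)} {f : ℤ × ℤ → ℤ}
    (hf : ∀ a b, |f a - f b| ≤ dist0 (a - b)) {p b : ℤ × ℤ}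
    (h : Relation.ReflTransGen (Close S) p b) {R : ℕ} (hp : f p ≤ R) (hb : 5 * R ≤ f b) :
    ∃ F : Finset (ℤ × ℤ), F.card = R ∧ Set.InjOn f F ∧ ∀ a ∈ F, a ∈ S ∧ R < f a := by
  classical
  have key : ∀ i : ℕ, ∃ c, i < R → c ∈ S ∧ (R : ℤ) + 1 + 4 * i ≤ f c ∧ f c < R + 1 + 4 * i + 4 := by
    intro i
    by_cases hi : i < R
    · obtain ⟨c, hc⟩ := exists_reachable_between hf h (w := R + 1 + 4 * i) (by omega) (by omega)
      exact ⟨c, fun _ => hc⟩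
    · exact ⟨0, fun h => absurd h hi⟩
  choose c hc using key
  have hinj : ∀ i < R, ∀ j < R, f (c i) = f (c j) → i = j := by
    intro i hi j hj hij
    have h1 := (hc i hi).2
    have h2 := (hc j hj).2
    omega
  refine ⟨(Finset.range R).image c, ?_, ?_, ?_⟩
  · rw [Finset.card_image_of_injOn, Finset.card_range]
    intro i hi j hj hij
    exact hinj i (by simpa using hi) j (by simpa using hj) (congrArg f hij)
  · intro a ha b hb hab
    simp only [Finset.coe_image, Finset.coe_range, Set.mem_image, Set.mem_Iio] at ha hb
    obtain ⟨i, hi, rfl⟩ := ha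
    obtain ⟨j, hj, rfl⟩ := hb
    rw [hinj i hi j hj hab]
  · intro a ha
    simp only [Finset.mem_image, Finset.mem_range] at ha
    obtain ⟨i, hi, rfl⟩ := ha
    have := (hc i hi).2
    exact ⟨(hc i hi).1, by omega⟩

lemma exists_spread_of_reachable {S : Set (ℤ × ℤ)} {x p b : ℤ × ℤ}
    (h : Relation.ReflTransGen (Close S) p b) {R : ℕ} (hp : dist0 (p - x) ≤ R)
    (hb : 5 * R ≤ dist0 (b - x)) :
    ∃ F : Finset (ℤ × ℤ), F.card = R ∧ Spread F ∧ ∀ a ∈ F, a ∈ S ∧ R < dist0 (a - x) := by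
  have key : ∀ f : ℤ × ℤ → ℤ, (∀ a b, |f a - f b| ≤ dist0 (a - b)) → (∀ a, f a ≤ dist0 (a - x)) →
      5 * R ≤ f b → ∃ F : Finset (ℤ × ℤ), F.card = R ∧ Set.InjOn f F ∧
        ∀ a ∈ F, a ∈ S ∧ R < dist0 (a - x) := by
    intro f hf hfx hfb
    obtain ⟨F, h1, h2, h3⟩ := exists_injOn_of_reachable hf h (R := R)
      (by have := hfx p; omega) hfb
    refine ⟨F, h1, h2, fun a ha => ⟨(h3 a ha).1, ?_⟩⟩
    have := (h3 a ha).2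
    have := hfx a
    omega
  have hcase : 5 * (R : ℤ) ≤ (b - x).1 + (b - x).2 ∨ 5 * (R : ℤ) ≤ -((b - x).1 + (b - x).2) ∨
      5 * (R : ℤ) ≤ (b - x).1 - (b - x).2 ∨ 5 * (R : ℤ) ≤ -((b - x).1 - (b - x).2) := by
    simp only [dist0] at hb; omega
  rcases hcase with hc | hc | hc | hc
  · obtain ⟨F, h1, h2, h3⟩ := key (fun a => (a - x).1 + (a - x).2)
      (fun a b => by simp only [dist0, Prod.fst_sub, Prod.snd_sub, abs_le]; omega)
      (fun a => by simp only [dist0]; omega) hc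
    refine ⟨F, h1, Or.inl fun a ha b hb hab => h2 ha hb ?_, h3⟩
    simp only [Prod.fst_sub, Prod.snd_sub] at hab ⊢; omega
  · obtain ⟨F, h1, h2, h3⟩ := key (fun a => -((a - x).1 + (a - x).2))
      (fun a b => by simp only [dist0, Prod.fst_sub, Prod.snd_sub, abs_le]; omega)
      (fun a => by simp only [dist0]; omega) hc
    refine ⟨F, h1, Or.inl fun a ha b hb hab => h2 ha hb ?_, h3⟩
    simp only [Prod.fst_sub, Prod.snd_sub] at hab ⊢; omega
  · obtain ⟨F, h1, h2, h3⟩ := key (fun a => (a - x).1 - (a - x).2)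
      (fun a b => by simp only [dist0, Prod.fst_sub, Prod.snd_sub, abs_le]; omega)
      (fun a => by simp only [dist0]; omega) hc
    refine ⟨F, h1, Or.inr fun a ha b hb hab => h2 ha hb ?_, h3⟩
    simp only [Prod.fst_sub, Prod.snd_sub] at hab ⊢; omega
  · obtain ⟨F, h1, h2, h3⟩ := key (fun a => -((a - x).1 - (a - x).2))
      (fun a b => by simp only [dist0, Prod.fst_sub, Prod.snd_sub, abs_le]; omega)
      (fun a => by simp only [dist0]; omega) hc
    refine ⟨F, h1, Or.inr fun a ha b hb hab => h2 ha hb ?_, h3⟩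
    simp only [Prod.fst_sub, Prod.snd_sub] at hab ⊢; omega

/-- A weak form of Beurling's estimate: a connected set which crosses the annulus between the
distances `R` and `5 R` of `x` is hit by the walk started at distance at most `R` of `x`, within
a time of order `R ^ 2` and outside of the ball of radius `R`, with a probability bounded below. -/
lemma le_avg_hit_of_reachable {S : Set (ℤ × ℤ)} {x p b z : ℤ × ℤ} {R : ℕ} (hR : 1 ≤ R)
    (hS : ∀ a ∈ S, dist0 (a - x) ≤ 9 * R) (h : Relation.ReflTransGen (Close S) p b)
    (hp : dist0 (p - x) ≤ R) (hb : 5 * R ≤ dist0 (b - x)) (hz : dist0 (z - x) ≤ R) :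
    1 / 5184 ≤ avg (1600 * R ^ 2)
      fun l => ind (∃ p ∈ positions z l, p ∈ S ∧ R < dist0 (p - x)) := by
  obtain ⟨F, h1, h2, h3⟩ := exists_spread_of_reachable h hp hb
  refine (le_avg_hit hR h2 h1 z fun a ha => ?_).trans (avg_mono fun l _ => ind_mono ?_)
  · have := dist0_sub_le a x z
    have := hS a (h3 a ha).1
    rw [dist0_sub_comm z x] at hz
    omega
  · rintro ⟨p, hp, hpF⟩
    exact ⟨p, hp, h3 p hpF⟩

/-! ### The evolution of the loop-erasure -/

/-- The effect on the chronological loop-erasure of a step of the path to the vertex `v`. -/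
def lerwStep (η : List (ℤ × ℤ)) (v : ℤ × ℤ) : List (ℤ × ℤ) :=
  η.takeWhile (fun u => decide (u ≠ v)) ++ [v]

/-- `η` is a nearest-neighbour path from `0` to `z`. -/
structure IsLatticePath (η : List (ℤ × ℤ)) (z : ℤ × ℤ) : Prop where
  head : η.head? = some 0
  last : η.getLast? = some z
  chain : η.IsChain fun a b => dist0 (a - b) = 1

lemma isLatticePath_zero : IsLatticePath [0] 0 := ⟨rfl, rfl, by simp⟩

lemma lerwStep_of_notMem {η : List (ℤ × ℤ)} {v : ℤ × ℤ} (h : v ∉ η) : lerwStep η v = η ++ [v] := by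
  rw [lerwStep, List.takeWhile_eq_self_iff.2]
  intro u hu
  simp only [ne_eq, decide_not, Bool.not_eq_eq_eq_not, Bool.not_true, decide_eq_false_iff_not]
  rintro rfl
  exact h hu

lemma lerwStep_append_cons {α β : List (ℤ × ℤ)} {v : ℤ × ℤ} (h : v ∉ α) :
    lerwStep (α ++ v :: β) v = α ++ [v] := by
  rw [lerwStep, List.takeWhile_append_of_pos]
  · simp
  · intro u hu
    simp only [ne_eq, decide_not, Bool.not_eq_eq_eq_not, Bool.not_true, decide_eq_false_iff_not]
    rintro rfl
    exact h hu

lemma lerwStep_append_of_notMem {α β : List (ℤ × ℤ)} {v : ℤ × ℤ} (h : v ∉ α) :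
    lerwStep (α ++ β) v = α ++ lerwStep β v := by
  rw [lerwStep, List.takeWhile_append_of_pos, List.append_assoc]
  · rfl
  · intro u hu
    simp only [ne_eq, decide_not, Bool.not_eq_eq_eq_not, Bool.not_true, decide_eq_false_iff_not]
    rintro rfl
    exact h hu

lemma mem_lerwStep {η : List (ℤ × ℤ)} {u v : ℤ × ℤ} (h : u ∈ lerwStep η v) : u ∈ η ∨ u = v := by
  rw [lerwStep, List.mem_append, List.mem_singleton] at h
  exact h.imp_left fun h => (List.takeWhile_prefix _).subset h

lemma exists_first_eq {α : Type*} {p : α → Prop} {L : List α} (h : ∃ a ∈ L, p a) :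
    ∃ A a B, L = A ++ a :: B ∧ p a ∧ ∀ c ∈ A, ¬ p c := by
  induction L with
  | nil => simp at h
  | cons c L ih =>
    by_cases hc : p c
    · exact ⟨[], c, L, rfl, hc, by simp⟩
    · obtain ⟨a, ha, hpa⟩ := h
      have ha' : a ∈ L := by
        rcases List.mem_cons.1 ha with rfl | h
        · exact absurd hpa hc
        · exact h
      obtain ⟨A, b, B, rfl, hb, hA⟩ := ih ⟨a, ha', hpa⟩
      refine ⟨c :: A, b, B, rfl, hb, ?_⟩
      simpa [hc] using hA

lemma IsLatticePath.lerwStep {η : List (ℤ × ℤ)} {z e : ℤ × ℤ} (h : IsLatticePath η z)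
    (he : e ∈ unitSteps) : IsLatticePath (lerwStep η (z + e)) (z + e) := by
  by_cases hv : z + e ∈ η
  · obtain ⟨α, v, β, hη, rfl, hα⟩ := exists_first_eq (p := fun u => u = z + e) ⟨_, hv, rfl⟩
    have hα' : z + e ∉ α := fun h => hα _ h rfl
    rw [hη, lerwStep_append_cons hα']
    refine ⟨?_, by simp, ?_⟩
    · have := h.head
      rw [hη] at this
      cases α <;> simpa using this
    · have := h.chain
      rw [hη] at this
      exact this.prefix ⟨β, by simp⟩
  · rw [lerwStep_of_notMem hv]
    refine ⟨?_, by simp, ?_⟩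
    · rw [List.head?_append, h.head]; rfl
    · rw [List.isChain_append]
      refine ⟨h.chain, by simp, ?_⟩
      rw [h.last]
      simpa [dist0_neg] using dist0_unitSteps he

lemma IsLatticePath.foldl {η : List (ℤ × ℤ)} {z : ℤ × ℤ} (h : IsLatticePath η z) {m : ℕ}
    {l : List (ℤ × ℤ)} (hl : IsSteps m l) :
    IsLatticePath ((positions z l).foldl SquareLattice.lerwStep η) (z + l.sum) := by
  induction l generalizing η z m with
  | nil => simpa [positions] using h
  | cons e l ih =>
    rcases m with _ | m
    · simp [IsSteps] at hl
    · rw [List.sum_cons, ← add_assoc]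
      exact ih (h.lerwStep (isSteps_cons hl).1) (isSteps_cons hl).2

/-- The path `η` comes within distance `r` of `x`. -/
def Near (x : ℤ × ℤ) (r : ℕ) (η : List (ℤ × ℤ)) : Prop := ∃ v ∈ η, dist0 (v - x) ≤ r

/-- For the walk which continues with the steps `l` from the current position `z` and the current
loop-erasure `η`: the loop-erasure comes within distance `r` of `x` at all times until the walk is
for the first time at distance at least `s` of `x`, and this happens during the steps `l`. -/
def NearUntilLeaving (x : ℤ × ℤ) (r s : ℕ) : List (ℤ × ℤ) → ℤ × ℤ → List (ℤ × ℤ) → Prop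
  | η, z, [] => Near x r η ∧ s ≤ dist0 (z - x)
  | η, z, e :: l => Near x r η ∧
      (s ≤ dist0 (z - x) ∨ NearUntilLeaving x r s (lerwStep η (z + e)) (z + e) l)

section

variable {x : ℤ × ℤ} {r s : ℕ}

lemma NearUntilLeaving.near {η : List (ℤ × ℤ)} {z : ℤ × ℤ} {l : List (ℤ × ℤ)}
    (h : NearUntilLeaving x r s η z l) : Near x r η := by
  cases l <;> exact h.1

lemma NearUntilLeaving.append {η : List (ℤ × ℤ)} {z : ℤ × ℤ} {l l' : List (ℤ × ℤ)}
    (h : NearUntilLeaving x r s η z l) : NearUntilLeaving x r s η z (l ++ l') := by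
  induction l generalizing η z with
  | nil =>
    cases l' with
    | nil => exact h
    | cons e l' => exact ⟨h.1, Or.inl h.2⟩
  | cons e l ih => exact ⟨h.1, h.2.imp_right ih⟩

lemma NearUntilLeaving.of_append {η : List (ℤ × ℤ)} {z : ℤ × ℤ} {l l' : List (ℤ × ℤ)}
    (h : NearUntilLeaving x r s η z (l ++ l')) :
    (∃ p ∈ z :: positions z l, s ≤ dist0 (p - x)) ∨
      NearUntilLeaving x r s ((positions z l).foldl lerwStep η) (z + l.sum) l' := by
  induction l generalizing η z with
  | nil => right; simpa [positions] using h
  | cons e l ih =>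
    rcases h.2 with h | h
    · exact Or.inl ⟨z, by simp, h⟩
    · rcases ih h with ⟨p, hp, hps⟩ | h
      · exact Or.inl ⟨p, List.mem_cons_of_mem _ hp, hps⟩
      · right
        rw [List.sum_cons, ← add_assoc]
        exact h

/-- If the walk hits the part of the loop-erasure which precedes its first visit to the ball of
radius `r`, then the visit to this ball is erased. -/
lemma NearUntilLeaving.avoid {α β : List (ℤ × ℤ)} {z : ℤ × ℤ} {l l' : List (ℤ × ℤ)}
    (hα : ∀ a ∈ α, r < dist0 (a - x)) (h : NearUntilLeaving x r s (α ++ β) z (l ++ l')) :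
    (∃ p ∈ z :: positions z l, s ≤ dist0 (p - x)) ∨ ∀ p ∈ positions z l, p ∉ α := by
  induction l generalizing β z with
  | nil => right; simp [positions]
  | cons e l ih =>
    rcases h.2 with h | h
    · exact Or.inl ⟨z, by simp, h⟩
    · by_cases hv : z + e ∈ α
      · exfalso
        obtain ⟨A, v, B, rfl, rfl, hA⟩ := exists_first_eq (p := fun u => u = z + e) ⟨_, hv, rfl⟩
        have hA' : z + e ∉ A := fun h => hA _ h rfl
        rw [List.append_assoc, List.cons_append, lerwStep_append_cons hA'] at h
        obtain ⟨u, hu, hur⟩ := h.near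
        have := hα u (by
          simp only [List.mem_append, List.mem_cons, List.not_mem_nil, or_false] at hu ⊢
          tauto)
        omega
      · rw [lerwStep_append_of_notMem hv] at h
        rcases ih h with ⟨p, hp, hps⟩ | h
        · exact Or.inl ⟨p, List.mem_cons_of_mem _ hp, hps⟩
        · right
          simpa [positions, hv] using h

lemma reachable_of_isChain {S : Set (ℤ × ℤ)} {R : ℕ} {b : ℤ × ℤ} (hb : dist0 (b - x) ≤ R)
    (hR : 1 ≤ R) {L : List (ℤ × ℤ)} (hS : ∀ a ∈ L, dist0 (a - x) ≤ 9 * R → a ∈ S)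
    (hL : L.IsChain fun a b => dist0 (a - b) = 1) (hlast : L.getLast? = some b) {a : ℤ × ℤ}
    (ha : L.head? = some a) :
    (Relation.ReflTransGen (Close S) b a ∧ dist0 (a - x) < 5 * R) ∨
      ∃ q, Relation.ReflTransGen (Close S) b q ∧ 5 * R ≤ dist0 (q - x) := by
  induction L generalizing a with
  | nil => simp at ha
  | cons c L ih =>
    obtain rfl : c = a := by simpa using ha
    cases L with
    | nil =>
      obtain rfl : c = b := by simpa using hlast
      exact Or.inl ⟨.refl, by omega⟩
    | cons d L =>
      rw [List.isChain_cons_cons] at hL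
      rcases ih (fun a ha => hS a (List.mem_cons_of_mem _ ha)) hL.2 (by simpa using hlast) rfl with
        ⟨h1, h2⟩ | h
      · have h3 := dist0_sub_le c d x
        have hc : Relation.ReflTransGen (Close S) b c := by
          refine h1.tail ⟨hS d (by simp) (by omega), hS c (by simp) (by omega), ?_⟩
          rw [dist0_sub_comm]; omega
        by_cases h5 : dist0 (c - x) < 5 * R
        · exact Or.inl ⟨hc, h5⟩
        · exact Or.inr ⟨c, hc, by omega⟩
      · exact Or.inr h

/-- The exponent of the estimates. Its value is not optimal. -/
def exponent : ℝ := 1 / 10 ^ 9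

/-- The loop-erasure stays close to `x` until the walk leaves a large ball only if, at each scale,
the walk avoids the part of the loop-erasure which precedes the first visit to the ball of
radius `r`. -/
theorem avg_nearUntilLeaving_le (hr : 1 ≤ r) (hs : s ≤ dist0 x) (hs1 : 1 ≤ s) (m : ℕ)
    {η : List (ℤ × ℤ)} {z : ℤ × ℤ} (hη : IsLatticePath η z) :
    avg m (fun l => ind (NearUntilLeaving x r s η z l))
      ≤ (10 ^ 5 * (max (dist0 (z - x)) r : ℕ) / s : ℝ) ^ exponent := by
  induction m using Nat.strong_induction_on generalizing η z with
  | _ m ih =>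
  have hspos : (0 : ℝ) < s := by exact_mod_cast hs1
  have hν : 0 ≤ exponent := by norm_num [exponent]
  have hν1 : exponent ≤ 1 := by norm_num [exponent]
  set R := max (dist0 (z - x)) r with hRdef
  have hR1 : 1 ≤ R := hr.trans (le_max_right _ _)
  have hRpos : (0 : ℝ) < R := by exact_mod_cast hR1
  -- At distance of order `s` the bound is at least `1`.
  by_cases hRs : s ≤ 10 ^ 5 * R
  · refine (avg_le_const fun l _ => ind_le_one _).trans ?_
    apply Real.one_le_rpow _ hν
    rw [le_div_iff₀ hspos, one_mul]
    exact_mod_cast hRs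
  push Not at hRs
  have hzR : dist0 (z - x) ≤ R := le_max_left _ _
  have hrR : r ≤ R := le_max_right _ _
  have hzs : ¬ s ≤ dist0 (z - x) := by omega
  rcases Nat.eq_zero_or_pos m with rfl | hm
  · rw [avg_zero, ind_false fun h => hzs h.2]; positivity
  by_cases hnear : Near x r η
  swap
  · rw [avg_congr fun l _ => ind_false fun h => hnear h.near, avg_const]; positivity
  -- The part `α` of the loop-erasure before the first visit `b` to the ball of radius `r`.
  obtain ⟨α, b, β, hηeq, hbr, hα⟩ := exists_first_eq hnear
  push Not at hα
  set T := 1600 * R ^ 2 with hT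
  have hT1 : 1 ≤ T := by rw [hT]; nlinarith [sq_nonneg R]
  set m' := m - T with hm'
  have hm'lt : m' < m := by omega
  have hhit : 1 / 5184 ≤ avg T fun l => ind (∃ p ∈ positions z l, p ∈ α) := by
    have hchain : (α ++ [b]).IsChain fun a b => dist0 (a - b) = 1 := by
      have := hη.chain
      rw [hηeq] at this
      exact this.prefix ⟨β, by simp⟩
    have hhead : (α ++ [b]).head? = some 0 := by
      have := hη.head
      rw [hηeq] at this
      cases α <;> simpa using this
    obtain ⟨q, hq, hqR⟩ : ∃ q, Relation.ReflTransGen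
        (Close {a | a ∈ α ++ [b] ∧ dist0 (a - x) ≤ 9 * R}) b q ∧ 5 * R ≤ dist0 (q - x) := by
      rcases reachable_of_isChain (x := x) (R := R) (b := b) (hbr.trans hrR) hR1
        (S := {a | a ∈ α ++ [b] ∧ dist0 (a - x) ≤ 9 * R}) (fun a h1 h2 => ⟨h1, h2⟩) hchain (by simp)
        hhead with h | h
      · have := h.2
        rw [zero_sub, dist0_neg] at this
        omega
      · exact h
    refine (le_avg_hit_of_reachable hR1 (fun a ha => ha.2) hq (hbr.trans hrR) hqR hzR).trans
      (avg_mono fun l _ => ind_mono ?_)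
    rintro ⟨p, hp, ⟨hpα, -⟩, hpR⟩
    refine ⟨p, hp, ?_⟩
    rcases List.mem_append.1 hpα with h | h
    · exact h
    · obtain rfl : p = b := by simpa using h
      omega
  set Φ : ℝ := (10 ^ 5 * (R : ℕ) / s : ℝ) ^ exponent with hΦ
  have hΦpos : 0 < Φ := by rw [hΦ]; positivity
  have hle1 : avg m (fun l => ind (NearUntilLeaving x r s η z l))
      ≤ avg (T + m') (fun l => ind (NearUntilLeaving x r s η z l)) := by
    rw [show T + m' = m + (T + m' - m) by omega, avg_append]
    refine avg_mono fun l _ => ?_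
    rw [← avg_const (T + m' - m) (ind (NearUntilLeaving x r s η z l))]
    exact avg_mono fun l' _ => ind_mono fun h => h.append
  refine hle1.trans ?_
  rw [avg_append]
  -- Either the walk goes far within time `T`, or it avoids `α` during this time.
  have hle2 : ∀ l, IsSteps T l →
      avg m' (fun l' => ind (NearUntilLeaving x r s η z (l ++ l')))
        ≤ 4 * ((range l : ℝ) ^ 2 / (s : ℝ) ^ 2)
          + Φ * (1 - ind (∃ p ∈ positions z l, p ∈ α) + exponent * (1 + (range l : ℝ) ^ 2 / R ^ 2)) := by
    intro l hl
    have hY0 : (0 : ℝ) ≤ 1 - ind (∃ p ∈ positions z l, p ∈ α) := by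
      linarith [ind_le_one (∃ p ∈ positions z l, p ∈ α)]
    by_cases hfar : ∃ p ∈ z :: positions z l, s ≤ dist0 (p - x)
    · obtain ⟨p, hp, hps⟩ := hfar
      have h1 := dist0_le_range hp
      have h2 := dist0_sub_le p z x
      have h3 : (s : ℝ) ≤ 2 * range l := by exact_mod_cast (by omega : s ≤ 2 * range l)
      have h4 : (1 : ℝ) ≤ 4 * ((range l : ℝ) ^ 2 / (s : ℝ) ^ 2) := by
        rw [mul_div_assoc', le_div_iff₀ (by positivity)]
        nlinarith
      refine (avg_le_const fun l _ => ind_le_one _).trans (h4.trans ?_)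
      apply le_add_of_nonneg_right
      positivity
    · by_cases hav : ∃ p ∈ positions z l, p ∈ α
      · have : ∀ l', IsSteps m' l' → ind (NearUntilLeaving x r s η z (l ++ l')) = 0 := by
          intro l' _
          refine ind_false fun h => ?_
          rw [hηeq] at h
          rcases h.avoid hα with h | h
          · exact hfar h
          · obtain ⟨p, hp, hpα⟩ := hav
            exact h p hp hpα
        rw [avg_congr this, avg_const]
        positivity
      -- The claim for the walk after time `T`, linearized in the exponent; the loss `exponent * _`
      -- is smaller than the gain, which is the probability to hit `α`.
      · rw [ind_false hav, sub_zero]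
        have hd : ((max (dist0 (z + l.sum - x)) r : ℕ) : ℝ) ≤ R * (1 + range l / R) := by
          rw [mul_add, mul_one, mul_div_cancel₀ _ hRpos.ne']
          have h1 := dist0_le_range (endpoint_mem z l)
          have h2 := dist0_sub_le (z + l.sum) z x
          exact_mod_cast (by omega : max (dist0 (z + l.sum - x)) r ≤ R + range l)
        calc avg m' (fun l' => ind (NearUntilLeaving x r s η z (l ++ l')))
            ≤ avg m' (fun l' => ind (NearUntilLeaving x r s
                ((positions z l).foldl lerwStep η) (z + l.sum) l')) :=
              avg_mono fun l' _ => ind_mono fun h => h.of_append.resolve_left hfar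
          _ ≤ (10 ^ 5 * (max (dist0 (z + l.sum - x)) r : ℕ) / s : ℝ) ^ exponent :=
              ih m' hm'lt (hη.foldl hl)
          _ ≤ (10 ^ 5 * (R * (1 + range l / R)) / s : ℝ) ^ exponent := by gcongr
          _ = Φ * (1 + range l / R) ^ exponent := by
              rw [hΦ, ← Real.mul_rpow (by positivity) (by positivity)]
              congr 1; ring
          _ ≤ Φ * (1 + exponent * (range l / R)) := by
              gcongr
              exact rpow_one_add_le_one_add_mul_self
                (by have : (0 : ℝ) ≤ range l / R := by positivity
                    linarith) hν hν1
          _ ≤ Φ * (1 + exponent * (1 + (range l : ℝ) ^ 2 / R ^ 2)) := by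
              gcongr
              rw [← div_pow]
              nlinarith [sq_nonneg ((range l : ℝ) / R - 1)]
          _ ≤ _ := le_add_of_nonneg_left (by positivity)
  refine (avg_mono hle2).trans ?_
  simp only [avg_add, avg_mul_left, avg_sub, avg_const, div_eq_mul_inv, avg_mul_right]
  set h := avg T fun l => ind (∃ p ∈ positions z l, p ∈ α)
  set M := avg T fun l => (range l : ℝ) ^ 2
  have hM : M ≤ 52800 * (R : ℝ) ^ 2 := by
    refine (avg_range_sq_le T).trans_eq ?_
    rw [hT]; push_cast; ring
  have h1 : M * ((R : ℝ) ^ 2)⁻¹ ≤ 52800 := by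
    rw [← div_eq_mul_inv, div_le_iff₀ (by positivity)]; exact hM
  have h2 : M * ((s : ℝ) ^ 2)⁻¹ ≤ 52800 / 10 ^ 10 * Φ := by
    have hRs' : (10 ^ 5 * R / s : ℝ) ≤ 1 := by
      rw [div_le_one hspos]; exact_mod_cast hRs.le
    have h0 : (0 : ℝ) < 10 ^ 5 * R / s := by positivity
    have : (10 ^ 5 * R / s : ℝ) ^ 2 ≤ Φ := by
      rw [hΦ, ← Real.rpow_natCast]
      apply Real.rpow_le_rpow_of_exponent_ge h0 hRs'
      exact hν1.trans (by norm_num)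
    calc M * ((s : ℝ) ^ 2)⁻¹ ≤ 52800 * (R : ℝ) ^ 2 * ((s : ℝ) ^ 2)⁻¹ := by gcongr
      _ = 52800 / 10 ^ 10 * (10 ^ 5 * R / s : ℝ) ^ 2 := by field_simp
      _ ≤ _ := by gcongr
  have h3 : exponent * (1 + M * ((R : ℝ) ^ 2)⁻¹) ≤ 52801 / 10 ^ 9 := by
    unfold exponent; linarith
  -- The factor on the right is less than `1` by a margin that absorbs the term of `h2`.
  have h4 : 1 - h + exponent * (1 + M * ((R : ℝ) ^ 2)⁻¹) ≤ 1 - 1 / 5184 + 52801 / 10 ^ 9 := by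
    have := hhit
    linarith
  have h5 := mul_le_mul_of_nonneg_left h4 hΦpos.le
  nlinarith

end

/-! ### Chains of vertices incident to edges which leave a simply connected domain -/

/-- A function on a connected set with values in a translate of `2 π ℤ` is constant. -/
lemma eq_of_continuousOn_two_pi_int {S : Set ℂ} (hS : IsPreconnected S) {F : ℂ → ℝ}
    (hF : ContinuousOn F S) {c : ℝ} (hd : ∀ z ∈ S, ∃ n : ℤ, F z = c + n * (2 * Real.pi))
    {p q : ℂ} (hp : p ∈ S) (hq : q ∈ S) : F p = F q := by
  choose! n hn using hd
  have hn' : ∀ z ∈ S, (n z : ℝ) = (F z - c) / (2 * Real.pi) := by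
    intro z hz
    have := hn z hz
    field_simp
    linarith
  have hcont : ContinuousOn (fun z => (n z : ℝ)) S := by
    refine ContinuousOn.congr ?_ hn'
    fun_prop
  have hcont' : ContinuousOn n S :=
    Int.isClosedEmbedding_coe_real.isInducing.continuousOn_iff.2 hcont
  have := hS.constant hcont' hp hq
  rw [hn p hp, hn q hq, this]

lemma arg_eq_of_re_neg_of_im_nonneg {w : ℂ} (h : w.re < 0) (h' : 0 ≤ w.im) :
    w.arg = (-w).arg + Real.pi := by
  rw [Complex.arg_of_re_neg_of_im_nonneg h h', Complex.arg_of_re_nonneg (x := -w) (by simpa using h.le),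
    norm_neg]

lemma arg_eq_of_re_neg_of_im_neg {w : ℂ} (h : w.re < 0) (h' : w.im < 0) :
    w.arg = (-w).arg - Real.pi := by
  rw [Complex.arg_of_re_neg_of_im_neg h h', Complex.arg_of_re_nonneg (x := -w) (by simpa using h.le),
    norm_neg]

section

variable {U : Set ℂ} {a : ℂ} {f : ℂ → ℂ}

/-- Away from the cut of `Complex.arg`, a branch of the argument differs from it by a constant. -/
lemma im_sub_arg_eq (hf : ContinuousOn f U) (hexp : ∀ z ∈ U, Complex.exp (f z) = z - a) {S : Set ℂ}
    (hS : IsPreconnected S) (hSU : S ⊆ U) (hslit : ∀ z ∈ S, z - a ∈ Complex.slitPlane) {p q : ℂ}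
    (hp : p ∈ S) (hq : q ∈ S) : (f p).im - (p - a).arg = (f q).im - (q - a).arg := by
  refine eq_of_continuousOn_two_pi_int hS (F := fun z => (f z).im - (z - a).arg) ?_ (c := 0) ?_ hp hq
  · refine ContinuousOn.sub (Complex.continuous_im.comp_continuousOn (hf.mono hSU)) ?_
    intro z hz
    exact ((Complex.continuousAt_arg (hslit z hz)).comp (f := fun z => z - a)
      (by fun_prop)).continuousWithinAt
  · intro z hz
    have hne : z - a ≠ 0 := Complex.slitPlane_ne_zero (hslit z hz)
    have h := hexp z (hSU hz)
    rw [← Complex.exp_log hne, Complex.exp_eq_exp_iff_exists_int] at h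
    obtain ⟨n, hn⟩ := h
    refine ⟨n, ?_⟩
    have := congrArg Complex.im hn
    simp [Complex.log_im] at this
    rw [this]; ring

/-- To the left of `a`, a branch of the argument of `z - a` differs from the argument of `a - z` by
a constant. -/
lemma im_sub_arg_neg_eq (hf : ContinuousOn f U) (hexp : ∀ z ∈ U, Complex.exp (f z) = z - a)
    {S : Set ℂ} (hS : IsPreconnected S) (hSU : S ⊆ U) (hre : ∀ z ∈ S, z.re < a.re) {p q : ℂ}
    (hp : p ∈ S) (hq : q ∈ S) :
    (f p).im - (-(p - a)).arg = (f q).im - (-(q - a)).arg := by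
  have hslit : ∀ z ∈ S, -(z - a) ∈ Complex.slitPlane := fun z hz => by
    rw [Complex.mem_slitPlane_iff]; left; simpa using hre z hz
  refine eq_of_continuousOn_two_pi_int hS (F := fun z => (f z).im - (-(z - a)).arg) ?_
    (c := Real.pi) ?_ hp hq
  · refine ContinuousOn.sub (Complex.continuous_im.comp_continuousOn (hf.mono hSU)) ?_
    intro z hz
    exact ((Complex.continuousAt_arg (hslit z hz)).comp (f := fun z => -(z - a))
      (by fun_prop)).continuousWithinAt
  · intro z hz
    have hne : -(z - a) ≠ 0 := Complex.slitPlane_ne_zero (hslit z hz)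
    have h := hexp z (hSU hz)
    have h' : z - a = Complex.exp (Complex.log (-(z - a)) + Real.pi * Complex.I) := by
      rw [Complex.exp_add, Complex.exp_log hne, Complex.exp_pi_mul_I]; ring
    rw [h', Complex.exp_eq_exp_iff_exists_int] at h
    obtain ⟨n, hn⟩ := h
    refine ⟨n, ?_⟩
    have := congrArg Complex.im hn
    simp only [Complex.add_im, Complex.log_im] at this
    simp at this
    simp
    rw [this]; ring

lemma mem_segment_horizontal {p : ℤ × ℤ} {z : ℂ} :
    z ∈ segment ℝ (latticePoint p) (latticePoint (p + (1, 0))) ↔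
      z.im = p.2 ∧ (p.1 : ℝ) ≤ z.re ∧ z.re ≤ p.1 + 1 := by
  rw [segment_eq_image']
  constructor
  · rintro ⟨t, ⟨h0, h1⟩, rfl⟩
    simp [latticePoint]
    exact ⟨h0, h1⟩
  · rintro ⟨h1, h2, h3⟩
    refine ⟨z.re - p.1, ⟨by linarith, by linarith⟩, ?_⟩
    apply Complex.ext <;> simp [latticePoint, h1]

lemma mem_segment_vertical {p : ℤ × ℤ} {z : ℂ} :
    z ∈ segment ℝ (latticePoint p) (latticePoint (p + (0, 1))) ↔
      z.re = p.1 ∧ (p.2 : ℝ) ≤ z.im ∧ z.im ≤ p.2 + 1 := by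
  rw [segment_eq_image']
  constructor
  · rintro ⟨t, ⟨h0, h1⟩, rfl⟩
    simp [latticePoint]
    exact ⟨h0, h1⟩
  · rintro ⟨h1, h2, h3⟩
    refine ⟨z.im - p.2, ⟨by linarith, by linarith⟩, ?_⟩
    apply Complex.ext <;> simp [latticePoint, h1]

/-- The difference between a branch of the argument and the principal argument. -/
def argDefect (a : ℂ) (f : ℂ → ℂ) (p : ℤ × ℤ) : ℝ :=
  (f (latticePoint p)).im - (latticePoint p - a).arg

lemma argDefect_horizontal (hf : ContinuousOn f U) (hexp : ∀ z ∈ U, Complex.exp (f z) = z - a)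
    (ha : a ∉ U) {p : ℤ × ℤ}
    (hp : segment ℝ (latticePoint p) (latticePoint (p + (1, 0))) ⊆ U) :
    argDefect a f (p + (1, 0)) - argDefect a f p = 0 := by
  have hpre : IsPreconnected (segment ℝ (latticePoint p) (latticePoint (p + (1, 0)))) :=
    (convex_segment _ _).isPreconnected
  have hl := left_mem_segment ℝ (latticePoint p) (latticePoint (p + (1, 0)))
  have hr := right_mem_segment ℝ (latticePoint p) (latticePoint (p + (1, 0)))
  have hna : a ∉ segment ℝ (latticePoint p) (latticePoint (p + (1, 0))) := fun h => ha (hp h)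
  rw [mem_segment_horizontal] at hna
  by_cases h : (p.1 : ℝ) + 1 < a.re ∧ (p.2 : ℝ) = a.im
  · have := im_sub_arg_neg_eq hf hexp hpre hp (fun z hz => by
      rw [mem_segment_horizontal] at hz; linarith [h.1]) hr hl
    have hre1 : (latticePoint (p + (1, 0)) - a).re < 0 := by simp [latticePoint]; linarith [h.1]
    have hre2 : (latticePoint p - a).re < 0 := by simp [latticePoint]; linarith [h.1]
    have him1 : (latticePoint (p + (1, 0)) - a).im = p.2 - a.im := by simp [latticePoint]
    have him2 : (latticePoint p - a).im = p.2 - a.im := by simp [latticePoint]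
    rw [argDefect, argDefect, arg_eq_of_re_neg_of_im_nonneg hre1 (by linarith [h.2]),
      arg_eq_of_re_neg_of_im_nonneg hre2 (by linarith [h.2])]
    linarith
  · rw [sub_eq_zero]
    refine im_sub_arg_eq hf hexp hpre hp (fun z hz => ?_) hr hl
    rw [mem_segment_horizontal] at hz
    rw [Complex.mem_slitPlane_iff, Complex.sub_re, Complex.sub_im]
    by_contra hcon
    push Not at hcon
    have h2 : (p.2 : ℝ) = a.im := by linarith [hcon.2]
    have h1 : a.re ≤ p.1 + 1 := by
      by_contra h3
      exact h ⟨not_le.1 h3, h2⟩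
    exact hna ⟨h2.symm, by linarith, h1⟩

lemma argDefect_vertical (hf : ContinuousOn f U) (hexp : ∀ z ∈ U, Complex.exp (f z) = z - a)
    (ha : a ∉ U) {p : ℤ × ℤ}
    (hp : segment ℝ (latticePoint p) (latticePoint (p + (0, 1))) ⊆ U) {i j : ℤ}
    (hi : (i : ℝ) < a.re) (hi' : a.re ≤ i + 1) (hj : (j : ℝ) < a.im) (hj' : a.im ≤ j + 1) :
    argDefect a f (p + (0, 1)) - argDefect a f p
      = -(2 * Real.pi) * ind (p.2 = j ∧ p.1 ≤ i) := by
  have hpre : IsPreconnected (segment ℝ (latticePoint p) (latticePoint (p + (0, 1)))) :=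
    (convex_segment _ _).isPreconnected
  have hl := left_mem_segment ℝ (latticePoint p) (latticePoint (p + (0, 1)))
  have hr := right_mem_segment ℝ (latticePoint p) (latticePoint (p + (0, 1)))
  have hna : a ∉ segment ℝ (latticePoint p) (latticePoint (p + (0, 1))) := fun h => ha (hp h)
  rw [mem_segment_vertical] at hna
  by_cases h1 : p.1 ≤ i
  · have h1' : (p.1 : ℝ) < a.re := by
      have : (p.1 : ℝ) ≤ i := by exact_mod_cast h1
      linarith
    have := im_sub_arg_neg_eq hf hexp hpre hp (fun z hz => by
      rw [mem_segment_vertical] at hz; linarith [hz.1]) hr hl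
    have hre1 : (latticePoint (p + (0, 1)) - a).re < 0 := by simp [latticePoint]; linarith
    have hre2 : (latticePoint p - a).re < 0 := by simp [latticePoint]; linarith
    have him1 : (latticePoint (p + (0, 1)) - a).im = p.2 + 1 - a.im := by simp [latticePoint]
    have him2 : (latticePoint p - a).im = p.2 - a.im := by simp [latticePoint]
    rcases lt_trichotomy p.2 j with h2 | h2 | h2
    · have h2' : (p.2 : ℝ) + 1 ≤ j := by exact_mod_cast h2
      rw [ind_false (by omega), argDefect, argDefect,
        arg_eq_of_re_neg_of_im_neg hre1 (by linarith), arg_eq_of_re_neg_of_im_neg hre2 (by linarith)]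
      linarith
    · subst h2
      rw [ind_true ⟨rfl, h1⟩, argDefect, argDefect,
        arg_eq_of_re_neg_of_im_nonneg hre1 (by linarith),
        arg_eq_of_re_neg_of_im_neg hre2 (by linarith)]
      linarith
    · have h2' : (j : ℝ) + 1 ≤ p.2 := by exact_mod_cast h2
      rw [ind_false (by omega), argDefect, argDefect,
        arg_eq_of_re_neg_of_im_nonneg hre1 (by linarith),
        arg_eq_of_re_neg_of_im_nonneg hre2 (by linarith)]
      linarith
  · have h1' : (i : ℝ) + 1 ≤ p.1 := by exact_mod_cast (by omega : i + 1 ≤ p.1)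
    rw [ind_false (by tauto), mul_zero, sub_eq_zero]
    refine im_sub_arg_eq hf hexp hpre hp (fun z hz => ?_) hr hl
    rw [mem_segment_vertical] at hz
    rw [Complex.mem_slitPlane_iff, Complex.sub_re, Complex.sub_im]
    by_contra hcon
    push Not at hcon
    exact hna ⟨by linarith [hcon.1], by linarith [hcon.2], by linarith [hcon.2]⟩

lemma tsum_sub_shift_mul {χ : ℤ × ℤ → ℝ} (hχ : χ.support.Finite) (g : ℤ × ℤ → ℝ) (c : ℤ × ℤ) :
    ∑' p, (χ p - χ (p - c)) * g p = ∑' p, χ p * (g p - g (p + c)) := by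
  have hs : ∀ g : ℤ × ℤ → ℝ, Summable fun p => χ p * g p := fun g =>
    summable_of_hasFiniteSupport (hχ.subset fun p hp h => hp (by simp [Function.notMem_support.1 (fun h' => h' h)]))
  have h1 : ∑' p, χ (p - c) * g p = ∑' p, χ p * g (p + c) := by
    rw [← (Equiv.addRight c).tsum_eq]
    simp
  have h2 : Summable fun p => χ (p - c) * g p := by
    rw [← (Equiv.addRight c).summable_iff]
    simpa [Function.comp_def] using hs fun p => g (p + c)
  simp only [sub_mul, mul_sub]
  rw [(hs g).tsum_sub h2, (hs g).tsum_sub (hs _), h1]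

/-- A finite set of faces of the square lattice whose boundary edges lie in a domain `U` on which
`z - a` has a logarithm does not contain a face around `a ∉ U`: by the discrete Stokes formula
the winding number around `a` of the boundary of a set of faces is the indicator of this face, while
the winding number of any closed curve in `U` vanishes. -/
lemma notMem_of_boundary_subset (hf : ContinuousOn f U)
    (hexp : ∀ z ∈ U, Complex.exp (f z) = z - a) (ha : a ∉ U) {i j : ℤ}
    (hi : (i : ℝ) < a.re) (hi' : a.re ≤ i + 1) (hj : (j : ℝ) < a.im) (hj' : a.im ≤ j + 1)
    {A : Set (ℤ × ℤ)} (hA : A.Finite)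
    (hv : ∀ p, (p ∈ A ↔ p - (1, 0) ∈ A) ∨
      segment ℝ (latticePoint p) (latticePoint (p + (0, 1))) ⊆ U)
    (hh : ∀ p, (p ∈ A ↔ p - (0, 1) ∈ A) ∨
      segment ℝ (latticePoint p) (latticePoint (p + (1, 0))) ⊆ U) :
    (i, j) ∉ A := by
  intro hij
  set χ : ℤ × ℤ → ℝ := fun p => ind (p ∈ A) with hχdef
  have hχ : χ.support.Finite := hA.subset fun p hp => by
    by_contra h
    exact hp (ind_false h)
  set κ := argDefect a f
  -- Summation by parts. The differences of `argDefect` vanish along edges in `U`, except for `-2 π`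
  -- along those that cross the cut of `Complex.arg`, to the left of `a`.
  have h1 := tsum_sub_shift_mul hχ (fun p => κ (p + (0, 1)) - κ p) (1, 0)
  have h2 := tsum_sub_shift_mul hχ (fun p => κ (p + (1, 0)) - κ p) (0, 1)
  have h3 := tsum_sub_shift_mul hχ (fun p => -(2 * Real.pi) * ind (p.2 = j ∧ p.1 ≤ i)) (1, 0)
  have e1 : ∀ p, (χ p - χ (p - (1, 0))) * (κ (p + (0, 1)) - κ p)
      = (χ p - χ (p - (1, 0))) * (-(2 * Real.pi) * ind (p.2 = j ∧ p.1 ≤ i)) := by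
    intro p
    rcases hv p with h | h
    · simp only [hχdef, h, sub_self, zero_mul]
    · rw [argDefect_vertical hf hexp ha h hi hi' hj hj']
  have e2 : ∀ p, (χ p - χ (p - (0, 1))) * (κ (p + (1, 0)) - κ p) = 0 := by
    intro p
    rcases hh p with h | h
    · simp only [hχdef, h, sub_self, zero_mul]
    · rw [argDefect_horizontal hf hexp ha h, mul_zero]
  rw [tsum_congr e1, h3] at h1
  rw [tsum_congr e2, tsum_zero] at h2
  have e3 : ∀ p, χ p * (κ (p + (0, 1)) - κ p - (κ (p + (1, 0) + (0, 1)) - κ (p + (1, 0))))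
      = χ p * (κ (p + (1, 0)) - κ p - (κ (p + (0, 1) + (1, 0)) - κ (p + (0, 1)))) := by
    intro p
    rw [add_right_comm p (1, 0) (0, 1)]
    ring
  rw [tsum_congr e3, ← h2, tsum_eq_single (i, j)] at h1
  · rw [ind_true ⟨rfl, le_rfl⟩, ind_false (by simp)] at h1
    simp only [hχdef, ind_true hij] at h1
    have := Real.pi_pos
    linarith
  · intro p hp
    have : (p.2 = j ∧ p.1 ≤ i) ↔ ((p + (1, 0)).2 = j ∧ (p + (1, 0)).1 ≤ i) := by
      have : ¬ (p.1 = i ∧ p.2 = j) := fun h => hp (Prod.ext h.1 h.2)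
      simp only [Prod.fst_add, Prod.snd_add]
      omega
    rw [ind_congr this]
    simp

/-- A vertex with an edge which is not contained in `nD`. -/
def Bad (D : Set ℂ) (n : ℕ) (z : ℤ × ℤ) : Prop := ∃ e ∈ unitSteps, ¬ EdgeInside D n z (z + e)

/-- `F'` is a face which shares with the face `F` an edge that is not contained in `nD`. A face is
given by its lower left corner. -/
def FaceAdj (D : Set ℂ) (n : ℕ) (F F' : ℤ × ℤ) : Prop :=
  (F' = F + (1, 0) ∧ ¬ EdgeInside D n F' (F' + (0, 1))) ∨
  (F = F' + (1, 0) ∧ ¬ EdgeInside D n F (F + (0, 1))) ∨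
  (F' = F + (0, 1) ∧ ¬ EdgeInside D n F' (F' + (1, 0))) ∨
  (F = F' + (0, 1) ∧ ¬ EdgeInside D n F (F + (1, 0)))

/-- `v` is a corner of the face `F`. -/
def IsCorner (F v : ℤ × ℤ) : Prop := (v.1 = F.1 ∨ v.1 = F.1 + 1) ∧ (v.2 = F.2 ∨ v.2 = F.2 + 1)

lemma FaceAdj.exists_bad {D : Set ℂ} {n : ℕ} {F F' : ℤ × ℤ} (h : FaceAdj D n F F') :
    ∃ v, Bad D n v ∧ IsCorner F v ∧ IsCorner F' v := by
  rcases h with ⟨rfl, h⟩ | ⟨rfl, h⟩ | ⟨rfl, h⟩ | ⟨rfl, h⟩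
  · exact ⟨_, ⟨(0, 1), by decide, h⟩, by simp [IsCorner], by simp [IsCorner]⟩
  · exact ⟨_, ⟨(0, 1), by decide, h⟩, by simp [IsCorner], by simp [IsCorner]⟩
  · exact ⟨_, ⟨(1, 0), by decide, h⟩, by simp [IsCorner], by simp [IsCorner]⟩
  · exact ⟨_, ⟨(1, 0), by decide, h⟩, by simp [IsCorner], by simp [IsCorner]⟩

/-- In a simply connected domain, the vertices incident to edges which leave the domain form
arbitrarily long chains. -/
theorem exists_reachable_bad {D : Set ℂ} {n : ℕ}
    (hlog : ∀ a ∉ dilate n D, ∃ f : ℂ → ℂ, ContinuousOn f (dilate n D) ∧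
      ∀ z ∈ dilate n D, Complex.exp (f z) = z - a)
    {z : ℤ × ℤ} (hz : Bad D n z) (L : ℕ) :
    ∃ b, Relation.ReflTransGen (Close {v | Bad D n v ∧ dist0 (v - z) ≤ L + 4}) z b ∧
      L ≤ dist0 (b - z) := by
  by_contra hcon
  push Not at hcon
  set S := {v | Bad D n v ∧ dist0 (v - z) ≤ L + 4} with hS
  have hzS : z ∈ S := ⟨hz, by simp⟩
  obtain ⟨e, he, hze⟩ := hz
  obtain ⟨a, ha, haU⟩ := Set.not_subset.1 hze
  obtain ⟨f, hf, hexp⟩ := hlog a haU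
  -- The face which contains `a`.
  set i := ⌈a.re⌉ - 1 with hi
  set j := ⌈a.im⌉ - 1 with hj
  have hi1 : (i : ℝ) < a.re := by rw [hi]; push_cast; linarith [Int.ceil_lt_add_one a.re]
  have hi2 : a.re ≤ i + 1 := by rw [hi]; push_cast; linarith [Int.le_ceil a.re]
  have hj1 : (j : ℝ) < a.im := by rw [hj]; push_cast; linarith [Int.ceil_lt_add_one a.im]
  have hj2 : a.im ≤ j + 1 := by rw [hj]; push_cast; linarith [Int.le_ceil a.im]
  have hclose : ∀ v, IsCorner (i, j) v → dist0 (v - z) ≤ 4 := by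
    have hkey : (z.1 - 2 ≤ i ∧ i ≤ z.1 ∧ j = z.2 - 1) ∨ (i = z.1 - 1 ∧ z.2 - 2 ≤ j ∧ j ≤ z.2) := by
      have hH : ∀ p : ℤ × ℤ, a ∈ segment ℝ (latticePoint p) (latticePoint (p + (1, 0))) →
          p.1 - 1 ≤ i ∧ i ≤ p.1 ∧ j = p.2 - 1 := by
        intro p hp
        rw [mem_segment_horizontal] at hp
        have h1 : (p.1 : ℝ) - 1 ≤ i := by linarith [hp.2.1]
        have h2 : (i : ℝ) < p.1 + 1 := by linarith [hp.2.2]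
        have h3 : (j : ℝ) < p.2 := by linarith [hp.1]
        have h4 : (p.2 : ℝ) ≤ j + 1 := by linarith [hp.1]
        norm_cast at h1 h2 h3 h4
        omega
      have hV : ∀ p : ℤ × ℤ, a ∈ segment ℝ (latticePoint p) (latticePoint (p + (0, 1))) →
          i = p.1 - 1 ∧ p.2 - 1 ≤ j ∧ j ≤ p.2 := by
        intro p hp
        rw [mem_segment_vertical] at hp
        have h1 : (p.2 : ℝ) - 1 ≤ j := by linarith [hp.2.1]
        have h2 : (j : ℝ) < p.2 + 1 := by linarith [hp.2.2]
        have h3 : (i : ℝ) < p.1 := by linarith [hp.1]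
        have h4 : (p.1 : ℝ) ≤ i + 1 := by linarith [hp.1]
        norm_cast at h1 h2 h3 h4
        omega
      rcases mem_unitSteps.1 he with rfl | rfl | rfl | rfl
      · have := hH z ha; omega
      · have := hH (z + (-1, 0)) (by
          rw [segment_symm, show z + (-1, 0) + (1, 0) = z by ext <;> simp]; exact ha)
        simp only [Prod.fst_add, Prod.snd_add] at this; omega
      · have := hV z ha; omega
      · have := hV (z + (0, -1)) (by
          rw [segment_symm, show z + (0, -1) + (0, 1) = z by ext <;> simp]; exact ha)
        simp only [Prod.fst_add, Prod.snd_add] at this; omega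
    intro v hv
    simp only [IsCorner] at hv
    simp only [dist0, Prod.fst_sub, Prod.snd_sub]
    omega
  -- The faces which can be reached from this face through edges that leave the domain. If the chains
  -- of bad vertices from `z` stay bounded, `A` is finite, and its boundary edges lie inside the domain.
  set A := {F | Relation.ReflTransGen (FaceAdj D n) (i, j) F} with hA
  have hreach : ∀ F ∈ A, F = (i, j) ∨ ∃ v, IsCorner F v ∧ Relation.ReflTransGen (Close S) z v := by
    intro F hF
    induction hF with
    | refl => exact Or.inl rfl
    | @tail F F' _ hFF' ih =>
      right
      obtain ⟨v, hv, hvF, hvF'⟩ := hFF'.exists_bad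
      refine ⟨v, hvF', ?_⟩
      rcases ih with rfl | ⟨w, hw, hzw⟩
      · have := hclose v hvF
        exact .single ⟨hzS, ⟨hv, by omega⟩, by rwa [dist0_sub_comm]⟩
      · have h1 := hcon w hzw
        have h2 : dist0 (w - v) ≤ 4 := by
          simp only [IsCorner] at hw hvF
          simp only [dist0, Prod.fst_sub, Prod.snd_sub]
          omega
        have h3 := dist0_sub_le v w z
        rw [dist0_sub_comm v w] at h3
        have hwS : w ∈ S := by
          rcases Relation.ReflTransGen.cases_tail hzw with h | ⟨c, _, hc⟩
          · rwa [h]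
          · exact hc.2.1
        exact hzw.tail ⟨hwS, ⟨hv, by omega⟩, h2⟩
  have hfin : A.Finite := by
    refine (ball z (L + 10)).finite_toSet.subset fun F hF => ?_
    rw [Finset.mem_coe, mem_ball]
    have hcF : ∀ v, IsCorner F v → dist0 (F - v) ≤ 2 := by
      intro v hv
      simp only [IsCorner] at hv
      simp only [dist0, Prod.fst_sub, Prod.snd_sub]
      omega
    rcases hreach F hF with rfl | ⟨v, hv, hzv⟩
    · have := hclose (i, j) (by simp [IsCorner])
      omega
    · have h1 := hcon v hzv
      have h2 := hcF v hv
      have h3 := dist0_sub_le F v z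
      omega
  refine notMem_of_boundary_subset hf hexp haU hi1 hi2 hj1 hj2 hfin ?_ ?_ .refl
  · intro p
    by_cases h : EdgeInside D n p (p + (0, 1))
    · exact Or.inr h
    · left
      constructor
      · intro hp
        exact Relation.ReflTransGen.tail hp (Or.inr (Or.inl ⟨by simp, h⟩))
      · intro hp
        exact Relation.ReflTransGen.tail hp (Or.inl ⟨by simp, h⟩)
  · intro p
    by_cases h : EdgeInside D n p (p + (1, 0))
    · exact Or.inr h
    · left
      constructor
      · intro hp
        exact Relation.ReflTransGen.tail hp (Or.inr (Or.inr (Or.inr ⟨by simp, h⟩)))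
      · intro hp
        exact Relation.ReflTransGen.tail hp (Or.inr (Or.inr (Or.inl ⟨by simp, h⟩)))

lemma exists_log_dilate {D : Set ℂ} (hD : IsOpen D) (hsc : IsSimplyConnected D) {n : ℕ}
    (hn : 1 ≤ n) (a : ℂ) (ha : a ∉ dilate n D) :
    ∃ f : ℂ → ℂ, ContinuousOn f (dilate n D) ∧ ∀ z ∈ dilate n D, Complex.exp (f z) = z - a := by
  have hn0 : (n : ℂ) ≠ 0 := by exact_mod_cast (by omega : n ≠ 0)
  have himg : dilate n D = (Homeomorph.mulLeft₀ (n : ℂ) hn0) '' D := rfl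
  have h1 : IsOpen (dilate n D) := by rw [himg]; exact (Homeomorph.isOpenMap _) _ hD
  have h2 : IsSimplyConnected (dilate n D) := by
    rw [himg]; exact (Homeomorph.isSimplyConnected_image _).2 hsc
  obtain ⟨f, hf, hexp⟩ := Complex.exists_continuousOn_eqOn_exp_comp h2 h1 (g := fun z => z - a)
    (by fun_prop) (by
      rintro ⟨z, hz, hza⟩
      rw [sub_eq_zero] at hza
      exact ha (hza ▸ hz))
  exact ⟨f, hf, hexp⟩

end

/-! ### The survival probability -/

/-- The walk with steps `l` from `z` only uses edges contained in `nD`. -/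
def Survives (D : Set ℂ) (n : ℕ) : ℤ × ℤ → List (ℤ × ℤ) → Prop
  | _, [] => True
  | z, e :: l => EdgeInside D n z (z + e) ∧ Survives D n (z + e) l

/-- The probability that the first `m` steps of the walk from `z` are along edges contained
in `nD`. -/
def surv (D : Set ℂ) (n m : ℕ) (z : ℤ × ℤ) : ℝ := avg m fun l => ind (Survives D n z l)

section

variable {D : Set ℂ} {n : ℕ}

lemma survives_append {z : ℤ × ℤ} {l l' : List (ℤ × ℤ)} :
    Survives D n z (l ++ l') ↔ Survives D n z l ∧ Survives D n (z + l.sum) l' := by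
  induction l generalizing z with
  | nil => simp [Survives]
  | cons e l ih => simp [Survives, ih, and_assoc, add_assoc]

lemma surv_zero (z : ℤ × ℤ) : surv D n 0 z = 1 := ind_true trivial

lemma surv_nonneg (m : ℕ) (z : ℤ × ℤ) : 0 ≤ surv D n m z := avg_nonneg fun _ _ => ind_nonneg _

lemma surv_le_one (m : ℕ) (z : ℤ × ℤ) : surv D n m z ≤ 1 := avg_le_const fun _ _ => ind_le_one _

lemma surv_add (a b : ℕ) (z : ℤ × ℤ) :
    surv D n (a + b) z = avg a fun l => ind (Survives D n z l) * surv D n b (z + l.sum) := by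
  rw [surv, avg_append]
  congr 1; ext l
  rw [surv, ← avg_mul_left]
  congr 1; ext l'
  rw [← ind_and, ind_congr survives_append]

lemma surv_succ (m : ℕ) (z : ℤ × ℤ) : surv D n (m + 1) z
    = (∑ e ∈ unitSteps, ind (EdgeInside D n z (z + e)) * surv D n m (z + e)) / 4 := by
  rw [add_comm, surv_add, avg_succ]
  simp [Survives]

lemma surv_antitone (z : ℤ × ℤ) : Antitone fun m => surv D n m z := by
  intro a b hab
  obtain ⟨c, rfl⟩ := Nat.exists_eq_add_of_le hab
  simp only [surv_add]
  refine avg_mono fun l _ => ?_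
  exact mul_le_of_le_one_right (ind_nonneg _) (surv_le_one _ _)

/-- From a vertex with an edge that leaves the domain, the walk leaves with probability at least
`1 / 4` at the next step. -/
lemma surv_succ_le_of_bad (T : ℕ) {z : ℤ × ℤ} (h : Bad D n z) :
    (1 : ℝ) / 4 ≤ 1 - surv D n (T + 1) z := by
  obtain ⟨e, he, hze⟩ := h
  have h1 : ∀ e' ∈ unitSteps, ind (EdgeInside D n z (z + e')) * surv D n T (z + e')
      ≤ 1 - ind (e' = e) := by
    intro e' _
    by_cases h : e' = e
    · rw [h, ind_false hze, ind_true rfl]; simp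
    · rw [ind_false h, sub_zero]
      exact mul_le_one₀ (ind_le_one _) (surv_nonneg _ _) (surv_le_one _ _)
  have h2 := Finset.sum_le_sum h1
  rw [Finset.sum_sub_distrib, Finset.sum_eq_single_of_mem (f := fun e' => ind (e' = e)) e he
    fun b _ hb => ind_false hb, ind_true rfl] at h2
  have h3 : ∑ _e ∈ unitSteps, (1 : ℝ) = 4 := by simp [unitSteps]
  rw [surv_succ]
  linarith

lemma avg_hit_bad_le (T : ℕ) (z : ℤ × ℤ) :
    avg T (fun l => ind (∃ p ∈ z :: positions z l, Bad D n p)) / 4 ≤ 1 - surv D n (T + 1) z := by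
  induction T generalizing z with
  | zero =>
    by_cases h : Bad D n z
    · rw [avg_zero, ind_true ⟨z, by simp, h⟩]; exact surv_succ_le_of_bad 0 h
    · rw [avg_zero, ind_false (by simpa [positions] using h)]
      simpa using surv_le_one 1 z
  | succ T ih =>
    by_cases h : Bad D n z
    · refine le_trans ?_ (surv_succ_le_of_bad _ h)
      gcongr
      exact avg_le_const fun _ _ => ind_le_one _
    · have h1 : ∀ e ∈ unitSteps,
          avg T (fun l => ind (∃ p ∈ z :: positions z (e :: l), Bad D n p)) / 4
            ≤ 1 - ind (EdgeInside D n z (z + e)) * surv D n (T + 1) (z + e) := by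
        intro e he
        have hin : EdgeInside D n z (z + e) := by
          by_contra h'
          exact h ⟨e, he, h'⟩
        rw [ind_true hin, one_mul]
        refine le_trans (le_of_eq ?_) (ih (z + e))
        congr 2; ext l
        apply ind_congr
        simp [positions, h]
      have h2 := Finset.sum_le_sum h1
      have h3 : ∑ _e ∈ unitSteps, (1 : ℝ) = 4 := by simp [unitSteps]
      rw [Finset.sum_sub_distrib, ← Finset.sum_div] at h2
      rw [avg_succ, surv_succ]
      linarith

/-- Close to the boundary, the walk leaves the domain quickly with a probability bounded below. -/
lemma surv_le_of_close_bad
    (hlog : ∀ a ∉ dilate n D, ∃ f : ℂ → ℂ, ContinuousOn f (dilate n D) ∧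
      ∀ z ∈ dilate n D, Complex.exp (f z) = z - a)
    {z w : ℤ × ℤ} (hw : Bad D n w) {R : ℕ} (hR : 1 ≤ R) (hzw : dist0 (z - w) ≤ R) :
    surv D n (1600 * R ^ 2 + 1) z ≤ 1 - 1 / 20736 := by
  obtain ⟨b, hb, hbL⟩ := exists_reachable_bad hlog hw (5 * R)
  have h := le_avg_hit_of_reachable hR (x := w) (z := z) (fun a ha => by have := ha.2; omega) hb
    (by simp) hbL hzw
  have h' : avg (1600 * R ^ 2)
        (fun l => ind (∃ p ∈ positions z l, p ∈ {v | Bad D n v ∧ dist0 (v - w) ≤ 5 * R + 4} ∧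
          R < dist0 (p - w)))
      ≤ avg (1600 * R ^ 2) fun l => ind (∃ p ∈ z :: positions z l, Bad D n p) := by
    refine avg_mono fun l _ => ind_mono ?_
    rintro ⟨p, hp, hpS, -⟩
    exact ⟨p, List.mem_cons_of_mem _ hp, hpS.1⟩
  have := avg_hit_bad_le (D := D) (n := n) (1600 * R ^ 2) z
  linarith

lemma left_mem_of_edgeInside {x y : ℤ × ℤ} (h : EdgeInside D n x y) :
    latticePoint x ∈ dilate n D := h (left_mem_segment _ _ _)

lemma right_mem_of_edgeInside {x y : ℤ × ℤ} (h : EdgeInside D n x y) :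
    latticePoint y ∈ dilate n D := h (right_mem_segment _ _ _)

variable {ρ : ℕ}

lemma abs_le_of_mem_dilate (hD : ∀ z ∈ D, |z.re| ≤ ρ ∧ |z.im| ≤ ρ) {z : ℤ × ℤ}
    (hz : latticePoint z ∈ dilate n D) : |(z.1 : ℝ)| ≤ n * ρ ∧ |(z.2 : ℝ)| ≤ n * ρ := by
  obtain ⟨w, hw, hwz⟩ := hz
  have h1 := congrArg Complex.re hwz
  have h2 := congrArg Complex.im hwz
  simp [latticePoint] at h1 h2
  rw [← h1, ← h2, abs_mul, abs_mul, Nat.abs_cast]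
  exact ⟨by gcongr; exact (hD w hw).1, by gcongr; exact (hD w hw).2⟩

lemma mem_ball_of_mem_dilate (hD : ∀ z ∈ D, |z.re| ≤ ρ ∧ |z.im| ≤ ρ) {z : ℤ × ℤ}
    (hz : latticePoint z ∈ dilate n D) : z ∈ ball 0 (2 * (n * ρ)) := by
  obtain ⟨h1, h2⟩ := abs_le_of_mem_dilate hD hz
  rw [mem_ball, sub_zero, dist0]
  have h1' : ((z.1.natAbs : ℕ) : ℝ) ≤ (n * ρ : ℕ) := by rw [natAbs_cast_eq]; push_cast; exact h1
  have h2' : ((z.2.natAbs : ℕ) : ℝ) ≤ (n * ρ : ℕ) := by rw [natAbs_cast_eq]; push_cast; exact h2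
  have h1'' := Nat.cast_le.1 h1'
  have h2'' := Nat.cast_le.1 h2'
  omega

/-- The expected lifetime of the walk, by optional stopping for the martingale
`|S t| ^ 2 - t`. -/
lemma sum_surv_le_sub (hn : 1 ≤ n) (hρ : 1 ≤ ρ) (hD : ∀ z ∈ D, |z.re| ≤ ρ ∧ |z.im| ≤ ρ) (M : ℕ)
    {z : ℤ × ℤ} (hz : latticePoint z ∈ dilate n D) :
    ∑ t ∈ Finset.range M, surv D n t z ≤ (16 * (n * ρ) ^ 2 - normSq z) / 2 := by
  have hnρ : (1 : ℝ) ≤ n * ρ := by exact_mod_cast Nat.mul_le_mul hn hρ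
  have hsq : ∀ a b : ℝ, |a| ≤ b → a ^ 2 ≤ b ^ 2 := fun a b h => by
    rw [← sq_abs]; gcongr
  induction M generalizing z with
  | zero =>
    obtain ⟨h1, h2⟩ := abs_le_of_mem_dilate hD hz
    have := hsq _ _ h1
    have := hsq _ _ h2
    simp only [Finset.range_zero, Finset.sum_empty, normSq]
    nlinarith
  | succ M ih =>
    rw [Finset.sum_range_succ', surv_zero]
    simp only [surv_succ]
    rw [← Finset.sum_div, Finset.sum_comm]
    have h1 : ∀ e ∈ unitSteps,
        ∑ t ∈ Finset.range M, ind (EdgeInside D n z (z + e)) * surv D n t (z + e)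
          ≤ (16 * (n * ρ) ^ 2 - normSq (z + e)) / 2 := by
      intro e he
      rw [← Finset.mul_sum]
      by_cases h : EdgeInside D n z (z + e)
      · rw [ind_true h, one_mul]
        exact ih (right_mem_of_edgeInside h)
      · rw [ind_false h, zero_mul]
        obtain ⟨h1, h2⟩ := abs_le_of_mem_dilate hD hz
        have he1 : |(e.1 : ℝ)| ≤ 1 ∧ |(e.2 : ℝ)| ≤ 1 := by
          rcases mem_unitSteps.1 he with rfl | rfl | rfl | rfl <;> simp
        have h3 := hsq _ _ ((abs_add_le (z.1 : ℝ) e.1).trans (add_le_add h1 he1.1))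
        have h4 := hsq _ _ ((abs_add_le (z.2 : ℝ) e.2).trans (add_le_add h2 he1.2))
        simp only [normSq, Prod.fst_add, Prod.snd_add]
        push_cast
        nlinarith
    have h2 := Finset.sum_le_sum h1
    have h3 := sum_normSq z
    rw [← Finset.sum_div, Finset.sum_sub_distrib] at h2
    have h4 : ∑ _e ∈ unitSteps, (16 * ((n : ℝ) * ρ) ^ 2) = 64 * ((n : ℝ) * ρ) ^ 2 := by
      simp [unitSteps]; ring
    linarith

lemma sum_surv_le (hn : 1 ≤ n) (hρ : 1 ≤ ρ) (hD : ∀ z ∈ D, |z.re| ≤ ρ ∧ |z.im| ≤ ρ)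
    (h0 : (0 : ℂ) ∈ D) (M : ℕ) :
    ∑ t ∈ Finset.range M, surv D n t 0 ≤ 8 * (n * ρ) ^ 2 := by
  have h0' : latticePoint 0 ∈ dilate n D := ⟨0, h0, by apply Complex.ext <;> simp [latticePoint]⟩
  have := sum_surv_le_sub hn hρ hD M h0'
  have := normSq_nonneg 0
  linarith

lemma sum_surv_mul_le (hn : 1 ≤ n) (hρ : 1 ≤ ρ) (hD : ∀ z ∈ D, |z.re| ≤ ρ ∧ |z.im| ≤ ρ)
    (h0 : (0 : ℂ) ∈ D) {T : ℕ} (hT : 1 ≤ T) (I : ℕ) :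
    ∑ i ∈ Finset.range I, surv D n (i * T) 0 ≤ 1 + 8 * (n * ρ) ^ 2 / T := by
  have hT' : (0 : ℝ) < T := by exact_mod_cast hT
  have key : ∀ I : ℕ, T * ∑ i ∈ Finset.range I, surv D n ((i + 1) * T) 0
      ≤ ∑ t ∈ Finset.range (I * T), surv D n t 0 := by
    intro I
    induction I with
    | zero => simp
    | succ I ih =>
      rw [Finset.sum_range_succ, mul_add, add_mul, one_mul, Finset.sum_range_add]
      gcongr
      calc (T : ℝ) * surv D n (I * T + T) 0 = ∑ _j ∈ Finset.range T, surv D n (I * T + T) 0 := by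
            simp
        _ ≤ _ := Finset.sum_le_sum fun j hj =>
            surv_antitone 0 (by have := Finset.mem_range.1 hj; omega)
  rcases I with _ | I
  · simp only [Finset.range_zero, Finset.sum_empty]; positivity
  rw [Finset.sum_range_succ', zero_mul, surv_zero, add_comm]
  gcongr
  rw [le_div_iff₀ hT', mul_comm]
  exact (key I).trans (sum_surv_le hn hρ hD h0 _)

lemma mul_surv_le (hn : 1 ≤ n) (hρ : 1 ≤ ρ) (hD : ∀ z ∈ D, |z.re| ≤ ρ ∧ |z.im| ≤ ρ)
    (h0 : (0 : ℂ) ∈ D) (m : ℕ) : m * surv D n m 0 ≤ 8 * (n * ρ) ^ 2 := by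
  refine le_trans ?_ (sum_surv_le hn hρ hD h0 m)
  calc (m : ℝ) * surv D n m 0 = ∑ _t ∈ Finset.range m, surv D n m 0 := by simp
    _ ≤ _ := Finset.sum_le_sum fun t ht => surv_antitone 0 (Finset.mem_range.1 ht).le

end

/-! ### The loop-erased random walk is sparse -/

/-- For the walk which continues with the steps `l` from the current position `z` and the current
loop-erasure `η`: the walk traverses an edge which is not contained in `nD`, and the loop-erasure
at the end of the first such step comes within distance `r` of `x`. -/
def NearAtExit (D : Set ℂ) (n : ℕ) (x : ℤ × ℤ) (r : ℕ) : List (ℤ × ℤ) → ℤ × ℤ → List (ℤ × ℤ) → Prop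
  | _, _, [] => False
  | η, z, e :: l => (EdgeInside D n z (z + e) ∧ NearAtExit D n x r (lerwStep η (z + e)) (z + e) l) ∨
      (¬ EdgeInside D n z (z + e) ∧ Near x r (lerwStep η (z + e)))

/-- All edges at the vertices within distance `s` of `x` are contained in `nD`. -/
def Deep (D : Set ℂ) (n : ℕ) (x : ℤ × ℤ) (s : ℕ) : Prop := ∀ v, dist0 (v - x) ≤ s → ¬ Bad D n v

section

variable {D : Set ℂ} {n : ℕ} {x : ℤ × ℤ} {r s : ℕ}

lemma NearAtExit.append {η : List (ℤ × ℤ)} {z : ℤ × ℤ} {l l' : List (ℤ × ℤ)}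
    (h : NearAtExit D n x r η z l) : NearAtExit D n x r η z (l ++ l') := by
  induction l generalizing η z with
  | nil => exact h.elim
  | cons e l ih => exact h.imp_left fun h => ⟨h.1, ih h.2⟩

lemma dist0_le_add_one {z e : ℤ × ℤ} (he : e ∈ unitSteps) :
    dist0 (z - x) ≤ dist0 (z + e - x) + 1 := by
  have h1 := dist0_sub_le z (z + e) x
  have h2 : dist0 (z - (z + e)) = 1 := by
    rw [sub_add_cancel_left, dist0_neg, dist0_unitSteps he]
  omega

/-- Decomposition at the last visit of the walk to the ball of radius `r` around a deep point. -/
lemma NearAtExit.exists_last_visit (hdeep : Deep D n x s) (hrs : r < s) {m : ℕ}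
    {η : List (ℤ × ℤ)} {z : ℤ × ℤ} {l : List (ℤ × ℤ)} (hl : IsSteps m l)
    (h : NearAtExit D n x r η z l) :
    NearUntilLeaving x r s η z l ∨ ∃ a b, l = a ++ b ∧ b ≠ [] ∧ Survives D n z a ∧
      dist0 (z + a.sum - x) ≤ r ∧
      NearUntilLeaving x r s ((positions z a).foldl lerwStep η) (z + a.sum) b := by
  induction l generalizing η z m with
  | nil => exact h.elim
  | cons e l ih =>
    obtain _ | m := m
    · simp [IsSteps] at hl
    obtain ⟨he, hl⟩ := isSteps_cons hl
    have hstep : Near x r (lerwStep η (z + e)) → Near x r η ∨ dist0 (z + e - x) ≤ r := by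
      rintro ⟨v, hv, hvr⟩
      rcases mem_lerwStep hv with h | rfl
      · exact Or.inl ⟨v, h, hvr⟩
      · exact Or.inr hvr
    rcases h with ⟨hin, h⟩ | ⟨hout, h⟩
    · rcases ih hl h with h | ⟨a, b, rfl, hb, hsurv, hd, h⟩
      · by_cases hd : dist0 (z + e - x) ≤ r
        · refine Or.inr ⟨[e], l, rfl, ?_, ⟨hin, trivial⟩, by simpa using hd,
            by simpa [positions] using h⟩
          rintro rfl
          have := h.2
          omega
        · exact Or.inl ⟨(hstep h.near).resolve_right hd, Or.inr h⟩
      · exact Or.inr ⟨e :: a, b, rfl, hb, ⟨hin, hsurv⟩, by rwa [List.sum_cons, ← add_assoc],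
          by rwa [List.sum_cons, ← add_assoc]⟩
    · have hfar : s < dist0 (z - x) := by
        by_contra hcon
        exact hdeep z (not_lt.1 hcon) ⟨e, he, hout⟩
      have := dist0_le_add_one (x := x) (z := z) he
      exact Or.inl ⟨(hstep h).resolve_right (by omega), Or.inl hfar.le⟩

lemma NearAtExit.exists_visit {m : ℕ} {η : List (ℤ × ℤ)} {z : ℤ × ℤ} {l : List (ℤ × ℤ)}
    (hl : IsSteps m l) (h : NearAtExit D n x r η z l) :
    Near x r η ∨ ∃ a b, l = a ++ b ∧ b ≠ [] ∧ Survives D n z a ∧ dist0 (z + a.sum - x) ≤ r + 1 := by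
  induction l generalizing η z m with
  | nil => exact h.elim
  | cons e l ih =>
    obtain _ | m := m
    · simp [IsSteps] at hl
    obtain ⟨he, hl⟩ := isSteps_cons hl
    have hdist := dist0_le_add_one (x := x) (z := z) he
    have hstep : Near x r (lerwStep η (z + e)) → Near x r η ∨ dist0 (z - x) ≤ r + 1 := by
      rintro ⟨v, hv, hvr⟩
      rcases mem_lerwStep hv with h | rfl
      · exact Or.inl ⟨v, h, hvr⟩
      · exact Or.inr (by omega)
    have hnear : Near x r (lerwStep η (z + e)) → Near x r η ∨
        ∃ a b, e :: l = a ++ b ∧ b ≠ [] ∧ Survives D n z a ∧ dist0 (z + a.sum - x) ≤ r + 1 := fun h =>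
      (hstep h).imp_right fun h => ⟨[], e :: l, rfl, by simp, trivial, by simpa using h⟩
    rcases h with ⟨hin, h⟩ | ⟨_, h⟩
    · rcases ih hl h with h | ⟨a, b, rfl, hb, hsurv, hd⟩
      · exact hnear h
      · exact Or.inr ⟨e :: a, b, rfl, hb, ⟨hin, hsurv⟩, by rwa [List.sum_cons, ← add_assoc]⟩
    · exact hnear h

lemma exists_block {T I : ℕ} {a b : List (ℤ × ℤ)} (hl : (a ++ b).length = I * T) (hb : b ≠ []) :
    ∃ i < I, ∃ l₀ a₁ b₁ l₂, a = l₀ ++ a₁ ∧ b = b₁ ++ l₂ ∧ l₀.length = i * T ∧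
      (a₁ ++ b₁).length = T := by
  have hb' : 0 < b.length := List.length_pos_iff.2 hb
  rw [List.length_append] at hl
  have hT : 0 < T := by
    rcases Nat.eq_zero_or_pos T with rfl | h
    · omega
    · exact h
  have h1 : a.length / T * T ≤ a.length := Nat.div_mul_le_self _ _
  have h2 : a.length < a.length / T * T + T := by
    have := Nat.div_add_mod a.length T
    have := Nat.mod_lt a.length hT
    nlinarith
  have hI : a.length / T < I := by
    rw [Nat.div_lt_iff_lt_mul hT]; omega
  have h3 : a.length / T * T + T ≤ I * T := by
    have : (a.length / T + 1) * T ≤ I * T := Nat.mul_le_mul_right _ hI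
    linarith
  refine ⟨a.length / T, hI, a.take (a.length / T * T), a.drop (a.length / T * T),
    b.take (T - (a.length - a.length / T * T)), b.drop (T - (a.length - a.length / T * T)),
    (List.take_append_drop _ _).symm, (List.take_append_drop _ _).symm, ?_, ?_⟩
  · rw [List.length_take]; omega
  · rw [List.length_append, List.length_drop, List.length_take]; omega

/-- A union bound over the blocks of `T` consecutive steps. -/
lemma avg_le_sum_blocks {T I : ℕ} {P : List (ℤ × ℤ) → Prop}
    {E : List (ℤ × ℤ) → List (ℤ × ℤ) → List (ℤ × ℤ) → Prop}
    (h : ∀ l, IsSteps (I * T) l → P l → ∃ i < I, ∃ l₀ l₁ l₂, l = l₀ ++ (l₁ ++ l₂) ∧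
      l₀.length = i * T ∧ l₁.length = T ∧ E l₀ l₁ l₂) :
    avg (I * T) (fun l => ind (P l)) ≤ ∑ i ∈ Finset.range I, avg (i * T) fun l₀ => avg T fun l₁ =>
      avg ((I - 1 - i) * T) fun l₂ => ind (E l₀ l₁ l₂) := by
  set Q : ℕ → List (ℤ × ℤ) → Prop := fun i l => ∃ l₀ l₁ l₂, l = l₀ ++ (l₁ ++ l₂) ∧
      l₀.length = i * T ∧ l₁.length = T ∧ E l₀ l₁ l₂ with hQ
  have h1 : avg (I * T) (fun l => ind (P l))
      ≤ avg (I * T) fun l => ∑ i ∈ Finset.range I, ind (Q i l) := by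
    refine avg_mono fun l hl => (ind_mono fun hP => ?_).trans (ind_exists_le _ _)
    obtain ⟨i, hi, hQi⟩ := h l hl hP
    exact ⟨i, Finset.mem_range.2 hi, hQi⟩
  rw [avg_sum] at h1
  refine h1.trans (Finset.sum_le_sum fun i hi => ?_)
  rw [Finset.mem_range] at hi
  have hlen : I * T = i * T + (T + (I - 1 - i) * T) := by
    obtain ⟨k, rfl⟩ := Nat.exists_eq_add_of_lt hi
    rw [show i + k + 1 - 1 - i = k by omega]; ring
  rw [hlen, avg_append]
  refine avg_mono fun l₀ hl₀ => ?_
  rw [avg_append]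
  refine avg_mono fun l₁ hl₁ => avg_mono fun l₂ _ => ind_mono ?_
  rintro ⟨k₀, k₁, k₂, heq, hk₀, hk₁, hE⟩
  obtain ⟨h₀, heq⟩ := List.append_inj heq (hl₀.1.trans hk₀.symm)
  obtain ⟨h₁, h₂⟩ := List.append_inj heq (hl₁.1.trans hk₁.symm)
  subst h₀ h₁ h₂
  exact hE

lemma avg_nearAtExit_mono {m m' : ℕ} (h : m ≤ m') (η : List (ℤ × ℤ)) (z : ℤ × ℤ) :
    avg m (fun l => ind (NearAtExit D n x r η z l)) ≤
      avg m' fun l => ind (NearAtExit D n x r η z l) := by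
  obtain ⟨k, rfl⟩ := Nat.exists_eq_add_of_le h
  rw [avg_append]
  refine avg_mono fun l _ => ?_
  rw [← avg_const k (ind (NearAtExit D n x r η z l))]
  exact avg_mono fun l' _ => ind_mono fun h => h.append

lemma sum_ind_visit_le (X : Finset (ℤ × ℤ)) {z : ℤ × ℤ} {l : List (ℤ × ℤ)} (R : ℕ) :
    ∑ x ∈ X, ind (∃ p ∈ z :: positions z l, dist0 (p - x) ≤ R) ≤ (2 * (range l + R) + 1 : ℝ) ^ 2 := by
  classical
  have h1 : ∑ x ∈ X, ind (∃ p ∈ z :: positions z l, dist0 (p - x) ≤ R)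
      = ((X.filter fun x => ∃ p ∈ z :: positions z l, dist0 (p - x) ≤ R).card : ℝ) := by
    rw [Finset.card_filter, Nat.cast_sum]
    refine Finset.sum_congr rfl fun x _ => ?_
    by_cases h : ∃ p ∈ z :: positions z l, dist0 (p - x) ≤ R
    · rw [ind_true h, if_pos h]; simp
    · rw [ind_false h, if_neg h]; simp
  rw [h1]
  have h2 : (X.filter fun x => ∃ p ∈ z :: positions z l, dist0 (p - x) ≤ R) ⊆ ball z (range l + R) := by
    intro x hx
    obtain ⟨-, p, hp, hpx⟩ := Finset.mem_filter.1 hx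
    rw [mem_ball]
    have h1 := dist0_le_range hp
    have h2 := dist0_sub_le x p z
    rw [dist0_sub_comm x p] at h2
    omega
  have := (Finset.card_le_card h2).trans (card_ball_le _ _)
  exact_mod_cast this

/-- In each block of `r ^ 2` steps, the walk makes last visits to the neighbourhoods of at most
`r ^ 2` points on average, up to a constant. -/
lemma sum_avg_deep_le (hr : 1 ≤ r) (hrs : r < s) {X : Finset (ℤ × ℤ)}
    (hX : ∀ x ∈ X, Deep D n x s ∧ s ≤ dist0 x) (I : ℕ) :
    ∑ x ∈ X, avg (I * r ^ 2) (fun l => ind (NearAtExit D n x r [0] 0 l))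
      ≤ (∑ i ∈ Finset.range I, surv D n (i * r ^ 2) 0) *
        (4744 * 10 ^ 5 * (r : ℝ) ^ 2 * (r / s : ℝ) ^ exponent) := by
  have hν : 0 ≤ exponent := by norm_num [exponent]
  have hν1 : exponent ≤ 1 := by norm_num [exponent]
  have hr0 : (0 : ℝ) < r := by exact_mod_cast hr
  have hs0 : (0 : ℝ) < s := by exact_mod_cast (by omega : 0 < s)
  set T := r ^ 2 with hT
  set W : List (ℤ × ℤ) → ℝ := fun l => (10 ^ 5 * (2 * range l + r : ℕ) / s : ℝ) ^ exponent with hW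
  have hW0 : ∀ l, 0 ≤ W l := fun l => by rw [hW]; positivity
  -- The last visit takes place in one of the blocks, with steps `l₁`. At the end of this block, the
  -- distance to `x` is at most `2 * range l₁ + r`.
  have hblock : ∀ x ∈ X, avg (I * T) (fun l => ind (NearAtExit D n x r [0] 0 l))
      ≤ ∑ i ∈ Finset.range I, avg (i * T) fun l₀ => ind (Survives D n 0 l₀) * avg T fun l₁ =>
        ind (∃ p ∈ (0 + l₀.sum) :: positions (0 + l₀.sum) l₁, dist0 (p - x) ≤ r) * W l₁ := by
    intro x hx
    obtain ⟨hdeep, hsx⟩ := hX x hx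
    refine (avg_le_sum_blocks (E := fun l₀ l₁ l₂ => Survives D n 0 l₀ ∧
      (∃ p ∈ (0 + l₀.sum) :: positions (0 + l₀.sum) l₁, dist0 (p - x) ≤ r) ∧
      (s ≤ 2 * range l₁ + r ∨ NearUntilLeaving x r s ((positions 0 (l₀ ++ l₁)).foldl lerwStep [0])
        (0 + (l₀ ++ l₁).sum) l₂)) ?_).trans ?_
    · intro l hl h
      rcases h.exists_last_visit hdeep hrs hl with h | ⟨a, b, rfl, hb, hsurv, hd, h⟩
      · obtain ⟨v, hv, hvr⟩ := h.near
        obtain rfl : v = 0 := by simpa using hv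
        rw [zero_sub, dist0_neg] at hvr
        omega
      · obtain ⟨i, hi, l₀, a₁, b₁, l₂, rfl, rfl, hlen₀, hlen₁⟩ := exists_block hl.1 hb
        have hmem : 0 + (l₀ ++ a₁).sum ∈ (0 + l₀.sum) :: positions (0 + l₀.sum) (a₁ ++ b₁) := by
          have := endpoint_mem (0 + l₀.sum) a₁
          rw [List.sum_append, ← add_assoc, positions_append, ← List.cons_append]
          exact List.mem_append_left _ this
        refine ⟨i, hi, l₀, a₁ ++ b₁, l₂, by simp, hlen₀, hlen₁, (survives_append.1 hsurv).1,
          ⟨_, hmem, hd⟩, ?_⟩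
        rcases h.of_append with ⟨p, hp, hps⟩ | h
        · left
          have hp' : p ∈ (0 + l₀.sum) :: positions (0 + l₀.sum) (a₁ ++ b₁) := by
            rcases List.mem_cons.1 hp with rfl | hp
            · exact hmem
            · rw [positions_append, add_assoc, ← List.sum_append]
              exact List.mem_cons_of_mem _ (List.mem_append_right _ hp)
          have h1 := dist0_le_range hmem
          have h2 := dist0_le_range hp'
          have h3 := dist0_sub_le p (0 + l₀.sum) x
          have h4 := dist0_sub_le (0 + l₀.sum) (0 + (l₀ ++ a₁).sum) x
          rw [dist0_sub_comm (0 + l₀.sum) (0 + (l₀ ++ a₁).sum)] at h4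
          omega
        · right
          rw [← List.append_assoc l₀, positions_append 0 (l₀ ++ a₁), List.foldl_append,
            List.sum_append (l₁ := l₀ ++ a₁), ← add_assoc]
          exact h
    · refine Finset.sum_le_sum fun i _ => avg_mono fun l₀ hl₀ => ?_
      rw [← avg_mul_left]
      refine avg_mono fun l₁ hl₁ => ?_
      simp only [ind_and, avg_mul_left]
      refine mul_le_mul_of_nonneg_left ?_ (ind_nonneg _)
      by_cases hvis : ∃ p ∈ (0 + l₀.sum) :: positions (0 + l₀.sum) l₁, dist0 (p - x) ≤ r
      swap
      · rw [ind_false hvis, zero_mul, zero_mul]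
      rw [ind_true hvis, one_mul, one_mul]
      obtain ⟨p, hp, hpx⟩ := hvis
      by_cases hfar : s ≤ 2 * range l₁ + r
      · refine (avg_le_const fun _ _ => ind_le_one _).trans ?_
        apply Real.one_le_rpow _ hν
        rw [le_div_iff₀ hs0, one_mul]
        have : (s : ℝ) ≤ (2 * range l₁ + r : ℕ) := by exact_mod_cast hfar
        have h0 : (0 : ℝ) ≤ (2 * range l₁ + r : ℕ) := Nat.cast_nonneg _
        linarith
      · have hsteps : IsSteps (i * T + T) (l₀ ++ l₁) :=
          ⟨by rw [List.length_append, hl₀.1, hl₁.1], fun e he => by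
            rcases List.mem_append.1 he with h | h
            · exact hl₀.2 e h
            · exact hl₁.2 e h⟩
        simp only [hfar, false_or]
        refine (avg_nearUntilLeaving_le hr hsx (by omega) _
          (isLatticePath_zero.foldl hsteps)).trans ?_
        simp only [hW]
        gcongr
        have h1 := dist0_le_range (endpoint_mem (0 + l₀.sum) l₁)
        have h2 := dist0_le_range hp
        have h3 := dist0_sub_le (0 + l₀.sum + l₁.sum) (0 + l₀.sum) x
        have h4 := dist0_sub_le (0 + l₀.sum) p x
        rw [dist0_sub_comm (0 + l₀.sum) p] at h4
        rw [List.sum_append, ← add_assoc]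
        omega
  -- In a block, the walk visits the balls around at most `(2 * (range l + r) + 1) ^ 2` points.
  have hmom : avg T (fun l => (2 * (range l + r) + 1 : ℝ) ^ 2 * W l)
      ≤ 4744 * 10 ^ 5 * (r : ℝ) ^ 2 * (r / s : ℝ) ^ exponent := by
    have h1 : ∀ l, IsSteps T l → (2 * (range l + r) + 1 : ℝ) ^ 2 * W l
        ≤ (10 ^ 5 * (r : ℝ) ^ 2 * (r / s : ℝ) ^ exponent) * (648 + 128 / r ^ 4 * (range l : ℝ) ^ 4) := by
      intro l _
      set Y : ℝ := range l / r with hY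
      have hY0 : 0 ≤ Y := by positivity
      have hYr : (range l : ℝ) = r * Y := by rw [hY]; field_simp
      have hw : W l ≤ 10 ^ 5 * (r / s : ℝ) ^ exponent * (1 + 2 * Y) := by
        have : (10 ^ 5 * (2 * range l + r : ℕ) / s : ℝ) = 10 ^ 5 * (r / s) * (1 + 2 * Y) := by
          push_cast; rw [hYr]; field_simp; ring
        simp only [hW]
        rw [this, Real.mul_rpow (by positivity) (by positivity),
          Real.mul_rpow (by positivity) (by positivity)]
        gcongr
        · exact Real.rpow_le_self_of_one_le (by norm_num) hν1
        · exact Real.rpow_le_self_of_one_le (by linarith) hν1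
      have hc : (2 * (range l + r) + 1 : ℝ) ≤ r * (3 + 2 * Y) := by
        rw [hYr]
        have : (1 : ℝ) ≤ r := by exact_mod_cast hr
        nlinarith
      calc (2 * (range l + r) + 1 : ℝ) ^ 2 * W l
          ≤ (r * (3 + 2 * Y)) ^ 2 * (10 ^ 5 * (r / s : ℝ) ^ exponent * (1 + 2 * Y)) := by
            gcongr
        _ = (10 ^ 5 * (r : ℝ) ^ 2 * (r / s : ℝ) ^ exponent) * ((3 + 2 * Y) ^ 2 * (1 + 2 * Y)) := by
            ring
        _ ≤ (10 ^ 5 * (r : ℝ) ^ 2 * (r / s : ℝ) ^ exponent) * (648 + 128 / r ^ 4 * (range l : ℝ) ^ 4) := by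
            gcongr
            rw [hYr]
            have : 128 / (r : ℝ) ^ 4 * (r * Y) ^ 4 = 128 * Y ^ 4 := by field_simp
            rw [this]
            nlinarith [sq_nonneg (Y ^ 2 - 1), sq_nonneg (Y - 1), sq_nonneg (Y ^ 2 - Y),
              mul_nonneg hY0 hY0]
    refine (avg_mono h1).trans ?_
    rw [avg_mul_left, avg_add, avg_const, avg_mul_left]
    have h2 := avg_range_pow_four_le T
    have h3 : 128 / (r : ℝ) ^ 4 * avg T (fun l => (range l : ℝ) ^ 4) ≤ 4096 := by
      calc _ ≤ 128 / (r : ℝ) ^ 4 * (32 * (T : ℝ) ^ 2) := by gcongr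
        _ = 4096 := by rw [hT]; push_cast; field_simp; norm_num
    calc _ ≤ (10 ^ 5 * (r : ℝ) ^ 2 * (r / s : ℝ) ^ exponent) * (648 + 4096) := by gcongr
      _ = _ := by ring
  refine (Finset.sum_le_sum hblock).trans ?_
  rw [Finset.sum_comm, Finset.sum_mul]
  refine Finset.sum_le_sum fun i _ => ?_
  rw [← avg_sum, surv, ← avg_mul_right]
  refine avg_mono fun l₀ _ => ?_
  rw [← Finset.mul_sum, ← avg_sum]
  refine mul_le_mul_of_nonneg_left (le_trans (avg_mono fun l₁ _ => ?_) hmom) (ind_nonneg _)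
  rw [← Finset.sum_mul]
  exact mul_le_mul_of_nonneg_right (sum_ind_visit_le X r) (hW0 l₁)

/-- The walk from `z` comes within distance `R` of `x` before it leaves the domain. -/
def VisitsInside (D : Set ℂ) (n : ℕ) (x : ℤ × ℤ) (R : ℕ) (z : ℤ × ℤ) (l : List (ℤ × ℤ)) : Prop :=
  ∃ a b, l = a ++ b ∧ Survives D n z a ∧ dist0 (z + a.sum - x) ≤ R

/-- The number of points close to the boundary which are approached within time `j` is controlled
by the probability to leave the domain soon after. -/
lemma sum_avg_visitsInside_le
    (hlog : ∀ a ∉ dilate n D, ∃ f : ℂ → ℂ, ContinuousOn f (dilate n D) ∧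
      ∀ z ∈ dilate n D, Complex.exp (f z) = z - a)
    (hs : 1 ≤ s) {X : Finset (ℤ × ℤ)} (hX : ∀ x ∈ X, ¬ Deep D n x s) {T : ℕ}
    (hT : T = 1600 * (2 * s) ^ 2 + 1) {j : ℕ} (hj : j ≤ T) (z : ℤ × ℤ) :
    avg j (fun l => ∑ x ∈ X, ind (VisitsInside D n x s z l))
      ≤ 20736 * (2 * 10 ^ 6) * s ^ 2 * (1 - surv D n (j + T) z) := by
  have hs1 : (1 : ℝ) ≤ s := by exact_mod_cast hs
  have hnot : ∀ x ∈ X, ∀ {z}, dist0 (z - x) ≤ s → ∃ w, Bad D n w ∧ dist0 (z - w) ≤ 2 * s := by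
    intro x hx z hzx
    have := hX x hx
    simp only [Deep, not_forall, not_not] at this
    obtain ⟨v, hv, hbad⟩ := this
    refine ⟨v, hbad, ?_⟩
    have := dist0_sub_le z x v
    rw [dist0_sub_comm x v] at this
    omega
  -- Once the walk is close to the boundary, the right-hand side is of order `s ^ 2`, which is the
  -- expected number of points approached during `j ≤ T` steps.
  have hstrip : ∀ j ≤ T, ∀ z, (∃ w, Bad D n w ∧ dist0 (z - w) ≤ 2 * s) →
      avg j (fun l => ∑ x ∈ X, ind (VisitsInside D n x s z l))
        ≤ 20736 * (2 * 10 ^ 6) * s ^ 2 * (1 - surv D n (j + T) z) := by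
    intro j hj z hz
    obtain ⟨w, hw, hzw⟩ := hz
    have h1 : surv D n (j + T) z ≤ 1 - 1 / 20736 :=
      (surv_antitone z (Nat.le_add_left T j)).trans
        (hT ▸ surv_le_of_close_bad hlog hw (by omega) hzw)
    have h2 : avg j (fun l => ∑ x ∈ X, ind (VisitsInside D n x s z l)) ≤ 2 * 10 ^ 6 * s ^ 2 := by
      calc _ ≤ avg j (fun l => (8 * (range l : ℝ) ^ 2 + 18 * (s : ℝ) ^ 2)) := by
            refine avg_mono fun l _ => ?_
            calc _ ≤ ∑ x ∈ X, ind (∃ p ∈ z :: positions z l, dist0 (p - x) ≤ s) := by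
                  refine Finset.sum_le_sum fun x _ => ind_mono ?_
                  rintro ⟨a, b, rfl, -, hd⟩
                  refine ⟨_, ?_, hd⟩
                  rw [positions_append, ← List.cons_append]
                  exact List.mem_append_left _ (endpoint_mem z a)
              _ ≤ (2 * (range l + s) + 1 : ℝ) ^ 2 := sum_ind_visit_le X s
              _ ≤ (2 * range l + 3 * s) ^ 2 := by
                  apply pow_le_pow_left₀ (by positivity)
                  linarith
              _ ≤ _ := by nlinarith [sq_nonneg (2 * (range l : ℝ) - 3 * s)]
        _ ≤ 8 * (33 * T) + 18 * (s : ℝ) ^ 2 := by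
            rw [avg_add, avg_mul_left, avg_const]
            gcongr
            exact (avg_range_sq_le j).trans (by gcongr)
        _ ≤ _ := by
            rw [hT]; push_cast
            nlinarith
    have h3 : (0 : ℝ) ≤ 20736 * (2 * 10 ^ 6) * s ^ 2 := by positivity
    have := mul_le_mul_of_nonneg_left (by linarith : 1 / 20736 ≤ 1 - surv D n (j + T) z) h3
    linarith
  induction j generalizing z with
  | zero =>
    by_cases hz : ∃ w, Bad D n w ∧ dist0 (z - w) ≤ 2 * s
    · exact hstrip 0 hj z hz
    rw [avg_zero, Finset.sum_eq_zero]
    · have := surv_le_one (D := D) (n := n) (0 + T) z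
      have : 0 ≤ 1 - surv D n (0 + T) z := by linarith
      positivity
    · intro x hx
      apply ind_false
      rintro ⟨a, b, hab, -, hd⟩
      obtain ⟨rfl, rfl⟩ : a = [] ∧ b = [] := by simpa using hab.symm
      exact hz (hnot x hx (by simpa using hd))
  | succ j ih =>
    by_cases hz : ∃ w, Bad D n w ∧ dist0 (z - w) ≤ 2 * s
    · exact hstrip (j + 1) hj z hz
    have hV : ∀ x ∈ X, ∀ e l, VisitsInside D n x s z (e :: l) →
        EdgeInside D n z (z + e) ∧ VisitsInside D n x s (z + e) l := by
      rintro x hx e l ⟨a, b, hab, hsurv, hd⟩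
      rcases a with _ | ⟨e', a⟩
      · exact absurd (hnot x hx (by simpa using hd)) hz
      · obtain ⟨rfl, rfl⟩ : e = e' ∧ l = a ++ b := by simpa using hab
        exact ⟨hsurv.1, a, b, rfl, hsurv.2, by rwa [List.sum_cons, ← add_assoc] at hd⟩
    have h1 : ∀ e ∈ unitSteps, avg j (fun l => ∑ x ∈ X, ind (VisitsInside D n x s z (e :: l)))
        ≤ 20736 * (2 * 10 ^ 6) * s ^ 2 *
          (1 - ind (EdgeInside D n z (z + e)) * surv D n (j + T) (z + e)) := by
      intro e _
      by_cases hin : EdgeInside D n z (z + e)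
      · rw [ind_true hin, one_mul]
        refine le_trans (avg_mono fun l _ => Finset.sum_le_sum fun x hx => ?_)
          (ih (by omega) (z + e))
        exact ind_mono fun h => (hV x hx e l h).2
      · rw [ind_false hin, zero_mul, sub_zero, avg_congr (g := fun _ => 0), avg_const]
        · positivity
        · intro l _
          exact Finset.sum_eq_zero fun x hx => ind_false fun h => hin (hV x hx e l h).1
    have h2 := Finset.sum_le_sum h1
    have h3 : ∑ _e ∈ unitSteps, (1 : ℝ) = 4 := by simp [unitSteps]
    rw [← Finset.mul_sum, Finset.sum_sub_distrib, h3] at h2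
    rw [avg_succ, show j + 1 + T = j + T + 1 by ring, surv_succ]
    linarith

/-- The expected number of points close to the boundary which are approached by the loop-erased
random walk. -/
lemma sum_avg_shallow_le
    (hlog : ∀ a ∉ dilate n D, ∃ f : ℂ → ℂ, ContinuousOn f (dilate n D) ∧
      ∀ z ∈ dilate n D, Complex.exp (f z) = z - a)
    (hrs : r < s) {X : Finset (ℤ × ℤ)} (hX : ∀ x ∈ X, ¬ Deep D n x s ∧ s ≤ dist0 x) {T : ℕ}
    (hT : T = 1600 * (2 * s) ^ 2 + 1) (I : ℕ) :
    ∑ x ∈ X, avg (I * T) (fun l => ind (NearAtExit D n x r [0] 0 l))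
      ≤ 2 * (20736 * (2 * 10 ^ 6) * s ^ 2) := by
  have hblock : ∀ x ∈ X, avg (I * T) (fun l => ind (NearAtExit D n x r [0] 0 l))
      ≤ ∑ i ∈ Finset.range I, avg (i * T) fun l₀ => ind (Survives D n 0 l₀) * avg T fun l₁ =>
        ind (VisitsInside D n x s (0 + l₀.sum) l₁) := by
    intro x hx
    refine (avg_le_sum_blocks (E := fun l₀ l₁ _ => Survives D n 0 l₀ ∧
      VisitsInside D n x s (0 + l₀.sum) l₁) ?_).trans ?_
    · intro l hl h
      rcases h.exists_visit hl with ⟨v, hv, hvr⟩ | ⟨a, b, rfl, hb, hsurv, hd⟩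
      · obtain rfl : v = 0 := by simpa using hv
        rw [zero_sub, dist0_neg] at hvr
        have := (hX x hx).2
        omega
      · obtain ⟨i, hi, l₀, a₁, b₁, l₂, rfl, rfl, hlen₀, hlen₁⟩ := exists_block hl.1 hb
        rw [survives_append] at hsurv
        refine ⟨i, hi, l₀, a₁ ++ b₁, l₂, by simp, hlen₀, hlen₁, hsurv.1, a₁, b₁, rfl, hsurv.2, ?_⟩
        rw [List.sum_append, ← add_assoc] at hd
        omega
    · refine Finset.sum_le_sum fun i _ => avg_mono fun l₀ _ => ?_
      rw [← avg_mul_left]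
      refine avg_mono fun l₁ _ => ?_
      rw [avg_const, ind_and]
  refine (Finset.sum_le_sum hblock).trans ?_
  rw [Finset.sum_comm]
  set K : ℝ := 20736 * (2 * 10 ^ 6) * s ^ 2 with hK
  have hK0 : 0 ≤ K := by positivity
  -- The bounds for the blocks telescope.
  have h1 : ∀ i ∈ Finset.range I,
      ∑ x ∈ X, avg (i * T) (fun l₀ => ind (Survives D n 0 l₀) * avg T fun l₁ =>
        ind (VisitsInside D n x s (0 + l₀.sum) l₁))
      ≤ K * ((surv D n (i * T) 0 + surv D n ((i + 1) * T) 0)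
        - (surv D n ((i + 1) * T) 0 + surv D n ((i + 1 + 1) * T) 0)) := by
    intro i _
    rw [← avg_sum]
    have h2 : (surv D n (i * T) 0 + surv D n ((i + 1) * T) 0)
        - (surv D n ((i + 1) * T) 0 + surv D n ((i + 1 + 1) * T) 0)
        = avg (i * T) fun l₀ => ind (Survives D n 0 l₀) * (1 - surv D n (T + T) (0 + l₀.sum)) := by
      rw [show (i + 1 + 1) * T = i * T + (T + T) by ring, surv_add (i * T) (T + T), surv]
      simp only [mul_sub, mul_one, avg_sub]
      ring
    rw [h2, ← avg_mul_left]
    refine avg_mono fun l₀ _ => ?_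
    rw [← Finset.mul_sum, ← avg_sum, mul_left_comm]
    exact mul_le_mul_of_nonneg_left
      (sum_avg_visitsInside_le hlog (by omega) (fun x hx => (hX x hx).1) hT le_rfl _) (ind_nonneg _)
  refine (Finset.sum_le_sum h1).trans ?_
  rw [← Finset.mul_sum,
    Finset.sum_range_sub' (fun i => surv D n (i * T) 0 + surv D n ((i + 1) * T) 0)]
  have := surv_le_one (D := D) (n := n) (0 * T) 0
  have := surv_le_one (D := D) (n := n) ((0 + 1) * T) 0
  have := surv_nonneg (D := D) (n := n) (I * T) 0
  have := surv_nonneg (D := D) (n := n) ((I + 1) * T) 0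
  nlinarith

/-- The expected number of points at distance at most `r` of the loop-erased random walk. The points
are split according to a scale `s` of order `√(n r)`: those close to the origin, those close to
the boundary, and the others. -/
theorem sum_avg_nearAtExit_le {ρ : ℕ}
    (hlog : ∀ a ∉ dilate n D, ∃ f : ℂ → ℂ, ContinuousOn f (dilate n D) ∧
      ∀ z ∈ dilate n D, Complex.exp (f z) = z - a)
    (hn : 1 ≤ n) (hρ : 1 ≤ ρ) (hD : ∀ z ∈ D, |z.re| ≤ ρ ∧ |z.im| ≤ ρ) (h0 : (0 : ℂ) ∈ D)
    (hr : 1 ≤ r) (m : ℕ) :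
    ∑ x ∈ ball 0 (2 * (n * ρ)), avg m (fun l => ind (NearAtExit D n x r [0] 0 l))
      ≤ 10 ^ 12 * (ρ : ℝ) ^ 2 * n ^ 2 * (r / n : ℝ) ^ (exponent / 2) := by
  classical
  have hν : 0 ≤ exponent / 2 := by norm_num [exponent]
  have hν1 : exponent / 2 ≤ 1 := by norm_num [exponent]
  have hn0 : (1 : ℝ) ≤ n := by exact_mod_cast hn
  have hρ0 : (1 : ℝ) ≤ ρ := by exact_mod_cast hρ
  have hr0 : (1 : ℝ) ≤ r := by exact_mod_cast hr
  -- For `n < r` the number of all points of the ball suffices.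
  rcases lt_or_ge n r with hnr | hrn
  · have h1 : (1 : ℝ) ≤ (r / n : ℝ) ^ (exponent / 2) := by
      apply Real.one_le_rpow _ hν
      rw [le_div_iff₀ (by linarith), one_mul]
      exact_mod_cast hnr.le
    have h2 : ∑ x ∈ ball 0 (2 * (n * ρ)), avg m (fun l => ind (NearAtExit D n x r [0] 0 l))
        ≤ ((2 * (2 * (n * ρ)) + 1 : ℕ) : ℝ) ^ 2 := by
      calc _ ≤ ∑ _x ∈ ball 0 (2 * (n * ρ)), (1 : ℝ) :=
            Finset.sum_le_sum fun x _ => avg_le_const fun _ _ => ind_le_one _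
        _ = ((ball 0 (2 * (n * ρ))).card : ℝ) := by simp
        _ ≤ _ := by exact_mod_cast card_ball_le _ _
    have h3 : ((2 * (2 * (n * ρ)) + 1 : ℕ) : ℝ) ≤ 5 * (n * ρ) := by
      push_cast
      nlinarith
    calc _ ≤ (5 * (n * ρ : ℝ)) ^ 2 := h2.trans (by gcongr)
      _ ≤ 10 ^ 12 * (ρ : ℝ) ^ 2 * n ^ 2 * 1 := by
          have : (0 : ℝ) ≤ (n * ρ) ^ 2 := by positivity
          nlinarith
      _ ≤ _ := by gcongr
  set s := Nat.sqrt (n * r) + 1 with hs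
  have hs1 : n * r ≤ s ^ 2 := by rw [sq]; exact (Nat.lt_succ_sqrt _).le
  have hs2 : s ^ 2 ≤ 4 * (n * r) := by
    have h1 := Nat.sqrt_le (n * r)
    have h2 : 1 ≤ Nat.sqrt (n * r) := Nat.le_sqrt.2 (by nlinarith)
    rw [hs]
    nlinarith
  have hrs : r < s := by
    have : r ≤ Nat.sqrt (n * r) := Nat.le_sqrt.2 (Nat.mul_le_mul_right _ hrn)
    omega
  have hs1' : (n * r : ℝ) ≤ s ^ 2 := by exact_mod_cast hs1
  have hs2' : (s : ℝ) ^ 2 ≤ 4 * (n * r) := by exact_mod_cast hs2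
  have hspos : (0 : ℝ) < s := by exact_mod_cast (by omega : 0 < s)
  set q : ℝ := (r / n : ℝ) ^ (exponent / 2) with hq
  have hq0 : 0 ≤ q := by positivity
  have hrn' : (r : ℝ) ≤ n := by exact_mod_cast hrn
  have hnr : (n * r : ℝ) ≤ n ^ 2 * q := by
    have h1 : (r / n : ℝ) ≤ q := by
      rw [hq]
      apply Real.self_le_rpow_of_le_one (by positivity) _ hν1
      rw [div_le_one (by linarith)]; exact hrn'
    calc (n * r : ℝ) = n ^ 2 * (r / n) := by field_simp
      _ ≤ _ := by gcongr
  have hsq : (r / s : ℝ) ^ exponent ≤ q := by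
    have : (r / s : ℝ) ^ exponent = ((r / s : ℝ) ^ 2) ^ (exponent / 2) := by
      rw [← Real.rpow_natCast, ← Real.rpow_mul (by positivity)]
      congr 1; push_cast; ring
    rw [this, hq]
    gcongr
    rw [div_pow, div_le_div_iff₀ (by positivity) (by linarith)]
    nlinarith
  -- The three classes of points.
  set B := ball 0 (2 * (n * ρ))
  set f : ℤ × ℤ → ℝ := fun x => avg m (fun l => ind (NearAtExit D n x r [0] 0 l)) with hf
  have hf0 : ∀ x, 0 ≤ f x := fun x => avg_nonneg fun _ _ => ind_nonneg _
  have hnear : ∑ x ∈ B.filter (fun x => ¬ s ≤ dist0 x), f x ≤ 36 * (n * r) := by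
    calc _ ≤ ∑ x ∈ ball 0 s, (1 : ℝ) := by
          refine (Finset.sum_le_sum_of_subset_of_nonneg (fun x hx => ?_) fun x _ _ => hf0 x).trans
            (Finset.sum_le_sum fun x _ => avg_le_const fun _ _ => ind_le_one _)
          rw [mem_ball, sub_zero]
          exact (not_le.1 (Finset.mem_filter.1 hx).2).le
      _ = ((ball 0 s).card : ℝ) := by simp
      _ ≤ ((2 * s + 1 : ℕ) : ℝ) ^ 2 := by exact_mod_cast card_ball_le _ _
      _ ≤ (3 * s : ℝ) ^ 2 := by
          have : (1 : ℝ) ≤ s := by exact_mod_cast (by omega : 1 ≤ s)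
          gcongr
          push_cast
          linarith
      _ ≤ 36 * (n * r) := by nlinarith
  have hshallow : ∑ x ∈ (B.filter fun x => s ≤ dist0 x).filter (fun x => ¬ Deep D n x s), f x
      ≤ 2 * (20736 * (2 * 10 ^ 6) * (4 * (n * r))) := by
    refine le_trans ?_ ((sum_avg_shallow_le (r := r) hlog hrs
      (X := (B.filter fun x => s ≤ dist0 x).filter (fun x => ¬ Deep D n x s)) (fun x hx => ?_)
      rfl m).trans (by gcongr))
    · refine Finset.sum_le_sum fun x _ => avg_nearAtExit_mono ?_ _ _
      exact Nat.le_mul_of_pos_right _ (by positivity)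
    · simp only [Finset.mem_filter] at hx
      exact ⟨hx.2, hx.1.2⟩
  have hdeep : ∑ x ∈ (B.filter fun x => s ≤ dist0 x).filter (fun x => Deep D n x s), f x
      ≤ 4744 * 10 ^ 5 * (9 * (n * ρ) ^ 2) * q := by
    refine le_trans ?_ ((sum_avg_deep_le (D := D) (n := n) hr hrs
      (X := (B.filter fun x => s ≤ dist0 x).filter (fun x => Deep D n x s)) (fun x hx => ?_)
      m).trans ?_)
    · refine Finset.sum_le_sum fun x _ => avg_nearAtExit_mono ?_ _ _
      exact Nat.le_mul_of_pos_right _ (by positivity)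
    · simp only [Finset.mem_filter] at hx
      exact ⟨hx.2, hx.1.2⟩
    · have h1 := sum_surv_mul_le hn hρ hD h0 (T := r ^ 2) (Nat.one_le_pow _ _ hr) m
      calc _ ≤ (1 + 8 * (n * ρ) ^ 2 / (r ^ 2 : ℕ)) * (4744 * 10 ^ 5 * (r : ℝ) ^ 2 * q) := by gcongr
        _ = 4744 * 10 ^ 5 * (r ^ 2 + 8 * (n * ρ) ^ 2) * q := by push_cast; field_simp
        _ ≤ _ := by
          gcongr
          have : (r : ℝ) ^ 2 ≤ (n * ρ) ^ 2 := by
            gcongr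
            nlinarith
          linarith
  rw [← Finset.sum_filter_add_sum_filter_not B (fun x => s ≤ dist0 x),
    ← Finset.sum_filter_add_sum_filter_not (B.filter fun x => s ≤ dist0 x) (fun x => Deep D n x s)]
  have h1 : (n : ℝ) ^ 2 * q ≤ ρ ^ 2 * n ^ 2 * q := by
    have : (1 : ℝ) ≤ ρ ^ 2 := by nlinarith
    have h2 : (0 : ℝ) ≤ n ^ 2 * q := by positivity
    nlinarith
  have h2 : (0 : ℝ) ≤ ρ ^ 2 * n ^ 2 * q := by positivity
  have h3 : 4744 * 10 ^ 5 * (9 * (n * ρ : ℝ) ^ 2) * q = 4744 * 10 ^ 5 * 9 * (ρ ^ 2 * n ^ 2 * q) := by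
    ring
  rw [show (10 : ℝ) ^ 12 * ρ ^ 2 * n ^ 2 * q = 10 ^ 12 * (ρ ^ 2 * n ^ 2 * q) by ring]
  linarith

end

/-! ### Closed step sequences -/

/-- The sequences of `k` unit steps. -/
def stepLists : ℕ → Finset (List (ℤ × ℤ))
  | 0 => {[]}
  | k + 1 => (unitSteps ×ˢ stepLists k).image fun p => p.1 :: p.2

lemma mem_stepLists {k : ℕ} {l : List (ℤ × ℤ)} : l ∈ stepLists k ↔ IsSteps k l := by
  induction k generalizing l with
  | zero => simp [stepLists, IsSteps]; rintro rfl; simp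
  | succ k ih =>
    rw [stepLists, Finset.mem_image]
    constructor
    · rintro ⟨p, hp, rfl⟩
      rw [Finset.mem_product, ih] at hp
      exact hp.2.cons hp.1
    · intro h
      cases l with
      | nil => simp [IsSteps] at h
      | cons e l =>
        have := isSteps_cons h
        exact ⟨(e, l), by rw [Finset.mem_product, ih]; exact this, rfl⟩

lemma sum_stepLists (k : ℕ) (f : List (ℤ × ℤ) → ℝ) : ∑ l ∈ stepLists k, f l = 4 ^ k * avg k f := by
  induction k generalizing f with
  | zero => simp [stepLists]
  | succ k ih =>
    rw [stepLists, Finset.sum_image (by rintro ⟨a, b⟩ _ ⟨c, d⟩ _ h; simpa using h),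
      Finset.sum_product, avg_succ]
    simp only [ih, ← Finset.mul_sum]
    ring

lemma avg_comm (a b : ℕ) (f : List (ℤ × ℤ) → List (ℤ × ℤ) → ℝ) :
    avg a (fun l => avg b fun l' => f l l') = avg b fun l' => avg a fun l => f l l' := by
  induction a generalizing f with
  | zero => rfl
  | succ a ih =>
    simp only [avg_succ, ih, div_eq_mul_inv]
    rw [avg_mul_right, avg_sum]

lemma exists_split_of_mem_positions {z p : ℤ × ℤ} {l : List (ℤ × ℤ)} (hp : p ∈ positions z l) :
    ∃ c d, l = c ++ d ∧ p = z + c.sum := by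
  induction l generalizing z with
  | nil => simp [positions] at hp
  | cons e l ih =>
    rcases List.mem_cons.1 hp with rfl | hp
    · exact ⟨[e], l, rfl, by simp⟩
    · obtain ⟨c, d, rfl, rfl⟩ := ih hp
      exact ⟨e :: c, d, rfl, by simp [add_assoc]⟩

lemma range_le_of_sum_eq_zero {l l' : List (ℤ × ℤ)} (h : l.sum + l'.sum = 0) :
    range (l ++ l') ≤ max (range l) (range l'.reverse) := by
  refine range_le fun p hp => ?_
  rw [positions_append, List.mem_append] at hp
  rcases hp with hp | hp
  · refine le_max_of_le_left ?_
    simpa using dist0_le_range (List.mem_cons_of_mem _ hp)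
  · refine le_max_of_le_right ?_
    obtain ⟨c, d, hl', rfl⟩ := exists_split_of_mem_positions hp
    have h1 : 0 + l.sum + c.sum = -d.reverse.sum := by
      rw [hl', List.sum_append] at h
      rw [List.sum_reverse, eq_neg_iff_add_eq_zero, zero_add, add_assoc]
      exact h
    rw [h1, dist0_neg, hl', List.reverse_append]
    have h2 : 0 + d.reverse.sum ∈ 0 :: positions 0 (d.reverse ++ c.reverse) := by
      rw [positions_append, ← List.cons_append]
      exact List.mem_append_left _ (endpoint_mem _ _)
    simpa using dist0_le_range h2

/-- The range of a closed walk is controlled by the ranges of its first half and of its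
time-reversed second half. Given one half, the other one closes the walk with a probability of
order `1 / k` by the local bound on the transition probabilities. -/
lemma avg_closed_range_sq_le {k : ℕ} (hk : 1 ≤ k) :
    avg k (fun l => ind (l.sum = 0) * (range l : ℝ) ^ 2) ≤ 99 := by
  rcases Nat.lt_or_ge k 2 with h2 | h2
  · obtain rfl : k = 1 := by omega
    have := avg_range_sq_le 1
    refine le_trans (avg_mono fun l _ => mul_le_of_le_one_left (by positivity) (ind_le_one _)) ?_
    norm_num at this ⊢
    linarith
  -- The two parts have comparable lengths, of order `k`.
  · obtain ⟨a, b, rfl, ha, hab, hb⟩ : ∃ a b, k = a + b ∧ 1 ≤ a ∧ a ≤ b ∧ b ≤ 2 * a :=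
      ⟨k / 2, k - k / 2, by omega, by omega, by omega, by omega⟩
    have h1 : avg (a + b) (fun l => ind (l.sum = 0) * (range l : ℝ) ^ 2)
        ≤ avg a (fun l => avg b fun l' => ind (l.sum + l'.sum = 0) * (range l : ℝ) ^ 2
            + ind (l.sum + l'.sum = 0) * (range l'.reverse : ℝ) ^ 2) := by
      rw [avg_append]
      refine avg_mono fun l _ => avg_mono fun l' _ => ?_
      rw [List.sum_append]
      by_cases h : l.sum + l'.sum = 0
      · rw [ind_true h]
        simp only [one_mul]
        rcases le_max_iff.1 (range_le_of_sum_eq_zero h) with h | h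
        · have : (range (l ++ l') : ℝ) ≤ range l := by exact_mod_cast h
          have := pow_le_pow_left₀ (by positivity) this 2
          nlinarith [sq_nonneg (range l'.reverse : ℝ)]
        · have : (range (l ++ l') : ℝ) ≤ range l'.reverse := by exact_mod_cast h
          have := pow_le_pow_left₀ (by positivity) this 2
          nlinarith [sq_nonneg (range l : ℝ)]
      · rw [ind_false h]; simp
    have h3 : avg a (fun l => avg b fun l' => ind (l.sum + l'.sum = 0) * (range l : ℝ) ^ 2)
        ≤ 33 := by
      have : avg a (fun l => avg b fun l' => ind (l.sum + l'.sum = 0) * (range l : ℝ) ^ 2)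
          ≤ avg a fun l => 1 / (b : ℝ) * (range l : ℝ) ^ 2 := by
        refine avg_mono fun l _ => ?_
        rw [avg_mul_right]
        refine mul_le_mul_of_nonneg_right ?_ (by positivity)
        refine le_trans (le_of_eq ?_) (avg_ind_sum_eq_le (ha.trans hab) (-l.sum))
        congr 1; ext l'
        exact ind_congr (by rw [eq_neg_iff_add_eq_zero, add_comm])
      refine this.trans ?_
      rw [avg_mul_left, one_div, inv_mul_le_iff₀ (by exact_mod_cast ha.trans hab)]
      have := avg_range_sq_le a
      have : (a : ℝ) ≤ b := by exact_mod_cast hab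
      linarith
    have h4 : avg a (fun l => avg b fun l' => ind (l.sum + l'.sum = 0) * (range l'.reverse : ℝ) ^ 2)
        ≤ 66 := by
      rw [avg_comm]
      have : avg b (fun l' => avg a fun l => ind (l.sum + l'.sum = 0) * (range l'.reverse : ℝ) ^ 2)
          ≤ avg b fun l' => 1 / (a : ℝ) * (range l'.reverse : ℝ) ^ 2 := by
        refine avg_mono fun l' _ => ?_
        rw [avg_mul_right]
        refine mul_le_mul_of_nonneg_right ?_ (by positivity)
        refine le_trans (le_of_eq ?_) (avg_ind_sum_eq_le ha (-l'.sum))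
        congr 1; ext l
        exact ind_congr (by rw [eq_neg_iff_add_eq_zero])
      refine this.trans ?_
      rw [avg_mul_left, avg_reverse b fun l => (range l : ℝ) ^ 2, one_div,
        inv_mul_le_iff₀ (by exact_mod_cast ha)]
      have := avg_range_sq_le b
      have : (b : ℝ) ≤ 2 * a := by exact_mod_cast hb
      linarith
    refine h1.trans ?_
    simp only [avg_add]
    linarith

lemma rpow_le_one_add_sq {y p : ℝ} (hy : 0 ≤ y) (hp : 0 ≤ p) (hp2 : p ≤ 2) : y ^ p ≤ 1 + y ^ 2 := by
  rcases le_total y 1 with h | h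
  · have := Real.rpow_le_one hy h hp
    nlinarith [sq_nonneg y]
  · have := Real.rpow_le_rpow_of_exponent_le h hp2
    rw [Real.rpow_two] at this
    linarith

lemma avg_closed_range_rpow_le {k : ℕ} (hk : 1 ≤ k) {p : ℝ} (hp : 0 ≤ p) (hp2 : p ≤ 2) :
    avg k (fun l => ind (l.sum = 0) * (range l : ℝ) ^ p) ≤ 100 / k * (k : ℝ) ^ (p / 2) := by
  have hk0 : (0 : ℝ) < k := by exact_mod_cast hk
  have h1 : ∀ l : List (ℤ × ℤ), ind (l.sum = 0) * (range l : ℝ) ^ p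
      ≤ (k : ℝ) ^ (p / 2) * (ind (l.sum = 0) + 1 / k * (ind (l.sum = 0) * (range l : ℝ) ^ 2)) := by
    intro l
    have h := rpow_le_one_add_sq (y := range l / √k) (by positivity) hp hp2
    rw [Real.div_rpow (by positivity) (by positivity), div_pow, Real.sq_sqrt hk0.le,
      Real.sqrt_eq_rpow, ← Real.rpow_mul hk0.le, one_div_mul_eq_div, div_le_iff₀ (by positivity)] at h
    have := mul_le_mul_of_nonneg_left h (ind_nonneg (l.sum = 0))
    refine this.trans (le_of_eq ?_)
    ring
  refine (avg_mono fun l _ => h1 l).trans ?_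
  rw [avg_mul_left, avg_add, avg_mul_left, mul_comm]
  refine mul_le_mul_of_nonneg_right ?_ (by positivity)
  have h2 := avg_ind_sum_eq_le hk 0
  have h3 := mul_le_mul_of_nonneg_left (avg_closed_range_sq_le hk) (by positivity : 0 ≤ 1 / (k : ℝ))
  calc _ ≤ 1 / (k : ℝ) + 1 / k * 99 := add_le_add h2 h3
    _ = 100 / k := by ring

lemma one_le_range {k : ℕ} (hk : 1 ≤ k) {l : List (ℤ × ℤ)} (hl : IsSteps k l) : 1 ≤ range l := by
  cases l with
  | nil => simp [IsSteps] at hl; omega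
  | cons e l =>
    have he : e ∈ unitSteps := hl.2 e (by simp)
    have : e ∈ (0 : ℤ × ℤ) :: positions 0 (e :: l) := by simp [positions]
    have := dist0_le_range this
    rwa [sub_zero, dist0_unitSteps he] at this

/-! ### Lattice loops -/

/-- The steps of a lattice walk. -/
def walkSteps {u v : ℤ × ℤ} : squareLattice.Walk u v → List (ℤ × ℤ)
  | .nil => []
  | .cons (v := w) _ p => (w - u) :: walkSteps p

lemma isSteps_walkSteps {u v : ℤ × ℤ} (w : squareLattice.Walk u v) :
    IsSteps w.length (walkSteps w) := by
  induction w with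
  | nil => exact isSteps_nil
  | @cons u v _ h p ih =>
    refine ih.cons ?_
    have h : |u.1 - v.1| + |u.2 - v.2| = 1 := h
    rw [Int.abs_eq_natAbs, Int.abs_eq_natAbs] at h
    simp only [mem_unitSteps, Prod.ext_iff, Prod.fst_sub, Prod.snd_sub]
    omega

lemma sum_walkSteps {u v : ℤ × ℤ} (w : squareLattice.Walk u v) : u + (walkSteps w).sum = v := by
  induction w with
  | nil => simp [walkSteps]
  | cons h p ih => simpa [walkSteps, ← add_assoc] using ih

lemma support_eq {u v : ℤ × ℤ} (w : squareLattice.Walk u v) :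
    w.support = u :: positions u (walkSteps w) := by
  induction w with
  | nil => simp [walkSteps, positions]
  | cons h p ih => simp [walkSteps, positions, ih]

/-- A loop is determined by its root and its steps. -/
lemma loop_injective :
    Function.Injective fun L : LatticeLoop => (L.root, walkSteps L.walk) := by
  rintro ⟨r, w, h⟩ ⟨r', w', h'⟩ heq
  obtain ⟨rfl, h2⟩ := Prod.mk.inj heq
  have : w = w' := by
    apply SimpleGraph.Walk.ext_support
    rw [support_eq, support_eq]
    simp only at h2
    rw [h2]
  subst this
  rfl

instance : Countable LatticeLoop := loop_injective.countable

lemma Near.of_meets {γ : List (ℤ × ℤ)} {L : LatticeLoop} (h : L.Meets γ) :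
    Near L.root (range (walkSteps L.walk)) γ := by
  obtain ⟨v, hv, hvγ⟩ := h
  rw [support_eq] at hv
  exact ⟨v, hvγ, dist0_le_range hv⟩

lemma root_mem_dilate {D : Set ℂ} {n : ℕ} {L : LatticeLoop} (h : L.Inside D n) :
    latticePoint L.root ∈ dilate n D := by
  obtain ⟨r, w, hw⟩ := L
  cases w with
  | nil => simp at hw
  | cons hadj p => exact left_mem_of_edgeInside (h ⟨(_, _), hadj⟩ (by simp))

/-! ### The law of the walk and of its loop-erasure -/

/-- The first `m` terms of a sequence. -/
def firstSteps (m : ℕ) (s : ℕ → ℤ × ℤ) : List (ℤ × ℤ) := (List.range m).map s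

lemma firstSteps_succ (m : ℕ) (s : ℕ → ℤ × ℤ) : firstSteps (m + 1) s = firstSteps m s ++ [s m] := by
  simp [firstSteps, List.range_succ]

lemma isSteps_firstSteps {m : ℕ} {s : ℕ → ℤ × ℤ} (h : ∀ i, s i ∈ unitSteps) :
    IsSteps m (firstSteps m s) := by
  simp [IsSteps, firstSteps, h]

lemma toMeasure_uniform_singleton (h : unitSteps.Nonempty) {a : ℤ × ℤ} (ha : a ∈ unitSteps) :
    (PMF.uniformOfFinset unitSteps h).toMeasure {a} = 4⁻¹ := by
  rw [PMF.toMeasure_apply_singleton _ _ (measurableSet_singleton _),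
    PMF.uniformOfFinset_apply_of_mem _ ha]
  rfl

lemma toMeasure_uniform_compl (h : unitSteps.Nonempty) :
    (PMF.uniformOfFinset unitSteps h).toMeasure {a | a ∉ unitSteps} = 0 := by
  rw [PMF.toMeasure_apply_eq_zero_iff _ .of_discrete, PMF.support_uniformOfFinset]
  exact Set.disjoint_left.2 fun a ha ha' => ha' ha

lemma walkStepsLaw_firstSteps_eq_le {m : ℕ} {l : List (ℤ × ℤ)} (hl : IsSteps m l) :
    walkStepsLaw {s | firstSteps m s = l} ≤ ENNReal.ofReal (1 / 4 ^ m) := by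
  have hsub : {s : ℕ → ℤ × ℤ | firstSteps m s = l}
      ⊆ Set.pi (Finset.range m) fun i => {l.getD i 0} := by
    rintro s rfl i hi
    have hi : i < m := by simpa using hi
    simp [firstSteps, hi]
  refine (measure_mono hsub).trans (le_of_eq ?_)
  rw [walkStepsLaw, Measure.infinitePi_pi _ fun i _ => measurableSet_singleton _]
  have h : ∀ i ∈ Finset.range m, (PMF.uniformOfFinset unitSteps
      ⟨(1, 0), by simp [unitSteps]⟩).toMeasure {l.getD i 0} = 4⁻¹ := by
    intro i hi
    have hi : i < l.length := by rw [hl.1]; simpa using hi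
    have hmem : l.getD i 0 ∈ unitSteps := by
      rw [List.getD_eq_getElem _ _ hi]
      exact hl.2 _ (List.getElem_mem hi)
    exact toMeasure_uniform_singleton _ hmem
  rw [Finset.prod_congr rfl h, Finset.prod_const, Finset.card_range, ← one_div_pow,
    ENNReal.ofReal_pow (by norm_num), one_div, ENNReal.ofReal_inv_of_pos (by norm_num)]
  simp

lemma walkStepsLaw_notMem_unitSteps (i : ℕ) : walkStepsLaw {s | s i ∉ unitSteps} = 0 := by
  have h : MeasurableSet {a : ℤ × ℤ | a ∉ unitSteps} := .of_discrete
  have h1 : {s : ℕ → ℤ × ℤ | s i ∉ unitSteps} = (fun s => s i) ⁻¹' {a | a ∉ unitSteps} := rfl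
  rw [h1, ← Measure.map_apply (measurable_pi_apply i) h, walkStepsLaw, Measure.infinitePi_map_eval]
  exact toMeasure_uniform_compl _

lemma walkStepsLaw_le_avg (m : ℕ) (P : List (ℤ × ℤ) → Prop) :
    walkStepsLaw {s | P (firstSteps m s)} ≤ ENNReal.ofReal (avg m fun l => ind (P l)) := by
  classical
  have hsub : {s | P (firstSteps m s)} ⊆ (⋃ i : ℕ, {s | s i ∉ unitSteps}) ∪
      ⋃ l ∈ (stepLists m).filter P, {s | firstSteps m s = l} := by
    intro s hs
    by_cases h : ∀ i, s i ∈ unitSteps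
    · refine Or.inr (Set.mem_biUnion (x := firstSteps m s) ?_ rfl)
      simpa [mem_stepLists] using ⟨isSteps_firstSteps h, hs⟩
    · push Not at h
      exact Or.inl (Set.mem_iUnion.2 h)
  -- The sequences of steps are infinite: a term outside of `unitSteps` has probability zero only.
  refine (measure_mono hsub).trans ((measure_union_le _ _).trans ?_)
  rw [measure_iUnion_null walkStepsLaw_notMem_unitSteps, zero_add]
  refine (measure_biUnion_finset_le _ _).trans ?_
  refine (Finset.sum_le_sum fun l hl => walkStepsLaw_firstSteps_eq_le
    (mem_stepLists.1 (Finset.mem_filter.1 hl).1)).trans (le_of_eq ?_)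
  rw [← ENNReal.ofReal_sum_of_nonneg fun _ _ => by positivity]
  congr 1
  have h2 : ∑ l ∈ stepLists m, ind (P l) = ∑ l ∈ (stepLists m).filter P, 1 := by
    rw [Finset.sum_filter]
    refine Finset.sum_congr rfl fun l _ => ?_
    split_ifs with h
    exacts [ind_true h, ind_false h]
  rw [sum_stepLists] at h2
  rw [Finset.sum_const, nsmul_eq_mul, mul_one_div, div_eq_iff (by positivity), mul_comm, h2]
  simp

lemma sum_firstSteps (m : ℕ) (s : ℕ → ℤ × ℤ) : (firstSteps m s).sum = walkAt s m := by
  induction m with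
  | zero => simp [firstSteps, walkAt]
  | succ m ih => rw [firstSteps_succ, List.sum_append, ih, walkAt, walkAt, Finset.sum_range_succ]; simp

lemma walkAt_succ (s : ℕ → ℤ × ℤ) (m : ℕ) : walkAt s (m + 1) = walkAt s m + s m :=
  Finset.sum_range_succ _ _

lemma map_walkAt (s : ℕ → ℤ × ℤ) (m : ℕ) :
    (List.range (m + 1)).map (walkAt s) = 0 :: positions 0 (firstSteps m s) := by
  induction m with
  | zero => simp [firstSteps, positions, walkAt]
  | succ m ih =>
    rw [List.range_succ, List.map_append, ih, firstSteps_succ, positions_append, sum_firstSteps]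
    simp [positions, walkAt_succ]

variable {D : Set ℂ} {n : ℕ} {x : ℤ × ℤ} {r : ℕ}

lemma survives_firstSteps {m : ℕ} {s : ℕ → ℤ × ℤ} : Survives D n 0 (firstSteps m s) ↔
    ∀ i < m, EdgeInside D n (walkAt s i) (walkAt s (i + 1)) := by
  induction m with
  | zero => simp [firstSteps, Survives]
  | succ m ih =>
    rw [firstSteps_succ, survives_append, ih, Nat.forall_lt_succ_right, sum_firstSteps]
    simp [Survives, walkAt_succ]

lemma nearAtExit_of_survives {l η : List (ℤ × ℤ)} {z e : ℤ × ℤ} (h : Survives D n z l)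
    (he : ¬ EdgeInside D n (z + l.sum) (z + l.sum + e))
    (hnear : Near x r ((positions z (l ++ [e])).foldl lerwStep η)) :
    NearAtExit D n x r η z (l ++ [e]) := by
  induction l generalizing η z with
  | nil => exact Or.inr ⟨by simpa using he, by simpa [positions] using hnear⟩
  | cons a l ih =>
    exact Or.inl ⟨h.1, ih h.2 (by simpa [add_assoc] using he) (by simpa [positions] using hnear)⟩

lemma nearAtExit_firstSteps {m : ℕ} {s : ℕ → ℤ × ℤ} (h : ¬ Survives D n 0 (firstSteps m s))
    (hnear : Near x r (loopErasure (stoppedWalk D n s))) :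
    NearAtExit D n x r [0] 0 (firstSteps m s) := by
  rw [survives_firstSteps] at h
  push Not at h
  obtain ⟨i, hi, hout⟩ := h
  set j := stepsBeforeExit D n s with hj
  have hjout : ¬ EdgeInside D n (walkAt s j) (walkAt s (j + 1)) :=
    Nat.sInf_mem (s := {j | ¬ EdgeInside D n (walkAt s j) (walkAt s (j + 1))}) ⟨i, hout⟩
  have hji : j ≤ i := Nat.sInf_le hout
  have hsurv : Survives D n 0 (firstSteps j s) := survives_firstSteps.2 fun i' hi' => by
    by_contra h
    exact Nat.notMem_of_lt_sInf hi' h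
  have hlist : firstSteps m s = (firstSteps j s ++ [s j])
      ++ (List.range (m - (j + 1))).map (fun i => s (j + 1 + i)) := by
    rw [← firstSteps_succ, firstSteps, show m = (j + 1) + (m - (j + 1)) by omega, List.range_add,
      List.map_append]
    simp [firstSteps, Function.comp_def]
  rw [hlist]
  refine (nearAtExit_of_survives hsurv ?_ ?_).append
  · simpa [sum_firstSteps, walkAt_succ] using hjout
  · rw [stoppedWalk, ← hj, map_walkAt, firstSteps_succ] at hnear
    exact hnear

lemma lerwLaw_near_le (m : ℕ) : lerwLaw D n {γ | Near x r γ} ≤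
    ENNReal.ofReal (avg m fun l => ind (NearAtExit D n x r [0] 0 l)) +
      ENNReal.ofReal (surv D n m 0) := by
  by_cases hf : AEMeasurable (fun s => loopErasure (stoppedWalk D n s)) walkStepsLaw
  · rw [lerwLaw, Measure.map_apply_of_aemeasurable hf trivial]
    have hsub : (fun s => loopErasure (stoppedWalk D n s)) ⁻¹' {γ | Near x r γ}
        ⊆ {s | NearAtExit D n x r [0] 0 (firstSteps m s)} ∪ {s | Survives D n 0 (firstSteps m s)} := by
      intro s hs
      by_cases h : Survives D n 0 (firstSteps m s)
      · exact Or.inr h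
      · exact Or.inl (nearAtExit_firstSteps h hs)
    refine (measure_mono hsub).trans ((measure_union_le _ _).trans ?_)
    exact add_le_add (walkStepsLaw_le_avg m _) (walkStepsLaw_le_avg m _)
  -- Otherwise `lerwLaw` is by convention the zero measure.
  · rw [lerwLaw, Measure.map_of_not_aemeasurable hf]
    simp

lemma tendsto_surv {ρ : ℕ} (hn : 1 ≤ n) (hρ : 1 ≤ ρ) (hD : ∀ z ∈ D, |z.re| ≤ ρ ∧ |z.im| ≤ ρ)
    (h0 : (0 : ℂ) ∈ D) : Filter.Tendsto (fun m => surv D n m 0) Filter.atTop (nhds 0) := by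
  refine squeeze_zero' (Filter.Eventually.of_forall fun m => surv_nonneg m 0) ?_
    (tendsto_const_div_atTop_nhds_zero_nat (8 * ((n : ℝ) * ρ) ^ 2))
  filter_upwards [Filter.eventually_ge_atTop 1] with m hm
  rw [le_div_iff₀ (by exact_mod_cast hm), mul_comm]
  exact mul_surv_le hn hρ hD h0 m

lemma sum_lerwLaw_near_le {ρ : ℕ} (hD_open : IsOpen D) (hD_sc : IsSimplyConnected D)
    (hn : 1 ≤ n) (hρ : 1 ≤ ρ) (hD : ∀ z ∈ D, |z.re| ≤ ρ ∧ |z.im| ≤ ρ) (h0 : (0 : ℂ) ∈ D)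
    (hr : 1 ≤ r) :
    ∑ x ∈ ball 0 (2 * (n * ρ)), lerwLaw D n {γ | Near x r γ} ≤
      ENNReal.ofReal (10 ^ 12 * (ρ : ℝ) ^ 2 * n ^ 2 * (r / n : ℝ) ^ (exponent / 2)) := by
  set B := ball 0 (2 * (n * ρ))
  set V := ENNReal.ofReal (10 ^ 12 * (ρ : ℝ) ^ 2 * n ^ 2 * (r / n : ℝ) ^ (exponent / 2))
  -- The walk leaves the domain almost surely, so that the error term vanishes as `m → ∞`.
  have key : ∀ m : ℕ, ∑ x ∈ B, lerwLaw D n {γ | Near x r γ}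
      ≤ V + B.card * ENNReal.ofReal (surv D n m 0) := by
    intro m
    refine (Finset.sum_le_sum fun x _ => lerwLaw_near_le m).trans ?_
    rw [Finset.sum_add_distrib, Finset.sum_const, nsmul_eq_mul,
      ← ENNReal.ofReal_sum_of_nonneg fun _ _ => avg_nonneg fun _ _ => ind_nonneg _]
    gcongr
    exact ENNReal.ofReal_le_ofReal
      (sum_avg_nearAtExit_le (exists_log_dilate hD_open hD_sc hn) hn hρ hD h0 hr m)
  have hlim : Filter.Tendsto (fun m => V + B.card * ENNReal.ofReal (surv D n m 0)) Filter.atTop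
      (nhds (V + B.card * ENNReal.ofReal 0)) :=
    (ENNReal.Tendsto.const_mul (ENNReal.tendsto_ofReal (tendsto_surv hn hρ hD h0))
      (Or.inr (ENNReal.natCast_ne_top _))).const_add V
  simpa using ge_of_tendsto' hlim key

/-! ### Loops which meet the loop-erased random walk -/

/-- Sum over the loops of `k` steps which meet the loop-erased walk. A loop rooted at `x` of range
`r` can only meet the loop-erased walk if the latter comes within distance `r` of `x`. -/
lemma tsum_loops_le {D : Set ℂ} {n ρ k : ℕ} (hD_open : IsOpen D) (hD_sc : IsSimplyConnected D)
    (hn : 1 ≤ n) (hρ : 1 ≤ ρ) (hD : ∀ z ∈ D, |z.re| ≤ ρ ∧ |z.im| ≤ ρ) (h0 : (0 : ℂ) ∈ D)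
    (hk : 1 ≤ k) :
    ∑' L : {L : LatticeLoop // L.Inside D n ∧ L.duration = k},
        lerwLaw D n {γ | L.1.Meets γ} * loopWeight L.1 ≤
      ENNReal.ofReal (10 ^ 14 * (ρ : ℝ) ^ 2 * (n : ℝ) ^ (2 - exponent / 2) * (k : ℝ) ^ (-2 : ℤ) *
        √k ^ (exponent / 2)) := by
  classical
  have hp : 0 ≤ exponent / 2 := by norm_num [exponent]
  have hp2 : exponent / 2 ≤ 2 := by norm_num [exponent]
  set p := exponent / 2
  have hn0 : (0 : ℝ) < n := by exact_mod_cast hn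
  have hk0 : (0 : ℝ) < k := by exact_mod_cast hk
  set B := ball 0 (2 * (n * ρ))
  set A := (stepLists k).filter fun l => l.sum = 0
  set c : ℝ := 1 / (4 ^ k * k) with hc
  have hc0 : 0 ≤ c := by positivity
  let F : (ℤ × ℤ) × List (ℤ × ℤ) → ℝ≥0∞ :=
    fun q => lerwLaw D n {γ | Near q.1 (range q.2) γ} * ENNReal.ofReal c
  have hmem : ∀ L : {L : LatticeLoop // L.Inside D n ∧ L.duration = k},
      (L.1.root, walkSteps L.1.walk) ∈ B ×ˢ A := by
    rintro ⟨L, hL, rfl⟩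
    refine Finset.mem_product.2 ⟨mem_ball_of_mem_dilate hD (root_mem_dilate hL),
      Finset.mem_filter.2 ⟨mem_stepLists.2 (isSteps_walkSteps _), ?_⟩⟩
    simpa using sum_walkSteps L.walk
  let f : {L : LatticeLoop // L.Inside D n ∧ L.duration = k} → ↥(B ×ˢ A) := fun L => ⟨_, hmem L⟩
  have hf : Function.Injective f := fun L L' h =>
    Subtype.ext (loop_injective (congrArg Subtype.val h))
  have h1 : ∑' L : {L : LatticeLoop // L.Inside D n ∧ L.duration = k},
      lerwLaw D n {γ | L.1.Meets γ} * loopWeight L.1 ≤ ∑ q ∈ B ×ˢ A, F q := by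
    rw [← Finset.tsum_subtype]
    refine le_trans (ENNReal.tsum_le_tsum fun L => ?_)
      (ENNReal.tsum_comp_le_tsum_of_injective hf fun q => F q)
    refine mul_le_mul' (measure_mono fun γ hγ => Near.of_meets hγ) (le_of_eq ?_)
    have : loopWeight L.1 = c.toNNReal := by
      ext
      rw [Real.coe_toNNReal _ hc0, loopWeight, L.2.2, hc]
      push_cast
      rw [inv_pow]
      field_simp
    rw [this]; rfl
  refine h1.trans ?_
  rw [Finset.sum_product_right]
  have h2 : ∀ l ∈ A, ∑ x ∈ B, F (x, l)
      ≤ ENNReal.ofReal (10 ^ 12 * (ρ : ℝ) ^ 2 * n ^ 2 * (range l / n : ℝ) ^ p * c) := by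
    intro l hl
    have hl := mem_stepLists.1 (Finset.mem_filter.1 hl).1
    rw [← Finset.sum_mul, ENNReal.ofReal_mul (by positivity)]
    gcongr
    exact sum_lerwLaw_near_le hD_open hD_sc hn hρ hD h0 (one_le_range hk hl)
  refine (Finset.sum_le_sum h2).trans ?_
  rw [← ENNReal.ofReal_sum_of_nonneg fun _ _ => by positivity]
  refine ENNReal.ofReal_le_ofReal ?_
  have h3 : ∀ l : List (ℤ × ℤ), 10 ^ 12 * (ρ : ℝ) ^ 2 * n ^ 2 * (range l / n : ℝ) ^ p * c
      = 10 ^ 12 * (ρ : ℝ) ^ 2 * (n : ℝ) ^ (2 - p) * c * (range l : ℝ) ^ p := by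
    intro l
    rw [Real.div_rpow (by positivity) (by positivity), Real.rpow_sub hn0, Real.rpow_two]
    ring
  have h4 : ∑ l ∈ A, (range l : ℝ) ^ p ≤ 4 ^ k * (100 / k * (k : ℝ) ^ (p / 2)) := by
    rw [Finset.sum_filter]
    refine le_trans (le_of_eq ?_)
      (mul_le_mul_of_nonneg_left (avg_closed_range_rpow_le hk hp hp2) (by positivity))
    rw [← sum_stepLists]
    refine Finset.sum_congr rfl fun l _ => ?_
    split_ifs with h
    · rw [ind_true h, one_mul]
    · rw [ind_false h, zero_mul]
  simp only [h3]
  rw [← Finset.mul_sum]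
  refine (mul_le_mul_of_nonneg_left h4 (by positivity)).trans (le_of_eq ?_)
  rw [Real.sqrt_eq_rpow, ← Real.rpow_mul hk0.le, one_div_mul_eq_div, hc, zpow_neg,
    show (k : ℝ) ^ (2 : ℤ) = k ^ 2 from zpow_ofNat _ 2]
  field_simp
  norm_num

/-! ### Expectations for the Poisson loop soup -/

lemma lintegral_poissonMeasure (r : ℝ≥0) : ∫⁻ k, (k : ℝ≥0∞) ∂poissonMeasure r = r := by
  rw [poissonMeasure, lintegral_sum_measure]
  simp only [lintegral_smul_measure, lintegral_dirac, smul_eq_mul]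
  have hs : HasSum (fun k : ℕ => Real.exp (-r) * r ^ k / k.factorial * k) (r : ℝ) := by
    rw [← hasSum_nat_add_iff' 1]
    simp only [Finset.range_one, Finset.sum_singleton, Nat.cast_zero, mul_zero, sub_zero]
    have h := (hasSum_one_poissonMeasure r).mul_left (r : ℝ)
    rw [mul_one] at h
    refine h.congr_fun fun k => ?_
    rw [Nat.factorial_succ]
    push_cast
    field_simp
    ring
  conv_rhs => rw [← ENNReal.ofReal_coe_nnreal, ← hs.tsum_eq]
  rw [ENNReal.ofReal_tsum_of_nonneg (fun k => by positivity) hs.summable]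
  refine tsum_congr fun k => ?_
  rw [ENNReal.ofReal_mul (by positivity), ENNReal.ofReal_natCast]

lemma lintegral_loopSoup {Ω : Type*} [MeasurableSpace Ω] {P : Measure Ω}
    {N : Ω → LatticeLoop → ℕ} (hN : HasLaw N loopSoupLaw P) (L : LatticeLoop) :
    ∫⁻ ω, (N ω L : ℝ≥0∞) ∂P = loopWeight L := by
  have hmeas : Measurable fun x : LatticeLoop → ℕ => x L := measurable_pi_apply L
  have hcast : Measurable fun k : ℕ => (k : ℝ≥0∞) := measurable_from_top
  have h1 : ∫⁻ x, (x L : ℝ≥0∞) ∂loopSoupLaw = ∫⁻ ω, (N ω L : ℝ≥0∞) ∂P := by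
    rw [← hN.map_eq, lintegral_map' (f := fun x : LatticeLoop → ℕ => (x L : ℝ≥0∞))
      (hcast.comp hmeas).aemeasurable hN.aemeasurable]
  rw [← h1, ← lintegral_map (f := fun k : ℕ => (k : ℝ≥0∞)) hcast hmeas, loopSoupLaw,
    Measure.infinitePi_map_eval, lintegral_poissonMeasure]

lemma tsum_meeting_eq (D : Set ℂ) (n : ℕ) (γ : List (ℤ × ℤ)) (Q : LatticeLoop → Prop)
    (f : LatticeLoop → ℝ≥0∞) :
    ∑' L : {L : LatticeLoop // L.Inside D n ∧ L.Meets γ ∧ Q L}, f L.1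
      = ∑' L : {L : LatticeLoop // L.Inside D n ∧ Q L},
          Set.indicator {γ | L.1.Meets γ} 1 γ * f L.1 := by
  classical
  refine (tsum_subtype {L : LatticeLoop | L.Inside D n ∧ L.Meets γ ∧ Q L} f).trans
    (Eq.trans (tsum_congr fun L => ?_) (tsum_subtype {L : LatticeLoop | L.Inside D n ∧ Q L}
      fun L => Set.indicator {γ | L.Meets γ} 1 γ * f L).symm)
  by_cases h1 : L.Inside D n <;> by_cases h2 : L.Meets γ <;> by_cases h3 : Q L <;>
    simp [Set.indicator, h1, h2, h3]

lemma lintegral_indicator_meets_mul {Ω : Type*} [MeasurableSpace Ω] {P : Measure Ω} {D : Set ℂ}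
    {n : ℕ} {γ : Ω → List (ℤ × ℤ)} {N : Ω → LatticeLoop → ℕ} (h : IsLerwWithLoopSoup P D n γ N)
    (L : LatticeLoop) :
    AEMeasurable (fun ω => Set.indicator {γ | L.Meets γ} 1 (γ ω) * (N ω L : ℝ≥0∞)) P ∧
    ∫⁻ ω, Set.indicator {γ | L.Meets γ} 1 (γ ω) * (N ω L : ℝ≥0∞) ∂P
      = lerwLaw D n {γ | L.Meets γ} * loopWeight L := by
  have hJ : Measurable (Set.indicator {γ | L.Meets γ} (1 : List (ℤ × ℤ) → ℝ≥0∞)) :=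
    measurable_from_top
  have hcast : Measurable fun x : LatticeLoop → ℕ => (x L : ℝ≥0∞) :=
    measurable_from_top.comp (measurable_pi_apply L)
  have hJγ := hJ.comp_aemeasurable h.lerw.aemeasurable
  have hN := hcast.comp_aemeasurable h.soup.aemeasurable
  refine ⟨hJγ.mul hN, ?_⟩
  refine (lintegral_mul_eq_lintegral_mul_lintegral_of_indepFun'' hJγ hN
    (h.indep.comp hJ hcast)).trans ?_
  congr 1
  · refine (lintegral_map' hJ.aemeasurable h.lerw.aemeasurable).symm.trans ?_
    rw [h.lerw.map_eq]
    exact lintegral_indicator_one MeasurableSpace.measurableSet_top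
  · exact lintegral_loopSoup h.soup L

lemma lintegral_tsum_loops {Ω : Type*} [MeasurableSpace Ω] {P : Measure Ω} (Q : LatticeLoop → Prop)
    (f : LatticeLoop → Ω → ℝ≥0∞) (hf : ∀ L, AEMeasurable (f L) P) :
    ∫⁻ ω, ∑' L : {L : LatticeLoop // Q L}, f L.1 ω ∂P
      = ∑' L : {L : LatticeLoop // Q L}, ∫⁻ ω, f L.1 ω ∂P :=
  lintegral_tsum fun L => hf L.1

/-- Campbell's formula for the loops which meet an independent random path. -/
lemma lintegral_tsum_meeting {Ω : Type*} [MeasurableSpace Ω] {P : Measure Ω} {D : Set ℂ} {n : ℕ}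
    {γ : Ω → List (ℤ × ℤ)} {N : Ω → LatticeLoop → ℕ} (h : IsLerwWithLoopSoup P D n γ N)
    (Q : LatticeLoop → Prop) (g : LatticeLoop → ℝ≥0∞) :
    ∫⁻ ω, ∑' L : {L : LatticeLoop // L.Inside D n ∧ L.Meets (γ ω) ∧ Q L}, (N ω L.1 : ℝ≥0∞) * g L.1 ∂P
      = ∑' L : {L : LatticeLoop // L.Inside D n ∧ Q L},
          lerwLaw D n {γ | L.1.Meets γ} * loopWeight L.1 * g L.1 := by
  have h1 : ∀ ω, ∑' L : {L : LatticeLoop // L.Inside D n ∧ L.Meets (γ ω) ∧ Q L},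
      (N ω L.1 : ℝ≥0∞) * g L.1
      = ∑' L : {L : LatticeLoop // L.Inside D n ∧ Q L},
        Set.indicator {γ | L.1.Meets γ} 1 (γ ω) * (N ω L.1 : ℝ≥0∞) * g L.1 := by
    intro ω
    have := tsum_meeting_eq D n (γ ω) Q fun L => (N ω L : ℝ≥0∞) * g L
    simp only [mul_assoc]
    exact this
  have h2 : ∀ L : LatticeLoop, AEMeasurable (fun ω =>
      Set.indicator {γ | L.Meets γ} 1 (γ ω) * (N ω L : ℝ≥0∞) * g L) P := fun L =>
    (lintegral_indicator_meets_mul h L).1.mul_const (g L)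
  have h3 : ∀ L : LatticeLoop, ∫⁻ ω, Set.indicator {γ | L.Meets γ} 1 (γ ω) * (N ω L : ℝ≥0∞) * g L ∂P
      = lerwLaw D n {γ | L.Meets γ} * loopWeight L * g L := fun L => by
    rw [lintegral_mul_const'' _ (lintegral_indicator_meets_mul h L).1,
      (lintegral_indicator_meets_mul h L).2]
  exact (lintegral_congr h1).trans
    ((lintegral_tsum_loops _ _ h2).trans (tsum_congr fun L => h3 L.1))

lemma sum_rpow_sub_one_le {a : ℝ} (ha : 0 < a) (ha1 : a ≤ 1) (K : ℕ) :
    ∑ k ∈ Finset.range K, ((k + 1 : ℕ) : ℝ) ^ (a - 1) ≤ 1 / a * (K : ℝ) ^ a := by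
  induction K with
  | zero => simp [Real.zero_rpow ha.ne']
  | succ K ih =>
    rw [Finset.sum_range_succ]
    have hK : (0 : ℝ) < K + 1 := by positivity
    have h1 : (-1 : ℝ) ≤ -1 / (K + 1) := by
      rw [le_div_iff₀ hK]; linarith [(Nat.cast_nonneg K : (0 : ℝ) ≤ K)]
    have h2 := rpow_one_add_le_one_add_mul_self h1 ha.le ha1
    rw [show 1 + -1 / ((K : ℝ) + 1) = K / (K + 1) by field_simp; ring,
      Real.div_rpow (by positivity) hK.le, div_le_iff₀ (by positivity)] at h2
    have h3 : ((K : ℝ) + 1) ^ (a - 1) = (K + 1) ^ a / (K + 1) := Real.rpow_sub_one hK.ne' a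
    have h4 : (1 + a * (-1 / ((K : ℝ) + 1))) * (K + 1) ^ a
        = (K + 1) ^ a - a * ((K + 1) ^ a / (K + 1)) := by ring
    rw [h4] at h2
    have h5 := mul_le_mul_of_nonneg_left h2 (by positivity : 0 ≤ 1 / a)
    have h6 : 1 / a * (((K : ℝ) + 1) ^ a - a * ((K + 1) ^ a / (K + 1)))
        = 1 / a * (K + 1) ^ a - (K + 1) ^ a / (K + 1) := by field_simp
    push_cast at ih ⊢
    rw [h3]
    linarith

/-- Summation of the bounds on the numbers of loops of `k` steps, weighted by the rescaled durations,
over the rescaled durations at most `δ`. -/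
lemma sum_duration_le {n ρ : ℕ} (hn : 1 ≤ n) {δ : ℝ} (hδ : 0 < δ) :
    ∑ i ∈ Finset.range ⌊2 * (n : ℝ) ^ 2 * δ⌋₊, 10 ^ 14 * (ρ : ℝ) ^ 2 * (n : ℝ) ^ (2 - exponent / 2) *
        ((i + 1 : ℕ) : ℝ) ^ (-2 : ℤ) * √(i + 1 : ℕ) ^ (exponent / 2) *
        (((i + 1 : ℕ) : ℝ) / (2 * (n : ℝ) ^ 2))
      ≤ 10 ^ 24 * (ρ : ℝ) ^ 2 * δ ^ (exponent / 2 / 2) := by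
  have ha : 0 < exponent / 2 / 2 := by norm_num [exponent]
  have ha1 : exponent / 2 / 2 ≤ 1 := by norm_num [exponent]
  have hinv : 1 / (exponent / 2 / 2) ≤ 10 ^ 10 := by norm_num [exponent]
  set a := exponent / 2 / 2 with ha_def
  have hp : exponent / 2 = 2 * a := by rw [ha_def]; ring
  have hn0 : (0 : ℝ) < n := by exact_mod_cast hn
  rw [hp]
  have h1 : ∀ i : ℕ, 10 ^ 14 * (ρ : ℝ) ^ 2 * (n : ℝ) ^ (2 - 2 * a) * ((i + 1 : ℕ) : ℝ) ^ (-2 : ℤ) *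
        √(i + 1 : ℕ) ^ (2 * a) * (((i + 1 : ℕ) : ℝ) / (2 * (n : ℝ) ^ 2))
      = 10 ^ 14 / 2 * (ρ : ℝ) ^ 2 * (n : ℝ) ^ (-(2 * a)) * ((i + 1 : ℕ) : ℝ) ^ (a - 1) := by
    intro i
    have hi : (0 : ℝ) < (i + 1 : ℕ) := by positivity
    set y : ℝ := ((i + 1 : ℕ) : ℝ)
    rw [Real.sqrt_eq_rpow, ← Real.rpow_mul hi.le, show 1 / 2 * (2 * a) = a by ring,
      Real.rpow_sub hn0, Real.rpow_two, Real.rpow_sub_one hi.ne', zpow_neg,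
      show y ^ (2 : ℤ) = y ^ 2 from zpow_ofNat _ 2, Real.rpow_neg hn0.le]
    field_simp
  simp only [h1]
  rw [← Finset.mul_sum]
  set K := ⌊2 * (n : ℝ) ^ 2 * δ⌋₊
  have h2 : (K : ℝ) ^ a ≤ 2 * (n : ℝ) ^ (2 * a) * δ ^ a := by
    have hK : (K : ℝ) ≤ 2 * (n : ℝ) ^ 2 * δ := Nat.floor_le (by positivity)
    refine (Real.rpow_le_rpow (by positivity) hK ha.le).trans ?_
    rw [Real.mul_rpow (by positivity) hδ.le, Real.mul_rpow (by norm_num) (by positivity),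
      Real.rpow_mul hn0.le, Real.rpow_two]
    gcongr
    exact Real.rpow_le_self_of_one_le (by norm_num) ha1
  calc 10 ^ 14 / 2 * (ρ : ℝ) ^ 2 * (n : ℝ) ^ (-(2 * a)) *
        ∑ i ∈ Finset.range K, ((i + 1 : ℕ) : ℝ) ^ (a - 1)
      ≤ 10 ^ 14 / 2 * (ρ : ℝ) ^ 2 * (n : ℝ) ^ (-(2 * a)) *
        (10 ^ 10 * (2 * (n : ℝ) ^ (2 * a) * δ ^ a)) := by
        gcongr
        exact (sum_rpow_sub_one_le ha ha1 K).trans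
          (mul_le_mul hinv h2 (by positivity) (by norm_num))
    _ = 10 ^ 24 * (ρ : ℝ) ^ 2 * δ ^ a * ((n : ℝ) ^ (-(2 * a)) * (n : ℝ) ^ (2 * a)) := by ring
    _ = 10 ^ 24 * (ρ : ℝ) ^ 2 * δ ^ a := by
        rw [← Real.rpow_add hn0, neg_add_cancel, Real.rpow_zero, mul_one]

lemma tsum_small_le {D : Set ℂ} {n : ℕ} (hn : 1 ≤ n) (δ : ℝ) (w : LatticeLoop → ℝ≥0∞) :
    ∑' L : {L : LatticeLoop // L.Inside D n ∧ L.rescaledDuration n ≤ δ},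
        w L.1 * ENNReal.ofReal (L.1.rescaledDuration n) ≤
      ∑ i ∈ Finset.range ⌊2 * (n : ℝ) ^ 2 * δ⌋₊,
        (∑' L : {L : LatticeLoop // L.Inside D n ∧ L.duration = i + 1}, w L.1) *
          ENNReal.ofReal (((i + 1 : ℕ) : ℝ) / (2 * (n : ℝ) ^ 2)) := by
  classical
  have hn0 : (0 : ℝ) < n := by exact_mod_cast hn
  have h1 : ∀ i : ℕ, (∑' L : {L : LatticeLoop // L.Inside D n ∧ L.duration = i + 1}, w L.1) *
        ENNReal.ofReal (((i + 1 : ℕ) : ℝ) / (2 * (n : ℝ) ^ 2))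
      = ∑' L, Set.indicator {L : LatticeLoop | L.Inside D n ∧ L.duration = i + 1} w L *
        ENNReal.ofReal (((i + 1 : ℕ) : ℝ) / (2 * (n : ℝ) ^ 2)) := fun i => by
    rw [ENNReal.tsum_mul_right]
    congr 1
    exact tsum_subtype {L : LatticeLoop | L.Inside D n ∧ L.duration = i + 1} w
  simp only [h1]
  rw [← Summable.tsum_finsetSum fun _ _ => ENNReal.summable]
  refine (tsum_subtype {L : LatticeLoop | L.Inside D n ∧ L.rescaledDuration n ≤ δ}
    fun L => w L * ENNReal.ofReal (L.rescaledDuration n)).trans_le (ENNReal.tsum_le_tsum fun L => ?_)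
  refine Set.indicator_apply_le' (fun hL => ?_) fun _ => zero_le
  have hpos : 0 < L.duration := L.length_pos
  have hK : L.duration - 1 ∈ Finset.range ⌊2 * (n : ℝ) ^ 2 * δ⌋₊ := by
    rw [Finset.mem_range]
    have h2 := hL.2
    rw [LatticeLoop.rescaledDuration, div_le_iff₀ (by positivity), mul_comm] at h2
    have := Nat.le_floor h2
    omega
  refine le_trans (le_of_eq ?_) (Finset.single_le_sum (f := fun i : ℕ =>
    Set.indicator {L : LatticeLoop | L.Inside D n ∧ L.duration = i + 1} w L *
      ENNReal.ofReal (((i + 1 : ℕ) : ℝ) / (2 * (n : ℝ) ^ 2))) (fun _ _ => zero_le) hK)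
  have h3 : L.duration - 1 + 1 = L.duration := by omega
  simp only [h3]
  rw [Set.indicator_of_mem (show L ∈ {L' : LatticeLoop | L'.Inside D n ∧ L'.duration = L.duration}
    from ⟨hL.1, rfl⟩), LatticeLoop.rescaledDuration]

end SquareLattice

end

theorem proposition6p13 (D : Set ℂ) (hD_open : IsOpen D) (hD_sc : IsSimplyConnected D)
    (hD_bdd : Bornology.IsBounded D) (hD_zero : (0 : ℂ) ∈ D) :
    ∃ ν : ℝ, 0 < ν ∧
      (∃ C : ℝ, ∀ n k : ℕ, 1 ≤ n → 1 ≤ k →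
        ∀ {Ω : Type*} [MeasurableSpace Ω] (P : Measure Ω) [IsProbabilityMeasure P]
          (γ : Ω → List (ℤ × ℤ)) (N : Ω → LatticeLoop → ℕ),
          IsLerwWithLoopSoup P D n γ N →
            ∫⁻ ω, numLoopsMeeting D n (γ ω) (N ω) k ∂P ≤
              ENNReal.ofReal (C * (n : ℝ) ^ (2 - ν) * (k : ℝ) ^ (-2 : ℤ) *
                max (Real.sqrt k) (Real.log n) ^ ν)) ∧
      (∃ C : ℝ, ∀ n : ℕ, 1 ≤ n → ∀ δ : ℝ, 0 < δ →
        ∀ {Ω : Type*} [MeasurableSpace Ω] (P : Measure Ω) [IsProbabilityMeasure P]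
          (γ : Ω → List (ℤ × ℤ)) (N : Ω → LatticeLoop → ℕ),
          IsLerwWithLoopSoup P D n γ N →
            ∫⁻ ω, timeOnSmallLoops D n (γ ω) (N ω) δ ∂P ≤
              ENNReal.ofReal (C * (Real.posLog (Real.log n) * Real.log n ^ ν * (n : ℝ) ^ (-ν) +
                δ ^ (ν / 2)))) := by
  obtain ⟨ρ, hρ, hD⟩ : ∃ ρ : ℕ, 1 ≤ ρ ∧ ∀ z ∈ D, |z.re| ≤ ρ ∧ |z.im| ≤ ρ := by
    obtain ⟨R, hR⟩ := hD_bdd.exists_norm_le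
    have h : ∀ z ∈ D, ‖z‖ ≤ (⌈R⌉₊ + 1 : ℕ) := fun z hz => by
      push_cast
      linarith [hR z hz, Nat.le_ceil R]
    exact ⟨⌈R⌉₊ + 1, by omega, fun z hz =>
      ⟨(Complex.abs_re_le_norm z).trans (h z hz), (Complex.abs_im_le_norm z).trans (h z hz)⟩⟩
  have hν : 0 < SquareLattice.exponent / 2 := by norm_num [SquareLattice.exponent]
  refine ⟨SquareLattice.exponent / 2, hν, ⟨10 ^ 14 * ρ ^ 2, ?_⟩, ⟨10 ^ 24 * ρ ^ 2, ?_⟩⟩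
  · intro n k hn hk Ω _ P _ γ N h
    have h1 := SquareLattice.lintegral_tsum_meeting h (fun L => L.duration = k) fun _ => 1
    simp only [mul_one] at h1
    refine h1.trans_le ((SquareLattice.tsum_loops_le hD_open hD_sc hn hρ hD hD_zero hk).trans ?_)
    refine ENNReal.ofReal_le_ofReal ?_
    gcongr
    exact le_max_left _ _
  · intro n hn δ hδ Ω _ P _ γ N h
    refine (SquareLattice.lintegral_tsum_meeting h (fun L => L.rescaledDuration n ≤ δ)
      fun L => ENNReal.ofReal (L.rescaledDuration n)).trans_le ?_
    refine (SquareLattice.tsum_small_le hn δ fun L => lerwLaw D n {γ | L.Meets γ} * loopWeight L).trans ?_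
    refine (Finset.sum_le_sum fun i _ => mul_le_mul_left
      (SquareLattice.tsum_loops_le hD_open hD_sc hn hρ hD hD_zero (Nat.le_add_left 1 i)) _).trans ?_
    have hmul : ∀ (y : ℝ) (i : ℕ), ENNReal.ofReal y *
        ENNReal.ofReal (((i + 1 : ℕ) : ℝ) / (2 * (n : ℝ) ^ 2))
        = ENNReal.ofReal (y * (((i + 1 : ℕ) : ℝ) / (2 * (n : ℝ) ^ 2))) := fun y i =>
      (ENNReal.ofReal_mul' (by positivity)).symm
    simp only [hmul]
    rw [← ENNReal.ofReal_sum_of_nonneg fun _ _ => by positivity]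
    refine ENNReal.ofReal_le_ofReal ((SquareLattice.sum_duration_le hn hδ).trans ?_)
    -- The bound holds without the first term, which is nonnegative.
    refine mul_le_mul_of_nonneg_left (le_add_of_nonneg_left ?_) (by positivity)
    have hlog : 0 ≤ Real.log n := Real.log_natCast_nonneg n
    have := Real.posLog_nonneg (x := Real.log n)
    positivity
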